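/- Write $\mathbb R^{d}$ for Euclidean space, $o_p(1)$ for convergence to $0$ in (outer) probability as $T\to\infty$, and $\mathcal U=\mathcal U_T=[\delta_T,1-\delta_T]$ with $0<\delta_T<1/2$, $\delta_T=o(1)$. Let $\Theta\subset\mathbb R^{d_\theta}$ and $\Gamma\subset\mathbb R^{d_\rho}$ be compact, $d_\rho\ge d_\theta$. **Structural model.** Let $(\nu_t)_{t\in\mathbb Z}$ and $(\tilde\nu_t)_{t\in\mathbb Z}$ (simulated) be i.i.d. with the same known law on a measurable space, and write $x_t=(\nu_t,\nu_{t-1},\dots)$, $\tilde x_t=(\tilde\nu_t,\tilde\nu_{t-1},\dots)$. For $\theta\in\Theta$, $u\in[0,1]$ put $$y_{u,t}(\theta)=r(\varphi(x_t;\theta);\theta),\qquad z_{u,t}(\theta)=\zeta(x_t;u,\theta)\in\mathbb R^{d_z},$$ and let $\tilde y_{u,t}(\theta),\tilde z_{u,t}(\theta)$ be the same expressions in $\tilde x_t$. Here $\varphi(\cdot;\theta)$ and $\zeta(\cdot;u,\theta)$ are measurable; on an open neighbourhood of $\Theta$, $r$ (jointly in its real argument and $\theta$) and, for almost every history $x$,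 $\varphi(x;\cdot)$ are real-valued and $C^2$ with second derivatives bounded uniformly (also in $x$); for almost every $x$, $\zeta(x;u,\theta)$ is continuous in $(u,\theta)\in[0,1]\times\Theta$. For every $\theta\in\Theta$, $(y_{u,t}(\theta))_t$ has finite second moments, constant mean and shift-invariant covariances. The true curve $\theta_0:[0,1]\to\Theta$ is twice differentiable on $(0,1)$ with bounded second derivative; put $y_{u,t}=y_{u,t}(\theta_0(u))$, $z_{u,t}=z_{u,t}(\theta_0(u))$. **Observed data.** The arrays of random variables $Y_{t,T}\in\mathbb R$, $Z_{t,T}\in\mathbb R^{d_z}$ ($1\le t\le T$) are locally stationary with stationary approximations $y_{u,t}$, $z_{u,t}$: for each of them, almost surely $\max_{1\le t\le T}|X_{t,T}-x_{t/T,t}|\le C_T/T$ for every $T$, with random variables $C_T$ such that $\sup_TE|C_T|^{\eta}<\infty$ for some $\eta>0$. The array $(Y_{t,T},Z_{t,T})$ is $\phi$-mixing: $\phi(k)=\sup|P(B\mid A)-P(B)|$, over $1\le t\le T$, $A\in\sigma((Y_{i,T},Z_{i,T}):i\le t)$ with $P(A)>0$ and $B\in\sigma((Y_{i,T},Z_{i,T}):i\ge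 t+k)$, tends to $0$ as $k\to\infty$, and for some integers $1\le m_T\le T$ the sequence $T\phi(m_T)/m_T$ is bounded. **Kernel and bandwidth.** $K\ge0$ is symmetric, bounded, Lipschitz, $\int K=1$, $\int K^2<\infty$, $|x|K(x)\to0$ as $|x|\to\infty$; for some $k\ge2$, $K$ is $C^k$, $\int|x|^k|K|<\infty$, $\int x^iK=0$ for $1\le i<k$ and $\int x^kK\ne0$; and either $K$ has compact support, or $K'$ is bounded with $|K'(x)|\le C|x|^{-v}$ for $|x|>L$, some $v>1$. The bandwidth $h=h_T>0$ satisfies $h\to0$, $Th\to\infty$, $Th/(m_T\log T)\to\infty$. **Auxiliary model.** The auxiliary (working, possibly misspecified) model is the nonlinear regression $Y_{t,T}=f(Z_{t,T};\rho(t/T))+\eta_t$; it enters only through the least squares criteria $$M_T[\rho;u]=\frac1{Th}\sum_{t=1}^T\bigl(Y_{t,T}-f(Z_{t,T};\rho)\bigr)^2K\Bigl(\frac{u-t/T}{h}\Bigr),\qquad \tilde M_T[\rho;u,\theta]=\frac1T\sum_{t=1}^T\bigl(\tilde y_{u,t}(\theta)-f(\tilde z_{u,t}(\theta);\rho)\bigr)^2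 .$$ The function $f(\cdot;\rho)$ is measurable and $|f(z;\rho_1)-f(z;\rho_2)|\le b(z)\|\rho_1-\rho_2\|_\infty$ for $\rho_1,\rho_2\in\Gamma$. The loss $(y,z,\rho)\mapsto(y-f(z;\rho))^2$ is twice continuously differentiable with bounded first and second derivatives on a set $D\times V$, with $V\supseteq\Gamma$ open and $D\subseteq\mathbb R\times\mathbb R^{d_z}$ open and convex, such that $(Y_{t,T},Z_{t,T})\in D$ almost surely for all $1\le t\le T$ and, almost surely, $(\tilde y_{u,t}(\theta),\tilde z_{u,t}(\theta))\in D$ for all $u\in[0,1]$, $\theta\in\Theta$. **Limits.** For all $u\in[0,1]$, $\theta\in\Theta$, $\rho\in\Gamma$ the limits $\mathbb M_0[\rho;u]=\lim_TE\,M_T[\rho;u]$ and $\tilde{\mathbb M}_0[\rho;u,\theta]=\lim_T\frac1T\sum_{t\le T}E(\tilde y_{u,t}(\theta)-f(\tilde z_{u,t}(\theta);\rho))^2$ exist. For every $u\in[0,1]$, $\rho_0(u)$ minimizes $\mathbb M_0[\cdot;u]$ over $\Gamma$ and for every $\varepsilon>0$ there is $\eta>0$ with $\mathbb M_0[\rho;u]-\mathbb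 M_0[\rho_0(u);u]\ge\eta$ for all $\rho\in\Gamma$ with $\|\rho-\rho_0(u)\|>\varepsilon$. For every $u\in[0,1]$ and $\theta\in\Theta$, $\rho_0(u;\theta)$ is the unique minimizer of $\tilde{\mathbb M}_0[\cdot;u,\theta]$ over $\Gamma$, and $\theta\mapsto\rho_0(u;\theta)$ is continuous and injective on $\Theta$. Finally, there is $\varepsilon_0>0$ such that for every $\varepsilon>0$ there are $a_1,a_2>0$ with $$\bigl|E(y_{u_1,t}-f(z_{u_1,t};\rho_1))^2-E(y_{u_2,t}-f(z_{u_2,t};\rho_2))^2\bigr|\le\varepsilon$$ for all $t$, whenever $u_1,u_2\in[0,1]$, $\rho_1,\rho_2\in\Gamma$, $\|\rho_1-\rho_0(u_1)\|\le\varepsilon_0$, $|u_2-u_1|\le a_1$, $\|\rho_2-\rho_1\|\le a_2$. **Conclusion.** For any choice of minimizers $\hat\rho(u)\in\operatorname{argmin}_{\rho\in\Gamma}M_T[\rho;u]$ and $\hat\rho(u;\theta)\in\operatorname{argmin}_{\rho\in\Gamma}\tilde M_T[\rho;u,\theta]$, $$\sup_{u\in\mathcal U_T}\|\hat\rho(u)-\rho_0(u)\|=o_p(1)\qquad\text{and}\qquad\sup_{u\in\mathcal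 U_T}\sup_{\theta\in\Theta}\|\hat\rho(u;\theta)-\rho_0(u;\theta)\|=o_p(1).$$ -/

import Mathlib

open MeasureTheory ProbabilityTheory Filter Topology Set
open scoped ENNReal

namespace LocalII

/-- Euclidean space of dimension `d`. -/
abbrev Vec (d : ℕ) := EuclideanSpace ℝ (Fin d)

section Processes

variable {Ω : Type*} [MeasurableSpace Ω] {S : Type*} {E : Type*} {F : Type*}

/-- The history `(ν_t, ν_{t-1}, ν_{t-2}, …)` of an innovation process at time `t`. -/
def history (ν : ℤ → Ω → S) (t : ℤ) (ω : Ω) : ℕ → S := fun j => ν (t - j) ω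

/-- `X` converges to zero in probability, `X_T = o_p(1)`, for `[0, ∞]`-valued `X_T`
(in outer probability if `X_T` is not measurable). -/
def IsLittleOP (μ : Measure Ω) (X : ℕ → Ω → ℝ≥0∞) : Prop :=
  ∀ ε : ℝ≥0∞, 0 < ε → Tendsto (fun T => μ {ω | ε ≤ X T ω}) atTop (𝓝 0)

/-- The process is i.i.d. with marginal distribution `law`. -/
structure IsIID [MeasurableSpace S] (μ : Measure Ω) (law : Measure S) (ν : ℤ → Ω → S) :
    Prop where
  measurable : ∀ t, Measurable (ν t)
  map_eq : ∀ t, μ.map (ν t) = law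
  indep : iIndepFun ν μ

/-- Strict stationarity: the law of the whole path is invariant under time shifts. -/
def IsStrictlyStationary [MeasurableSpace E] (μ : Measure Ω) (x : ℤ → Ω → E) : Prop :=
  ∀ k : ℤ, μ.map (fun ω (t : ℤ) => x (t + k) ω) = μ.map (fun ω (t : ℤ) => x t ω)

/-- The triangular array `X_{t,T}`, `1 ≤ t ≤ T`, is locally stationary with stationary
approximations `x_{u,t}`, `u ∈ [0,1]`: almost surely
`max_{1≤t≤T} |X_{t,T} - x_{t/T,t}| ≤ C_T / T`, where `sup_T E |C_T|^η < ∞` for some `η > 0`. -/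
def IsLocallyStationary [NormedAddCommGroup E] [MeasurableSpace E] (μ : Measure Ω)
    (X : ℕ → ℕ → Ω → E) (x : ℝ → ℤ → Ω → E) : Prop :=
  (∀ u ∈ Icc (0 : ℝ) 1, IsStrictlyStationary μ (x u)) ∧
  ∃ C : ℕ → Ω → ℝ, (∀ T, Measurable (C T)) ∧
    (∃ η : ℝ, 0 < η ∧ ∃ B : ℝ≥0∞, B < ∞ ∧ ∀ T, 1 ≤ T → ∫⁻ ω, ‖C T ω‖ₑ ^ η ∂μ ≤ B) ∧
    ∀ T : ℕ, 1 ≤ T → ∀ᵐ ω ∂μ, ∀ t ∈ Finset.Icc 1 T,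
      ‖X T t ω - x ((t : ℝ) / T) (t : ℤ) ω‖ ≤ C T ω / T

/-- The σ-field generated by `(Y_{i,T}, Z_{i,T})`, `i ∈ {a, …, b}`. -/
abbrev sigmaField [MeasurableSpace E] [MeasurableSpace F] (Y : ℕ → ℕ → Ω → E)
    (Z : ℕ → ℕ → Ω → F) (T a b : ℕ) : MeasurableSpace Ω :=
  ⨆ i ∈ Finset.Icc a b, MeasurableSpace.comap (fun ω => (Y T i ω, Z T i ω)) inferInstance

/-- The `φ`-mixing coefficient of the array: the supremum of `|P(B | A) - P(B)|` over all
`1 ≤ t ≤ T`, `A` in the past up to `t` with `P(A) > 0`, and `B` in the future from `t + k`. -/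
noncomputable def phiCoeff [MeasurableSpace E] [MeasurableSpace F] (μ : Measure Ω)
    (Y : ℕ → ℕ → Ω → E) (Z : ℕ → ℕ → Ω → F) (k : ℕ) : ℝ :=
  sSup {x : ℝ | ∃ (T t : ℕ) (A B : Set Ω), 1 ≤ t ∧ t ≤ T ∧
    MeasurableSet[sigmaField Y Z T 1 t] A ∧ MeasurableSet[sigmaField Y Z T (t + k) T] B ∧
    0 < μ A ∧ x = |μ.real (B ∩ A) / μ.real A - μ.real B|}

/-- The array is `φ`-mixing, with block lengths `m_T ∈ {1, …, T}` such that
`T φ(m_T) / m_T` is bounded. -/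
structure IsPhiMixing [MeasurableSpace E] [MeasurableSpace F] (μ : Measure Ω)
    (Y : ℕ → ℕ → Ω → E) (Z : ℕ → ℕ → Ω → F) (m : ℕ → ℕ) : Prop where
  tendsto : Tendsto (phiCoeff μ Y Z) atTop (𝓝 0)
  one_le : ∀ T, 1 ≤ T → 1 ≤ m T
  le : ∀ T, 1 ≤ T → m T ≤ T
  bound : ∃ C : ℝ, ∀ T : ℕ, 1 ≤ T → T * phiCoeff μ Y Z (m T) / m T ≤ C

end Processes

section Structural

variable {Ω : Type*} [MeasurableSpace Ω] {S : Type*} [MeasurableSpace S] {p dz : ℕ}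

/-- The structural output `r(φ(x; θ); θ)`, where `x` is a history of innovations. -/
def structY (r : ℝ × Vec p → ℝ) (φ : (ℕ → S) → Vec p → ℝ) (x : ℕ → S) (θ : Vec p) : ℝ :=
  r (φ x θ, θ)

/-- Smoothness of the parameter curve: twice differentiable with bounded second derivative on
`(0,1)`, the union of the intervals `[δ_T, 1 - δ_T]`, `δ_T → 0`. -/
def SmoothCurve (θ₀ : ℝ → Vec p) : Prop :=
  ∃ C : ℝ, ∀ u ∈ Ioo (0 : ℝ) 1, DifferentiableAt ℝ θ₀ u ∧
    DifferentiableAt ℝ (deriv θ₀) u ∧ ‖deriv (deriv θ₀) u‖ ≤ C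

/-- Smoothness of the structural functions: on an open neighbourhood `V` of `Θ`, `r` is `C²`
with bounded second derivatives and, for almost every history `x` of innovations, so is `φ(x; ·)`,
with a bound that does not depend on `x`; the regressors depend continuously on `(u, θ)`. -/
structure SmoothStructure (law : Measure S) [IsProbabilityMeasure law] (Θ : Set (Vec p))
    (r : ℝ × Vec p → ℝ) (φ : (ℕ → S) → Vec p → ℝ) (ζ : (ℕ → S) → ℝ → Vec p → Vec dz) :
    Prop where
  measurable_φ : ∀ θ ∈ Θ, Measurable (fun x => φ x θ)
  measurable_ζ : ∀ u ∈ Icc (0 : ℝ) 1, ∀ θ ∈ Θ, Measurable (fun x => ζ x u θ)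
  smooth : ∃ V : Set (Vec p), IsOpen V ∧ Θ ⊆ V ∧ ∃ C : ℝ,
    ContDiffOn ℝ 2 r (univ ×ˢ V) ∧
    (∀ q ∈ (univ : Set ℝ) ×ˢ V, ‖iteratedFDeriv ℝ 2 r q‖ ≤ C) ∧
    ∀ᵐ x ∂(Measure.infinitePi fun _ : ℕ => law),
      ContDiffOn ℝ 2 (φ x) V ∧ ∀ θ ∈ V, ‖iteratedFDeriv ℝ 2 (φ x) θ‖ ≤ C
  continuous_ζ : ∀ᵐ x ∂(Measure.infinitePi fun _ : ℕ => law),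
    ContinuousOn (fun q : ℝ × Vec p => ζ x q.1 q.2) (Icc 0 1 ×ˢ Θ)

/-- Weak (second-order) stationarity: finite second moments, constant mean, and
shift-invariant covariances. -/
structure IsWeaklyStationary (μ : Measure Ω) (y : ℤ → Ω → ℝ) : Prop where
  memLp : ∀ t, MemLp (y t) 2 μ
  mean : ∃ c : ℝ, ∀ t, ∫ ω, y t ω ∂μ = c
  cov : ∀ t s k : ℤ, cov[y t, y s; μ] = cov[y (t + k), y (s + k); μ]

end Structural

section Auxiliary

variable {Ω : Type*} [MeasurableSpace Ω] {S : Type*} [MeasurableSpace S] {p dz dρ : ℕ}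

/-- Squared regression residual `(y - f(z; ρ))²`. -/
def sqLoss (f : Vec dz → Vec dρ → ℝ) (y : ℝ) (z : Vec dz) (ρ : Vec dρ) : ℝ := (y - f z ρ) ^ 2

/-- The local least squares criterion
`M_T[ρ; u] = (T h)⁻¹ ∑_{t=1}^T (Y_{t,T} - f(Z_{t,T}; ρ))² K((u - t/T)/h)`. -/
noncomputable def localCriterion (f : Vec dz → Vec dρ → ℝ) (K : ℝ → ℝ) (h : ℕ → ℝ)
    (Y : ℕ → ℕ → Ω → ℝ) (Z : ℕ → ℕ → Ω → Vec dz) (T : ℕ) (u : ℝ) (ω : Ω) (ρ : Vec dρ) : ℝ :=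
  1 / (T * h T) * ∑ t ∈ Finset.Icc 1 T,
    sqLoss f (Y T t ω) (Z T t ω) ρ * K ((u - (t : ℝ) / T) / h T)

/-- The least squares criterion `T⁻¹ ∑_{t=1}^T (y_t - f(z_t; ρ))²` of simulated series. -/
noncomputable def simCriterion (f : Vec dz → Vec dρ → ℝ) (y : ℤ → Ω → ℝ) (z : ℤ → Ω → Vec dz)
    (T : ℕ) (ω : Ω) (ρ : Vec dρ) : ℝ :=
  1 / (T : ℝ) * ∑ t ∈ Finset.Icc 1 T, sqLoss f (y (t : ℤ) ω) (z (t : ℤ) ω) ρ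

/-- `ρ` minimizes `M` over `Γ`. -/
def IsArgmin (M : Vec dρ → ℝ) (Γ : Set (Vec dρ)) (ρ : Vec dρ) : Prop := ρ ∈ Γ ∧ IsMinOn M Γ ρ

/-- The regression function is measurable in `z` and Lipschitz in `ρ`, locally in `z`:
`|f(z; ρ₁) - f(z; ρ₂)| ≤ b(z) ‖ρ₁ - ρ₂‖_∞`. -/
structure IsRegressionFunction (Γ : Set (Vec dρ)) (f : Vec dz → Vec dρ → ℝ) : Prop where
  measurable : ∀ ρ ∈ Γ, Measurable (fun z => f z ρ)
  lipschitz : ∃ b : Vec dz → ℝ, ∀ z, ∀ ρ₁ ∈ Γ, ∀ ρ₂ ∈ Γ,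
    |f z ρ₁ - f z ρ₂| ≤ b z * ‖WithLp.ofLp ρ₁ - WithLp.ofLp ρ₂‖

/-- The squared residual, as a function of all its arguments `(y, z, ρ)`, is twice continuously
differentiable with bounded first and second derivatives. As no regression loss has these
properties on the whole space, they are asked for on an open set `D × V`, where `V` contains `Γ`
and the convex set `D` carries the observed variables, their stationary approximations and the
simulated variables. -/
def SmoothBoundedLoss (μ : Measure Ω) (law : Measure S) [IsProbabilityMeasure law]
    (Θ : Set (Vec p)) (Γ : Set (Vec dρ)) (r : ℝ × Vec p → ℝ) (φ : (ℕ → S) → Vec p → ℝ)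
    (ζ : (ℕ → S) → ℝ → Vec p → Vec dz) (Y : ℕ → ℕ → Ω → ℝ) (Z : ℕ → ℕ → Ω → Vec dz)
    (f : Vec dz → Vec dρ → ℝ) : Prop :=
  ∃ (D : Set (ℝ × Vec dz)) (V : Set (Vec dρ)) (C : ℝ),
    IsOpen D ∧ Convex ℝ D ∧ IsOpen V ∧ Γ ⊆ V ∧
    (∀ T t : ℕ, 1 ≤ t → t ≤ T → ∀ᵐ ω ∂μ, (Y T t ω, Z T t ω) ∈ D) ∧
    (∀ᵐ x ∂(Measure.infinitePi fun _ : ℕ => law), ∀ u ∈ Icc (0 : ℝ) 1, ∀ θ ∈ Θ,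
      (structY r φ x θ, ζ x u θ) ∈ D) ∧
    ContDiffOn ℝ 2 (fun q : (ℝ × Vec dz) × Vec dρ => sqLoss f q.1.1 q.1.2 q.2) (D ×ˢ V) ∧
    ∀ q ∈ D ×ˢ V, ∀ k ∈ ({1, 2} : Set ℕ),
      ‖iteratedFDeriv ℝ k
        (fun q : (ℝ × Vec dz) × Vec dρ => sqLoss f q.1.1 q.1.2 q.2) q‖ ≤ C

/-- `ρ₀` is a well-separated minimizer of `M` over `Γ`: it minimizes `M`, and for every `ε > 0`
the infimum of `M` over the points of `Γ` further than `ε` from `ρ₀` exceeds `M(ρ₀)`. -/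
def IsWellSeparatedMin (M : Vec dρ → ℝ) (Γ : Set (Vec dρ)) (ρ₀ : Vec dρ) : Prop :=
  IsArgmin M Γ ρ₀ ∧
    ∀ ε : ℝ, 0 < ε → ∃ η : ℝ, 0 < η ∧ ∀ ρ ∈ Γ, ε < ‖ρ - ρ₀‖ → η ≤ M ρ - M ρ₀

/-- Uniform equicontinuity of `(u, ρ) ↦ E (y_{u,t} - f(z_{u,t}; ρ))²` near the curve `ρ₀`. -/
def EquicontinuousLoss (μ : Measure Ω) (Γ : Set (Vec dρ)) (f : Vec dz → Vec dρ → ℝ)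
    (y : ℝ → ℤ → Ω → ℝ) (z : ℝ → ℤ → Ω → Vec dz) (ρ₀ : ℝ → Vec dρ) : Prop :=
  ∃ ε₀ : ℝ, 0 < ε₀ ∧ ∀ ε : ℝ, 0 < ε → ∃ a₁ a₂ : ℝ, 0 < a₁ ∧ 0 < a₂ ∧
    ∀ t : ℤ, ∀ u₁ ∈ Icc (0 : ℝ) 1, ∀ u₂ ∈ Icc (0 : ℝ) 1, ∀ ρ₁ ∈ Γ, ∀ ρ₂ ∈ Γ,
      ‖ρ₁ - ρ₀ u₁‖ ≤ ε₀ → |u₂ - u₁| ≤ a₁ → ‖ρ₂ - ρ₁‖ ≤ a₂ →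
      |∫ ω, sqLoss f (y u₁ t ω) (z u₁ t ω) ρ₁ ∂μ - ∫ ω, sqLoss f (y u₂ t ω) (z u₂ t ω) ρ₂ ∂μ| ≤ ε

end Auxiliary

/-- The conditions on the kernel. -/
structure IsKernel (K : ℝ → ℝ) : Prop where
  nonneg : ∀ x, 0 ≤ K x
  symm : ∀ x, K (-x) = K x
  bounded : ∃ B : ℝ, ∀ x, K x ≤ B
  integrable : Integrable K
  integral : ∫ x, K x = 1
  integrable_sq : Integrable (fun x => K x ^ 2)
  tail : ∃ L : ℝ, (∀ x, L < |x| → K x = 0) ∨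
    ∃ C v : ℝ, 1 < v ∧ (∀ x, |deriv K x| ≤ C) ∧ ∀ x, L < |x| → |deriv K x| ≤ C * |x| ^ (-v)
  order : ∃ k : ℕ, 2 ≤ k ∧ ContDiff ℝ k K ∧ Integrable (fun x => |x| ^ k * |K x|) ∧
    (∀ i ∈ Finset.Icc 1 (k - 1), ∫ x, x ^ i * K x = 0) ∧ ∫ x, x ^ k * K x ≠ 0
  decay : Tendsto (fun x => |x| * K x) (cocompact ℝ) (𝓝 0)
  lipschitz : ∃ C : ℝ, ∀ x x', |K x - K x'| ≤ C * |x - x'|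

/-- The conditions on the bandwidth, given the block lengths `m_T` of the mixing condition. -/
structure IsBandwidth (h : ℕ → ℝ) (m : ℕ → ℕ) : Prop where
  pos : ∀ T, 1 ≤ T → 0 < h T
  tendsto_zero : Tendsto h atTop (𝓝 0)
  tendsto_mul : Tendsto (fun T : ℕ => T * h T) atTop atTop
  tendsto_div : Tendsto (fun T : ℕ => T * h T / (m T * Real.log T)) atTop atTop

end LocalII

/-! Both claims follow the argmin scheme: if a random criterion is uniformly close to a
deterministic one whose minimizers are separated uniformly in the index, its minimizers are
uniformly close too. Pointwise separation, or mere uniqueness of the minimizer, becomes uniform by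
compactness as soon as the limit is jointly continuous (`exists_uniform_gap`). The common limit is
`limitLoss`, the expected loss as a function of `(u, θ, ρ)`; it is continuous by dominated
convergence. The domination comes from the loss itself: its derivative in `y` is twice the residual,
so a bounded gradient forces a bounded loss (`regularLoss_of_contDiffOn`).

Simulated data. The criterion is an average of a fixed function along i.i.d. histories. Conditioning
on finitely many coordinates reduces it to finite-range dependence, where Chebyshev applies
(`IsIID.tendsto_measure_avg`); a finite cover of the compact set of `(u, θ, ρ)` makes the law
uniform (`IsIID.highProb_uniform_avg`).

Observed data. The stochastic part is handled by a Hoeffding-type inequality over alternating blocks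
of length `m_T` (`measure_abs_sum_ge_le`). It gives tails of order `T⁻³`, enough for a union bound
over a time grid of mesh `T⁻²` and a finite net of `Γ`. For the expectation, local stationarity
replaces observed losses by stationary ones, and `θ₀`, Lipschitz on `(0,1)`, is replaced by a
continuous extension `g` to `[0,1]`. The expected criterion is then uniformly close to `kernelMass ·
limitLoss (u, g u, ρ)`. The total kernel weight need not be close to `1` near the endpoints, but it
stays between two positive constants, and a positive factor does not move minimizers. The assumed
separation of `M₀` thereby passes to `limitLoss (u, g u, ·)`, and the scheme applies on all of
`[0,1]`. -/

namespace LocalII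

/-! ### Uniform separation of minimizers by compactness. -/

section Separation

/-- A jointly continuous criterion with unique minimizers over compact sets separates the
minimizers uniformly in the index. -/
theorem exists_uniform_gap {A B : Type*} [MetricSpace A] [MetricSpace B] {Q : Set A} {Γ : Set B}
    (hQ : IsCompact Q) (hΓ : IsCompact Γ) {F : A → B → ℝ}
    (hF : ContinuousOn (fun x : A × B => F x.1 x.2) (Q ×ˢ Γ)) {s : A → B}
    (hs : ∀ q ∈ Q, s q ∈ Γ) (huniq : ∀ q ∈ Q, ∀ ρ ∈ Γ, ρ ≠ s q → F q (s q) < F q ρ)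
    {ε : ℝ} (hε : 0 < ε) :
    ∃ η : ℝ, 0 < η ∧ ∀ q ∈ Q, ∀ ρ ∈ Γ, ε ≤ dist ρ (s q) → η ≤ F q ρ - F q (s q) := by
  by_contra! hcon
  have hmin : ∀ q ∈ Q, ∀ ρ ∈ Γ, F q (s q) ≤ F q ρ := fun q hq ρ hρ => by
    by_cases h : ρ = s q
    · rw [h]
    · exact (huniq q hq ρ hρ h).le
  choose q hq ρ hρ hd hlt using fun n : ℕ => hcon (1 / ((n : ℝ) + 1)) (by positivity)
  -- Continuity of `s` is not available, so the values `s (q n)` are carried along as a third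
  -- convergent component. Both limits `σ` and `ρ₁` minimize `F q₀`, hence coincide with `s q₀`,
  -- although they must lie `ε` apart.
  obtain ⟨⟨⟨q₀, ρ₁⟩, σ⟩, hmem, φ, hφ, hlim⟩ :=
    ((hQ.prod hΓ).prod hΓ).tendsto_subseq (x := fun n => ((q n, ρ n), s (q n)))
      (fun n => ⟨⟨hq n, hρ n⟩, hs _ (hq n)⟩)
  obtain ⟨⟨hq₀, hρ₁⟩, hσ⟩ := hmem
  have hqlim : Tendsto (fun n => q (φ n)) atTop (𝓝 q₀) :=
    ((continuous_fst.comp continuous_fst).tendsto _).comp hlim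
  have hρlim : Tendsto (fun n => ρ (φ n)) atTop (𝓝 ρ₁) :=
    ((continuous_snd.comp continuous_fst).tendsto _).comp hlim
  have hσlim : Tendsto (fun n => s (q (φ n))) atTop (𝓝 σ) := (continuous_snd.tendsto _).comp hlim
  have key : ∀ (τ : ℕ → B) (τ₀ : B), (∀ n, τ n ∈ Γ) → τ₀ ∈ Γ → Tendsto τ atTop (𝓝 τ₀) →
      Tendsto (fun n => F (q (φ n)) (τ n)) atTop (𝓝 (F q₀ τ₀)) := by
    intro τ τ₀ hτ hτ₀ hlim
    exact (hF (q₀, τ₀) ⟨hq₀, hτ₀⟩).tendsto.comp (tendsto_nhdsWithin_iff.2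
      ⟨hqlim.prodMk_nhds hlim, Eventually.of_forall fun n => ⟨hq _, hτ n⟩⟩)
  have hσmin : ∀ τ ∈ Γ, F q₀ σ ≤ F q₀ τ := fun τ hτ =>
    le_of_tendsto_of_tendsto (key _ _ (fun n => hs _ (hq _)) hσ hσlim)
      (key (fun _ => τ) τ (fun _ => hτ) hτ tendsto_const_nhds)
      (Eventually.of_forall fun n => hmin _ (hq _) _ hτ)
  have hρ₁le : F q₀ ρ₁ ≤ F q₀ σ := by
    have h1 : Tendsto (fun n => F (q (φ n)) (s (q (φ n))) + 1 / (((φ n : ℕ) : ℝ) + 1)) atTop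
        (𝓝 (F q₀ σ + 0)) :=
      (key _ _ (fun n => hs _ (hq _)) hσ hσlim).add
        (tendsto_one_div_add_atTop_nhds_zero_nat.comp hφ.tendsto_atTop)
    rw [add_zero] at h1
    exact le_of_tendsto_of_tendsto (key _ _ (fun n => hρ _) hρ₁ hρlim) h1
      (Eventually.of_forall fun n => by have := hlt (φ n); simp only; linarith)
  have e1 : σ = s q₀ := by
    by_contra h
    exact absurd (huniq q₀ hq₀ σ hσ h) (not_lt.2 (hσmin _ (hs _ hq₀)))
  have e2 : ρ₁ = s q₀ := by
    by_contra h
    exact absurd (huniq q₀ hq₀ ρ₁ hρ₁ h) (not_lt.2 (hρ₁le.trans (hσmin _ (hs _ hq₀))))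
  have hdist : ε ≤ dist ρ₁ σ :=
    ge_of_tendsto (hρlim.dist hσlim) (Eventually.of_forall fun n => hd _)
  rw [e1, e2, dist_self] at hdist
  linarith

end Separation

/-! ### What bounded derivatives say about the squared loss. -/

section Loss

variable {dz dρ : ℕ}

/-- The properties of a smooth squared loss that the consistency proof uses. -/
structure RegularLoss (D : Set (ℝ × Vec dz)) (Γ : Set (Vec dρ)) (f : Vec dz → Vec dρ → ℝ)
    (B C : ℝ) : Prop where
  le : ∀ w ∈ D, ∀ ρ ∈ Γ, sqLoss f w.1 w.2 ρ ≤ B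
  lipschitz : ∀ w ∈ D, ∀ w' ∈ D, ∀ ρ ∈ Γ,
    |sqLoss f w.1 w.2 ρ - sqLoss f w'.1 w'.2 ρ| ≤ C * ‖w - w'‖
  net : ∀ ε : ℝ, 0 < ε → ∃ F : Finset (Vec dρ), (∀ ρ ∈ F, ρ ∈ Γ) ∧ ∀ ρ ∈ Γ, ∃ ρ' ∈ F, ∀ w ∈ D,
    |sqLoss f w.1 w.2 ρ - sqLoss f w.1 w.2 ρ'| ≤ ε
  continuousOn : ContinuousOn (fun q : (ℝ × Vec dz) × Vec dρ => sqLoss f q.1.1 q.1.2 q.2) (D ×ˢ Γ)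

theorem sqLoss_nonneg (f : Vec dz → Vec dρ → ℝ) (y : ℝ) (z : Vec dz) (ρ : Vec dρ) :
    0 ≤ sqLoss f y z ρ := sq_nonneg _

/-- The partial derivative in `y` is `2 (y - f)`, so the gradient bound gives `4 · loss ≤ C²`.
Convexity of `D` turns the gradient bound into a Lipschitz bound for fixed `ρ`. Since `V` need not
be convex, variation in `ρ` is controlled only inside balls contained in `V`; compactness of `Γ`
extracts the finite net from these balls. -/
theorem regularLoss_of_contDiffOn {D : Set (ℝ × Vec dz)} {V Γ : Set (Vec dρ)}
    {f : Vec dz → Vec dρ → ℝ} {C : ℝ} (hD : IsOpen D) (hDc : Convex ℝ D) (hV : IsOpen V)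
    (hΓ : IsCompact Γ) (hΓV : Γ ⊆ V)
    (hcd : ContDiffOn ℝ 2 (fun q : (ℝ × Vec dz) × Vec dρ => sqLoss f q.1.1 q.1.2 q.2) (D ×ˢ V))
    (hC : ∀ q ∈ D ×ˢ V, ‖iteratedFDeriv ℝ 1
        (fun q : (ℝ × Vec dz) × Vec dρ => sqLoss f q.1.1 q.1.2 q.2) q‖ ≤ C) :
    RegularLoss D Γ f (C ^ 2) C := by
  set ℓ := fun q : (ℝ × Vec dz) × Vec dρ => sqLoss f q.1.1 q.1.2 q.2 with hℓ
  have hdiff : ∀ q ∈ D ×ˢ V, DifferentiableAt ℝ ℓ q := fun q hq =>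
    (hcd.contDiffAt ((hD.prod hV).mem_nhds hq)).differentiableAt (by norm_num)
  have hC' : ∀ q ∈ D ×ˢ V, ‖fderiv ℝ ℓ q‖ ≤ C := fun q hq => by
    rw [← norm_iteratedFDeriv_one]; exact hC q hq
  have hlip : ∀ W ⊆ V, Convex ℝ W → ∀ q ∈ D ×ˢ W, ∀ q' ∈ D ×ˢ W, |ℓ q - ℓ q'| ≤ C * ‖q - q'‖ := by
    intro W hW hWc q hq q' hq'
    have hsub : D ×ˢ W ⊆ D ×ˢ V := prod_mono le_rfl hW
    exact (hDc.prod hWc).norm_image_sub_le_of_norm_fderiv_le (fun x hx => hdiff x (hsub hx))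
      (fun x hx => hC' x (hsub hx)) hq' hq
  refine ⟨?_, ?_, ?_, hcd.continuousOn.mono (prod_mono le_rfl hΓV)⟩
  · intro w hw ρ hρ
    have hq : (w, ρ) ∈ D ×ˢ V := ⟨hw, hΓV hρ⟩
    have h1 : HasDerivAt (fun s : ℝ => ℓ ((w.1 + s, w.2), ρ))
        (fderiv ℝ ℓ (w, ρ) (((1 : ℝ), (0 : Vec dz)), (0 : Vec dρ))) 0 := by
      have hg : HasDerivAt (fun s : ℝ => ((w.1 + s, w.2), ρ))
          (((1 : ℝ), (0 : Vec dz)), (0 : Vec dρ)) (0 : ℝ) :=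
        (((hasDerivAt_id (0 : ℝ)).const_add w.1).prodMk (hasDerivAt_const _ _)).prodMk
          (hasDerivAt_const _ _)
      have hf : HasFDerivAt ℓ (fderiv ℝ ℓ (w, ρ)) ((w.1 + 0, w.2), ρ) := by
        simpa using (hdiff _ hq).hasFDerivAt
      exact hf.comp_hasDerivAt (0 : ℝ) hg
    have h2 : HasDerivAt (fun s : ℝ => ℓ ((w.1 + s, w.2), ρ)) (2 * (w.1 - f w.2 ρ)) 0 := by
      have h3 : HasDerivAt (fun s : ℝ => w.1 + s - f w.2 ρ) 1 0 :=
        ((hasDerivAt_id (0 : ℝ)).const_add w.1).sub_const _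
      have h4 := h3.fun_pow 2
      exact h4.congr_deriv (by norm_num)
    have h4 : |2 * (w.1 - f w.2 ρ)| ≤ C := by
      rw [h2.unique h1, ← Real.norm_eq_abs]
      refine ((fderiv ℝ ℓ (w, ρ)).le_opNorm _).trans ?_
      have : ‖(((1 : ℝ), (0 : Vec dz)), (0 : Vec dρ))‖ = 1 := by simp [Prod.norm_def]
      rw [this, mul_one]
      exact hC' _ hq
    have h5 : (2 * (w.1 - f w.2 ρ)) ^ 2 ≤ C ^ 2 := sq_le_sq' (neg_le_of_abs_le h4) (le_of_abs_le h4)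
    have h6 : 0 ≤ (w.1 - f w.2 ρ) ^ 2 := sq_nonneg _
    unfold sqLoss
    nlinarith
  · intro w hw w' hw' ρ hρ
    have := hlip {ρ} (singleton_subset_iff.2 (hΓV hρ)) (convex_singleton ρ) (w, ρ) ⟨hw, rfl⟩
      (w', ρ) ⟨hw', rfl⟩
    simpa [hℓ, Prod.norm_def] using this
  · intro ε hε
    have hs : ∀ ρ ∈ Γ, ∃ s : ℝ, 0 < s ∧ Metric.ball ρ s ⊆ V ∧ |C| * s ≤ ε := by
      intro ρ hρ
      obtain ⟨s, hs, hsV⟩ := Metric.isOpen_iff.1 hV ρ (hΓV hρ)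
      refine ⟨min s (ε / (|C| + 1)), by positivity, (Metric.ball_subset_ball (min_le_left _ _)).trans
        hsV, ?_⟩
      calc |C| * min s (ε / (|C| + 1)) ≤ |C| * (ε / (|C| + 1)) := by gcongr; exact min_le_right _ _
        _ = ε * (|C| / (|C| + 1)) := by ring
        _ ≤ ε * 1 := by gcongr; rw [div_le_one (by positivity)]; linarith
        _ = ε := mul_one _
    choose! s hs0 hsV hsε using hs
    obtain ⟨F, hF, hcover⟩ := hΓ.elim_nhds_subcover (fun ρ => Metric.ball ρ (s ρ))
      (fun ρ hρ => Metric.ball_mem_nhds ρ (hs0 ρ hρ))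
    refine ⟨F, hF, fun ρ hρ => ?_⟩
    obtain ⟨ρ', hρ', hmem⟩ := mem_iUnion₂.1 (hcover hρ)
    refine ⟨ρ', hρ', fun w hw => ?_⟩
    have h0 := hs0 ρ' (hF _ hρ')
    have := hlip _ (hsV ρ' (hF _ hρ')) (convex_ball _ _) (w, ρ) ⟨hw, hmem⟩ (w, ρ')
      ⟨hw, Metric.mem_ball_self h0⟩
    refine this.trans ?_
    have h7 : ‖(w, ρ) - (w, ρ')‖ ≤ s ρ' := by
      have : ‖ρ - ρ'‖ ≤ s ρ' := by rw [← dist_eq_norm]; exact (Metric.mem_ball.1 hmem).le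
      simpa [Prod.norm_def, h0.le] using this
    calc C * ‖(w, ρ) - (w, ρ')‖ ≤ |C| * s ρ' := by
          gcongr; exact le_abs_self C
      _ ≤ ε := hsε ρ' (hF _ hρ')

end Loss

/-! ### Weak law of large numbers along i.i.d. histories. -/

section History

variable {Ω : Type*} [MeasurableSpace Ω] {μ : Measure Ω}
  {S : Type*} [MeasurableSpace S] {law : Measure S} {ν : ℤ → Ω → S}

theorem IsIID.measurable_history (hν : IsIID μ law ν) (t : ℤ) : Measurable (history ν t) :=
  measurable_pi_iff.2 fun _ => hν.measurable _

theorem IsIID.map_history (hν : IsIID μ law ν) (t : ℤ) :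
    μ.map (history ν t) = Measure.infinitePi fun _ : ℕ => law := by
  have hinj : Function.Injective fun j : ℕ => t - (j : ℤ) := fun a b hab => by
    simpa using hab
  have h := (hν.indep.precomp hinj).map_fun_eq_infinitePi_map fun j => hν.measurable _
  simp only [hν.map_eq] at h
  exact h

theorem IsIID.measurePreserving_history (hν : IsIID μ law ν) (t : ℤ) :
    MeasurePreserving (history ν t) μ (Measure.infinitePi fun _ : ℕ => law) :=
  ⟨hν.measurable_history t, hν.map_history t⟩

/-- The first `n + 1` coordinates of the history at `t` use only the innovations at times in `[t -
n, t]`, and two such windows are disjoint once their right ends differ by more than `n`. -/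
theorem IsIID.indepFun_history (hν : IsIID μ law ν) {n : ℕ} {χ : (Finset.Iic n → S) → ℝ}
    (hχ : Measurable χ) {s t : ℤ} (hst : (n : ℤ) < |s - t|) :
    IndepFun (fun ω => χ (Preorder.frestrictLe (π := fun _ => S) n (history ν s ω)))
      (fun ω => χ (Preorder.frestrictLe (π := fun _ => S) n (history ν t ω))) μ := by
  have hdisj : Disjoint (Finset.Icc (s - n) s) (Finset.Icc (t - n) t) := by
    rw [Finset.disjoint_left]
    intro a ha hb
    simp only [Finset.mem_Icc] at ha hb
    rcases abs_cases (s - t) with h | h <;> omega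
  have hmem : ∀ (t : ℤ) (j : Finset.Iic n), t - (j : ℕ) ∈ Finset.Icc (t - n) t := by
    rintro t ⟨j, hj⟩
    have := Finset.mem_Iic.1 hj
    simp only [Finset.mem_Icc]
    omega
  have hm : ∀ t : ℤ, Measurable
      fun v : (Finset.Icc (t - n) t → S) => χ fun j => v ⟨t - (j : ℕ), hmem t j⟩ := fun t =>
    hχ.comp (measurable_pi_iff.2 fun j => measurable_pi_apply _)
  exact (hν.indep.indepFun_finset _ _ hdisj hν.measurable).comp (hm s) (hm t)

/-- Serves to bound the averaged approximation error by an `L¹` norm, uniformly in `T`. It is an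
inequality only because the left side vanishes at `T = 0`. -/
theorem IsIID.lintegral_avg_le (hν : IsIID μ law ν) {g : (ℕ → S) → ℝ≥0∞} (hg : Measurable g)
    (T : ℕ) :
    ∫⁻ ω, ENNReal.ofReal (1 / (T : ℝ)) * ∑ t ∈ Finset.Icc 1 T, g (history ν (t : ℕ) ω) ∂μ ≤
      ∫⁻ x, g x ∂(Measure.infinitePi fun _ : ℕ => law) := by
  have hm : ∀ t : ℕ, Measurable fun ω => g (history ν t ω) := fun t =>
    hg.comp (hν.measurable_history t)
  rw [lintegral_const_mul _ (Finset.measurable_fun_sum _ fun t _ => hm t),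
    lintegral_finsetSum _ fun t _ => hm t]
  have : ∀ t : ℕ, ∫⁻ ω, g (history ν t ω) ∂μ = ∫⁻ x, g x ∂(Measure.infinitePi fun _ : ℕ => law) :=
    fun t => by rw [← hν.map_history t, lintegral_map hg (hν.measurable_history t)]
  simp only [this, Finset.sum_const, Nat.card_Icc, add_tsub_cancel_right, nsmul_eq_mul]
  rw [← mul_assoc]
  refine mul_le_of_le_one_left zero_le ?_
  rw [← ENNReal.ofReal_natCast, ← ENNReal.ofReal_mul (by positivity)]
  refine ENNReal.ofReal_le_one.2 ?_
  rw [one_div]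
  exact inv_mul_le_one

variable [IsProbabilityMeasure μ]

/-- Covariances vanish beyond lag `n`, so each row of the covariance matrix has at most `2n + 1`
nonzero entries, each at most the common variance. -/
theorem IsIID.variance_sum_le (hν : IsIID μ law ν) {n : ℕ} {χ : (Finset.Iic n → S) → ℝ}
    (hχ : Measurable χ)
    (hL : MemLp (fun x : ℕ → S => χ (Preorder.frestrictLe (π := fun _ => S) n x)) 2
      (Measure.infinitePi fun _ : ℕ => law)) (T : ℕ) :
    Var[∑ t ∈ Finset.Icc 1 T, fun ω =>
        χ (Preorder.frestrictLe (π := fun _ => S) n (history ν (t : ℕ) ω)); μ] ≤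
      T * ((2 * n + 1) * Var[fun x : ℕ → S => χ (Preorder.frestrictLe (π := fun _ => S) n x);
        Measure.infinitePi fun _ : ℕ => law]) := by
  set ψ : (ℕ → S) → ℝ := fun x => χ (Preorder.frestrictLe (π := fun _ => S) n x) with hψ
  set V := Var[ψ; Measure.infinitePi fun _ : ℕ => law]
  set X : ℕ → Ω → ℝ := fun t ω => ψ (history ν t ω) with hX
  have hψm : Measurable ψ := hχ.comp (Preorder.measurable_frestrictLe n)
  have hXL : ∀ t, MemLp (X t) 2 μ := fun t =>
    hL.comp_measurePreserving (hν.measurePreserving_history t)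
  have hV : ∀ t, Var[X t; μ] = V := fun t => by
    have := variance_map (X := ψ) (Y := history ν (t : ℤ)) (μ := μ) hψm.aemeasurable
      (hν.measurable_history t).aemeasurable
    rw [hν.map_history] at this
    exact this.symm
  have hV0 : 0 ≤ V := variance_nonneg _ _
  -- With equal variances, `0 ≤ Var(X s - X t) = 2V - 2 cov` replaces Cauchy–Schwarz.
  have hcov : ∀ s t, cov[X s, X t; μ] ≤ V := fun s t => by
    have h1 := variance_sub (hXL s) (hXL t)
    have h2 : 0 ≤ Var[X s - X t; μ] := variance_nonneg _ _
    rw [hV, hV] at h1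
    linarith
  have hcov0 : ∀ s t : ℕ, (n : ℤ) < |(s : ℤ) - t| → cov[X s, X t; μ] = 0 := fun s t h =>
    (hν.indepFun_history hχ h).covariance_eq_zero (hXL s) (hXL t)
  rw [show (∑ t ∈ Finset.Icc 1 T, fun ω =>
    χ (Preorder.frestrictLe (π := fun _ => S) n (history ν (t : ℕ) ω))) =
      ∑ t ∈ Finset.Icc 1 T, X t from rfl, variance_sum' fun t _ => hXL t]
  calc ∑ s ∈ Finset.Icc 1 T, ∑ t ∈ Finset.Icc 1 T, cov[X s, X t; μ]
      ≤ ∑ s ∈ Finset.Icc 1 T, (2 * n + 1) * V := by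
        refine Finset.sum_le_sum fun s _ => ?_
        calc ∑ t ∈ Finset.Icc 1 T, cov[X s, X t; μ]
            ≤ ∑ t ∈ Finset.Icc 1 T, if t ∈ Finset.Icc (s - n) (s + n) then V else 0 := by
              refine Finset.sum_le_sum fun t _ => ?_
              split_ifs with h
              · exact hcov s t
              · rw [hcov0 s t]
                simp only [Finset.mem_Icc, not_and_or, not_le] at h
                rcases abs_cases ((s : ℤ) - t) with h' | h' <;> omega
          _ = ((Finset.Icc 1 T).filter (· ∈ Finset.Icc (s - n) (s + n))).card * V := by
              rw [← Finset.sum_filter, Finset.sum_const, nsmul_eq_mul]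
          _ ≤ ((Finset.Icc (s - n) (s + n)).card : ℕ) * V := by
              gcongr
              intro t ht
              exact (Finset.mem_filter.1 ht).2
          _ ≤ (2 * n + 1) * V := by
              gcongr
              rw [Nat.card_Icc]
              have : s + n + 1 - (s - n) ≤ 2 * n + 1 := by omega
              exact_mod_cast this
    _ = T * ((2 * n + 1) * V) := by simp

theorem IsIID.tendsto_measure_avg_of_finite (hν : IsIID μ law ν) {n : ℕ}
    {χ : (Finset.Iic n → S) → ℝ} (hχ : Measurable χ)
    (hL : MemLp (fun x : ℕ → S => χ (Preorder.frestrictLe (π := fun _ => S) n x)) 2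
      (Measure.infinitePi fun _ : ℕ => law)) {ε : ℝ} (hε : 0 < ε) :
    Tendsto (fun T : ℕ => μ {ω | ε ≤ |1 / (T : ℝ) * ∑ t ∈ Finset.Icc 1 T,
        χ (Preorder.frestrictLe (π := fun _ => S) n (history ν (t : ℕ) ω)) -
      ∫ x, χ (Preorder.frestrictLe (π := fun _ => S) n x)
        ∂(Measure.infinitePi fun _ : ℕ => law)|}) atTop (𝓝 0) := by
  have hvar := hν.variance_sum_le hχ hL
  set ψ : (ℕ → S) → ℝ := fun x => χ (Preorder.frestrictLe (π := fun _ => S) n x) with hψ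
  set V := Var[ψ; Measure.infinitePi fun _ : ℕ => law]
  have hψm : Measurable ψ := hχ.comp (Preorder.measurable_frestrictLe n)
  have hXL : ∀ t : ℕ, MemLp (fun ω => ψ (history ν t ω)) 2 μ := fun t =>
    hL.comp_measurePreserving (hν.measurePreserving_history t)
  have hint : ∀ t : ℕ, ∫ ω, ψ (history ν t ω) ∂μ =
      ∫ x, ψ x ∂(Measure.infinitePi fun _ : ℕ => law) := fun t => by
    rw [← hν.map_history t, integral_map (hν.measurable_history t).aemeasurable
      hψm.aestronglyMeasurable]
  have hlim : Tendsto (fun T : ℕ => ENNReal.ofReal (((2 * n + 1) * V / ε ^ 2) / (T : ℝ))) atTop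
      (𝓝 0) := by
    have := (tendsto_const_div_atTop_nhds_zero_nat ((2 * n + 1) * V / ε ^ 2))
    simpa using ENNReal.tendsto_ofReal this
  refine tendsto_of_tendsto_of_tendsto_of_le_of_le' tendsto_const_nhds hlim
    (Eventually.of_forall fun _ => zero_le) ?_
  filter_upwards [eventually_ge_atTop 1] with T hT
  have hT0 : (0 : ℝ) < T := by exact_mod_cast hT
  set A : Ω → ℝ := fun ω => 1 / (T : ℝ) * (∑ t ∈ Finset.Icc 1 T, fun ω => ψ (history ν (t : ℕ) ω)) ω
  have hAL : MemLp A 2 μ := (memLp_finsetSum' _ fun t _ => hXL t).const_mul _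
  have hAint : ∫ ω, A ω ∂μ = ∫ x, ψ x ∂(Measure.infinitePi fun _ : ℕ => law) := by
    simp only [A, Finset.sum_apply]
    rw [integral_const_mul, integral_finsetSum _ fun t _ => (hXL t).integrable (by norm_num)]
    simp only [hint]
    simp
    field_simp
  have h := meas_ge_le_variance_div_sq hAL hε
  rw [hAint] at h
  simp only [A, Finset.sum_apply] at h
  refine h.trans (ENNReal.ofReal_le_ofReal ?_)
  have hvA : Var[A; μ] ≤ (1 / (T : ℝ)) ^ 2 * (T * ((2 * n + 1) * V)) := by
    simp only [A]
    rw [variance_const_mul]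
    gcongr
    exact hvar T
  simp only [A, Finset.sum_apply] at hvA
  calc _ ≤ ((1 / (T : ℝ)) ^ 2 * (T * ((2 * n + 1) * V))) / ε ^ 2 := by gcongr
    _ = _ := by field_simp

variable [IsProbabilityMeasure law]

/-- A weak law of large numbers for functions of the whole history of i.i.d. innovations. -/
theorem IsIID.tendsto_measure_avg (hν : IsIID μ law ν) {ψ : (ℕ → S) → ℝ} (hψm : Measurable ψ)
    (hψ : MemLp ψ 2 (Measure.infinitePi fun _ : ℕ => law)) {ε : ℝ} (hε : 0 < ε) :
    Tendsto (fun T : ℕ => μ {ω | ε ≤ |1 / (T : ℝ) * ∑ t ∈ Finset.Icc 1 T, ψ (history ν (t : ℕ) ω) -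
      ∫ x, ψ x ∂(Measure.infinitePi fun _ : ℕ => law)|}) atTop (𝓝 0) := by
  set P := Measure.infinitePi fun _ : ℕ => law with hP
  set ℱ : Filtration ℕ (MeasurableSpace.pi (X := fun _ : ℕ => S)) :=
    Filtration.piLE (X := fun _ : ℕ => S) with hF
  have hsup : (MeasurableSpace.pi : MeasurableSpace (ℕ → S)) ≤ ⨆ n, ℱ n := by
    refine iSup_le fun i => le_trans ?_ (le_iSup (fun n => (ℱ n : MeasurableSpace (ℕ → S))) i)
    rw [hF, Filtration.piLE_eq_comap_frestrictLe]
    rintro _ ⟨s, hs, rfl⟩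
    exact ⟨(fun v => v ⟨i, by simp⟩) ⁻¹' s, measurable_pi_apply _ hs, rfl⟩
  -- Lévy's upward theorem: conditioning on the coordinates up to `n` approximates `ψ` in `L¹`, and
  -- the approximant has finite range.
  have hL1 : Tendsto (fun n => eLpNorm (P[ψ | ℱ n] - ψ) 1 P) atTop (𝓝 0) :=
    (hψ.integrable (by norm_num)).tendsto_eLpNorm_condExp
      (hψm.mono hsup le_rfl).stronglyMeasurable
  rw [ENNReal.tendsto_atTop_zero]
  intro δ hδ
  -- By Markov, an `L¹` error of this size keeps the averaged error below `ε / 2` outside an event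
  -- of probability `δ / 2`, for every `T` at once.
  have hδ' : 0 < ENNReal.ofReal (ε / 2) * (δ / 2) := by
    apply ENNReal.mul_pos
    · simpa using hε
    · exact (ENNReal.half_pos hδ.ne').ne'
  obtain ⟨n, hn⟩ := (hL1.eventually (ge_mem_nhds hδ')).exists
  obtain ⟨χ, hχ, hχe⟩ : ∃ χ : (Finset.Iic n → S) → ℝ, Measurable χ ∧
      P[ψ | ℱ n] = χ ∘ Preorder.frestrictLe (π := fun _ => S) n := by
    have h : Measurable[ℱ n] (P[ψ | ℱ n]) := stronglyMeasurable_condExp.measurable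
    have he : (ℱ n : MeasurableSpace (ℕ → S)) = MeasurableSpace.comap
        (Preorder.frestrictLe (π := fun _ => S) n) MeasurableSpace.pi :=
      Filtration.piLE_eq_comap_frestrictLe n
    have h2 : Measurable[MeasurableSpace.comap (Preorder.frestrictLe (π := fun _ => S) n)
        MeasurableSpace.pi] (P[ψ | ℱ n]) := he ▸ h
    exact h2.exists_eq_measurable_comp
  have hχL : MemLp (χ ∘ Preorder.frestrictLe (π := fun _ => S) n) 2 P := by
    rw [← hχe]; exact hψ.condExp (by norm_num)
  have hχint : ∫ x, (χ ∘ Preorder.frestrictLe (π := fun _ => S) n) x ∂P = ∫ x, ψ x ∂P := by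
    rw [← hχe]; exact integral_condExp (ℱ.le n)
  have hfin := hν.tendsto_measure_avg_of_finite hχ hχL (half_pos hε)
  have hχm : Measurable (χ ∘ Preorder.frestrictLe (π := fun _ => S) n) :=
    hχ.comp (Preorder.measurable_frestrictLe n)
  rw [hχe] at hn
  set ψ' := χ ∘ Preorder.frestrictLe (π := fun _ => S) n with hψ'
  obtain ⟨N, hN⟩ := ENNReal.tendsto_atTop_zero.1 hfin (δ / 2) (ENNReal.half_pos hδ.ne')
  refine ⟨N, fun T hT => ?_⟩
  have hmark : μ {ω | ENNReal.ofReal (ε / 2) ≤ ENNReal.ofReal (1 / (T : ℝ)) *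
      ∑ t ∈ Finset.Icc 1 T, ‖(ψ' - ψ) (history ν (t : ℕ) ω)‖ₑ} ≤ δ / 2 := by
    have hgm : Measurable fun x => ‖(ψ' - ψ) x‖ₑ := (hχm.sub hψm).enorm
    have hgt : ∀ t : ℕ, Measurable fun ω => ‖(ψ' - ψ) (history ν t ω)‖ₑ := fun t =>
      hgm.comp (hν.measurable_history t)
    have h1 := mul_meas_ge_le_lintegral (μ := μ) (f := fun ω => ENNReal.ofReal (1 / (T : ℝ)) *
      ∑ t ∈ Finset.Icc 1 T, ‖(ψ' - ψ) (history ν (t : ℕ) ω)‖ₑ)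
      ((Finset.measurable_fun_sum _ fun t _ => hgt t).const_mul _)
      (ENNReal.ofReal (ε / 2))
    have h2 := h1.trans ((hν.lintegral_avg_le hgm T).trans
      (eLpNorm_one_eq_lintegral_enorm (μ := P) (f := ψ' - ψ) ▸ hn))
    rwa [ENNReal.mul_le_mul_iff_right (by simpa using hε) ENNReal.ofReal_ne_top] at h2
  calc _ ≤ μ ({ω | ENNReal.ofReal (ε / 2) ≤ ENNReal.ofReal (1 / (T : ℝ)) *
      ∑ t ∈ Finset.Icc 1 T, ‖(ψ' - ψ) (history ν (t : ℕ) ω)‖ₑ} ∪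
      {ω | ε / 2 ≤ |1 / (T : ℝ) * ∑ t ∈ Finset.Icc 1 T, ψ' (history ν (t : ℕ) ω) -
      ∫ x, ψ' x ∂P|}) := by
        refine measure_mono fun ω hω => ?_
        by_contra hcon
        simp only [mem_union, mem_ofPred_eq, not_or, not_le] at hcon hω
        obtain ⟨h1, h2⟩ := hcon
        rw [hχint] at h2
        have h3 : |1 / (T : ℝ) * ∑ t ∈ Finset.Icc 1 T, (ψ' - ψ) (history ν (t : ℕ) ω)| < ε / 2 := by
          have h4 : ENNReal.ofReal |1 / (T : ℝ) * ∑ t ∈ Finset.Icc 1 T,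
              (ψ' - ψ) (history ν (t : ℕ) ω)| < ENNReal.ofReal (ε / 2) := by
            refine lt_of_le_of_lt ?_ h1
            rw [abs_mul, abs_of_nonneg (by positivity : (0 : ℝ) ≤ 1 / T),
              ENNReal.ofReal_mul (by positivity)]
            gcongr
            calc _ ≤ ENNReal.ofReal (∑ t ∈ Finset.Icc 1 T, |(ψ' - ψ) (history ν (t : ℕ) ω)|) :=
                  ENNReal.ofReal_le_ofReal (Finset.abs_sum_le_sum_abs _ _)
              _ = _ := by
                  rw [ENNReal.ofReal_sum_of_nonneg fun _ _ => abs_nonneg _]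
                  simp only [← Real.norm_eq_abs, ofReal_norm]
          exact (ENNReal.ofReal_lt_ofReal_iff (half_pos hε)).1 h4
        simp only [Pi.sub_apply, Finset.sum_sub_distrib, mul_sub] at h3
        rw [abs_lt] at h2 h3
        rcases le_abs.1 hω with h | h <;> linarith
    _ ≤ δ / 2 + δ / 2 := (measure_union_le _ _).trans (add_le_add hmark (hN T hT))
    _ = δ := ENNReal.add_halves δ

end History

/-! ### Calculus of events whose probability tends to one. -/

section HighProb

variable {Ω : Type*} [MeasurableSpace Ω] {μ : Measure Ω}

/-- The events `p T` have (outer) probability tending to one. -/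
def HighProb (μ : Measure Ω) (p : ℕ → Ω → Prop) : Prop :=
  Tendsto (fun T => μ {ω | ¬ p T ω}) atTop (𝓝 0)

theorem HighProb.mono {p q : ℕ → Ω → Prop} (hp : HighProb μ p)
    (h : ∀ᶠ T in atTop, ∀ᵐ ω ∂μ, p T ω → q T ω) : HighProb μ q := by
  refine tendsto_of_tendsto_of_tendsto_of_le_of_le' tendsto_const_nhds hp
    (Eventually.of_forall fun _ => zero_le) ?_
  filter_upwards [h] with T hT
  refine measure_mono_ae ?_
  filter_upwards [hT] with ω hω using fun hq hpω => hq (hω hpω)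

theorem HighProb.and {p q : ℕ → Ω → Prop} (hp : HighProb μ p) (hq : HighProb μ q) :
    HighProb μ fun T ω => p T ω ∧ q T ω := by
  have h := hp.add hq
  rw [add_zero] at h
  refine tendsto_of_tendsto_of_tendsto_of_le_of_le tendsto_const_nhds h (fun _ => zero_le)
    fun T => (measure_mono fun ω hω => ?_).trans (measure_union_le _ _)
  simpa only [mem_union, mem_ofPred_eq, ← not_and_or] using hω

theorem HighProb.forall_finset {ι : Type*} (F : Finset ι) {p : ι → ℕ → Ω → Prop}
    (hp : ∀ i ∈ F, HighProb μ (p i)) : HighProb μ fun T ω => ∀ i ∈ F, p i T ω := by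
  have h := tendsto_finsetSum F hp
  rw [Finset.sum_const_zero] at h
  refine tendsto_of_tendsto_of_tendsto_of_le_of_le tendsto_const_nhds h (fun _ => zero_le)
    fun T => (measure_mono fun ω hω => ?_).trans (measure_biUnion_finset_le F _)
  simp only [mem_ofPred_eq, not_forall] at hω
  obtain ⟨i, hi, hω⟩ := hω
  exact mem_iUnion₂.2 ⟨i, hi, hω⟩

/-- Convergence in probability to zero of a nonnegative sequence, from high-probability bounds. -/
theorem isLittleOP_of_highProb {X : ℕ → Ω → ℝ≥0∞}
    (h : ∀ ε : ℝ, 0 < ε → HighProb μ fun T ω => X T ω ≤ ENNReal.ofReal ε) : IsLittleOP μ X := by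
  intro ε hε
  obtain ⟨e, he, hlt⟩ := ENNReal.lt_iff_exists_real_btwn.1 hε
  have he0 : 0 < e := by
    by_contra hneg
    simp [ENNReal.ofReal_of_nonpos (not_lt.1 hneg)] at hlt
  refine tendsto_of_tendsto_of_tendsto_of_le_of_le tendsto_const_nhds (h e he0)
    (fun _ => zero_le) fun T => measure_mono fun ω hω => ?_
  simp only [mem_ofPred_eq, not_le] at hω ⊢
  exact hlt.2.trans_le hω

end HighProb

/-! ### Uniform weak law over a compact index set. -/

section UniformLaw

variable {Ω : Type*} [MeasurableSpace Ω] {μ : Measure Ω} [IsProbabilityMeasure μ]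
  {S : Type*} [MeasurableSpace S] {law : Measure S} [IsProbabilityMeasure law] {ν : ℤ → Ω → S}

/-- The exceptional sets on which a random continuous function oscillates by more than `ε` at a
small scale have small probability. -/
theorem exists_modulus {X A : Type*} [MeasurableSpace X] {P : Measure X} [IsFiniteMeasure P]
    [MetricSpace A] {Q : Set A}
    (hQ : IsCompact Q) {g : X → A → ℝ} (hgm : ∀ q ∈ Q, Measurable fun x => g x q)
    (hgc : ∀ᵐ x ∂P, ContinuousOn (g x) Q) {ε κ : ℝ} (hε : 0 < ε) (hκ : 0 < κ) {d : ℝ} (hd : 0 < d) :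
    ∃ E : Set X, MeasurableSet E ∧ P.real E ≤ κ ∧ ∃ s : ℝ, 0 < s ∧ s ≤ d ∧
      ∀ x, x ∉ E → ContinuousOn (g x) Q → ∀ q ∈ Q, ∀ q' ∈ Q, dist q q' < s →
        |g x q - g x q'| ≤ ε := by
  obtain ⟨D, hDQ, hDc, hD⟩ := hQ.isSeparable.exists_countable_dense_subset
  -- Restricting to a countable dense set makes the oscillation event measurable. The events
  -- decrease in `n`, and their intersection contains no `x` with `g x` uniformly continuous, so it
  -- is null. Off `E n` the bound extends from the dense set to `Q` by continuity.
  set E : ℕ → Set X := fun n => ⋃ q ∈ D, ⋃ q' ∈ D, ⋃ _ : dist q q' < 1 / ((n : ℝ) + 1),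
    {x | ε < |g x q - g x q'|} with hE
  have hEm : ∀ n, MeasurableSet (E n) := fun n =>
    MeasurableSet.biUnion hDc fun q hq => MeasurableSet.biUnion hDc fun q' hq' =>
      MeasurableSet.iUnion fun _ => measurableSet_lt measurable_const
        (((hgm q (hDQ hq)).sub (hgm q' (hDQ hq'))).abs)
  have hmemE : ∀ n x, x ∈ E n ↔ ∃ q ∈ D, ∃ q' ∈ D, dist q q' < 1 / ((n : ℝ) + 1) ∧
      ε < |g x q - g x q'| := by
    intro n x
    simp only [hE, mem_iUnion, mem_ofPred_eq, exists_prop]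
  have hanti : Antitone E := by
    intro m n hmn x hx
    obtain ⟨q, hq, q', hq', h1, h2⟩ := (hmemE n x).1 hx
    refine (hmemE m x).2 ⟨q, hq, q', hq', h1.trans_le ?_, h2⟩
    gcongr
  have hlim := tendsto_measure_iInter_atTop (μ := P) (fun n => (hEm n).nullMeasurableSet) hanti
    ⟨0, measure_ne_top _ _⟩
  have hzero : P (⋂ n, E n) = 0 := by
    refine measure_mono_null (t := {x | ¬ ContinuousOn (g x) Q}) (fun x hx hc => ?_) hgc
    have hu := Metric.uniformContinuousOn_iff.1 (hQ.uniformContinuousOn_of_continuous hc) ε hε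
    obtain ⟨s, hs, hsx⟩ := hu
    obtain ⟨n, hn⟩ := exists_nat_one_div_lt hs
    obtain ⟨q, hq, q', hq', h1, h2⟩ := (hmemE n x).1 (mem_iInter.1 hx n)
    have := hsx q (hDQ hq) q' (hDQ hq') (h1.trans hn)
    rw [Real.dist_eq] at this
    linarith
  rw [hzero] at hlim
  obtain ⟨n₁, hn₁⟩ := ENNReal.tendsto_atTop_zero.1 hlim (ENNReal.ofReal κ) (by simpa using hκ)
  obtain ⟨n₂, hn₂⟩ := exists_nat_one_div_lt hd
  set n := max n₁ n₂
  refine ⟨E n, hEm n, ENNReal.toReal_le_of_le_ofReal hκ.le (hn₁ n (le_max_left _ _)),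
    1 / ((n : ℝ) + 1), by positivity, ?_, ?_⟩
  · refine le_trans ?_ hn₂.le
    gcongr
    exact le_max_right _ _
  · intro x hx hc q hq q' hq' hdist
    obtain ⟨a, ha, hal⟩ := mem_closure_iff_seq_limit.1 (hD hq)
    obtain ⟨b, hb, hbl⟩ := mem_closure_iff_seq_limit.1 (hD hq')
    have hga : Tendsto (fun k => g x (a k)) atTop (𝓝 (g x q)) :=
      (hc q hq).tendsto.comp (tendsto_nhdsWithin_iff.2
        ⟨hal, Eventually.of_forall fun k => hDQ (ha k)⟩)
    have hgb : Tendsto (fun k => g x (b k)) atTop (𝓝 (g x q')) :=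
      (hc q' hq').tendsto.comp (tendsto_nhdsWithin_iff.2
        ⟨hbl, Eventually.of_forall fun k => hDQ (hb k)⟩)
    refine le_of_tendsto (hga.sub hgb).abs ?_
    filter_upwards [(hal.dist hbl).eventually_lt_const hdist] with k hk
    by_contra hcon
    exact hx ((hmemE n x).2 ⟨a k, ha k, b k, hb k, hk, not_le.1 hcon⟩)

/-- A uniform weak law of large numbers over a compact index set. -/
theorem IsIID.highProb_uniform_avg (hν : IsIID μ law ν) {A : Type*} [MetricSpace A] {Q : Set A}
    (hQ : IsCompact Q) {g : (ℕ → S) → A → ℝ} (hgm : ∀ q ∈ Q, Measurable fun x => g x q)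
    (hgc : ∀ᵐ x ∂(Measure.infinitePi fun _ : ℕ => law), ContinuousOn (g x) Q) {B : ℝ} (hB0 : 0 ≤ B)
    (hB : ∀ᵐ x ∂(Measure.infinitePi fun _ : ℕ => law), ∀ q ∈ Q, |g x q| ≤ B)
    {ε : ℝ} (hε : 0 < ε) :
    HighProb μ fun T ω => ∀ q ∈ Q, |1 / (T : ℝ) * ∑ t ∈ Finset.Icc 1 T, g (history ν (t : ℕ) ω) q -
      ∫ x, g x q ∂(Measure.infinitePi fun _ : ℕ => law)| ≤ ε := by
  set P := Measure.infinitePi fun _ : ℕ => law with hP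
  set G : A → ℝ := fun q => ∫ x, g x q ∂P with hG
  have hGc : ContinuousOn G Q :=
    continuousOn_of_dominated (bound := fun _ => B)
      (fun q hq => (hgm q hq).aestronglyMeasurable)
      (fun q hq => hB.mono fun x hx => hx q hq) (integrable_const _) hgc
  have hε5 : 0 < ε / 5 := by positivity
  obtain ⟨d, hd, hGd⟩ := Metric.uniformContinuousOn_iff.1
    (hQ.uniformContinuousOn_of_continuous hGc) (ε / 5) hε5
  -- Moving `q` to the nearest net point costs `ε / 5` at histories outside `E` and at most `2 * B`
  -- inside. The fraction of times spent in `E` is at most `2 * κ` by the law of large numbers for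
  -- its indicator, and `κ` makes `2 * B * (2 * κ) ≤ ε / 5`.
  set κ := ε / (20 * (B + 1)) with hκ
  have hκ0 : 0 < κ := by positivity
  obtain ⟨E, hEm, hEκ, s, hs, hsd, hmod⟩ := exists_modulus hQ hgm hgc hε5 hκ0 hd
  obtain ⟨F, hF, hcover⟩ := hQ.elim_nhds_subcover (fun q => Metric.ball q s)
    (fun q _ => Metric.ball_mem_nhds q hs)
  have hlln : HighProb μ fun T ω => ∀ q ∈ F,
      |1 / (T : ℝ) * ∑ t ∈ Finset.Icc 1 T, g (history ν (t : ℕ) ω) q - G q| < ε / 5 :=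
    HighProb.forall_finset F fun q hq => by
      have hL : MemLp (fun x => g x q) 2 P :=
        MemLp.of_bound (hgm q (hF q hq)).aestronglyMeasurable B
          (hB.mono fun x hx => hx q (hF q hq))
      simpa only [HighProb, not_lt] using hν.tendsto_measure_avg (hgm q (hF q hq)) hL hε5
  have hind : HighProb μ fun T ω =>
      |1 / (T : ℝ) * ∑ t ∈ Finset.Icc 1 T, E.indicator (fun _ => (1 : ℝ)) (history ν (t : ℕ) ω) -
        P.real E| < κ := by
    have hL : MemLp (E.indicator fun _ => (1 : ℝ)) 2 P := memLp_indicator_const _ hEm _ (by simp)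
    have := hν.tendsto_measure_avg (measurable_const.indicator hEm) hL hκ0
    rw [integral_indicator_const _ hEm, smul_eq_mul, mul_one] at this
    simpa only [HighProb, not_lt] using this
  refine (hlln.and hind).mono (Eventually.of_forall fun T => ?_)
  have hreg : ∀ᵐ ω ∂μ, ∀ t : ℕ, ContinuousOn (g (history ν t ω)) Q ∧
      ∀ q ∈ Q, |g (history ν t ω) q| ≤ B :=
    ae_all_iff.2 fun t =>
      (hν.measurePreserving_history t).quasiMeasurePreserving.ae (hgc.and hB)
  filter_upwards [hreg] with ω hω hgood q hq
  obtain ⟨hg1, hg2⟩ := hgood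
  obtain ⟨q', hq'F, hqq'⟩ := mem_iUnion₂.1 (hcover hq)
  have hq' := hF q' hq'F
  have hdist : dist q q' < s := Metric.mem_ball.1 hqq'
  have h1 := hg1 q' hq'F
  have h2 : |G q - G q'| < ε / 5 := hGd q hq q' hq' (hdist.trans_le hsd)
  have h3 : |1 / (T : ℝ) * ∑ t ∈ Finset.Icc 1 T, g (history ν (t : ℕ) ω) q -
      1 / (T : ℝ) * ∑ t ∈ Finset.Icc 1 T, g (history ν (t : ℕ) ω) q'| ≤
      1 / (T : ℝ) * ∑ t ∈ Finset.Icc 1 T,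
        (ε / 5 + 2 * B * E.indicator (fun _ => (1 : ℝ)) (history ν (t : ℕ) ω)) := by
    rw [← mul_sub, abs_mul, abs_of_nonneg (by positivity : (0 : ℝ) ≤ 1 / T),
      ← Finset.sum_sub_distrib]
    gcongr
    refine (Finset.abs_sum_le_sum_abs _ _).trans (Finset.sum_le_sum fun t _ => ?_)
    by_cases hx : history ν (t : ℕ) ω ∈ E
    · rw [indicator_of_mem hx]
      have ha := (hω t).2 q hq
      have hb := (hω t).2 q' hq'
      rw [abs_le] at ha hb ⊢
      constructor <;> linarith
    · rw [indicator_of_notMem hx, mul_zero, add_zero]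
      exact hmod _ hx (hω t).1 q hq q' hq' hdist
  have h4 : 1 / (T : ℝ) * ∑ t ∈ Finset.Icc 1 T,
        (ε / 5 + 2 * B * E.indicator (fun _ => (1 : ℝ)) (history ν (t : ℕ) ω)) ≤
      ε / 5 + 2 * B * (2 * κ) := by
    rw [Finset.sum_add_distrib, ← Finset.mul_sum, mul_add]
    have h5 : 1 / (T : ℝ) * ∑ t ∈ Finset.Icc 1 T,
        E.indicator (fun _ => (1 : ℝ)) (history ν (t : ℕ) ω) ≤ 2 * κ := by
      have := (abs_lt.1 hg2).2
      linarith
    have h6 : 1 / (T : ℝ) * ∑ _t ∈ Finset.Icc 1 T, ε / 5 ≤ ε / 5 := by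
      rw [Finset.sum_const, Nat.card_Icc, add_tsub_cancel_right, nsmul_eq_mul, ← mul_assoc, one_div]
      exact mul_le_of_le_one_left hε5.le inv_mul_le_one
    have h7 := mul_le_mul_of_nonneg_left h5 (by positivity : 0 ≤ 2 * B)
    calc _ = 1 / (T : ℝ) * ∑ _t ∈ Finset.Icc 1 T, ε / 5 + 2 * B * (1 / (T : ℝ) *
          ∑ t ∈ Finset.Icc 1 T, E.indicator (fun _ => (1 : ℝ)) (history ν (t : ℕ) ω)) := by ring
      _ ≤ _ := add_le_add h6 h7
  have h8 : 2 * B * (2 * κ) ≤ ε / 5 := by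
    rw [hκ]
    have : ε / (20 * (B + 1)) * (B + 1) = ε / 20 := by field_simp
    nlinarith [hκ0]
  rw [abs_lt] at h1 h2
  rw [abs_le] at h3 ⊢
  constructor <;> linarith

end UniformLaw

/-! ### The limit loss and consistency for simulated data. -/

section StructuralLoss

variable {Ω : Type*} [MeasurableSpace Ω] {μ : Measure Ω} {S : Type*} [MeasurableSpace S]
  {law : Measure S} {p dz dρ : ℕ} {Θ : Set (Vec p)} {Γ : Set (Vec dρ)} {r : ℝ × Vec p → ℝ}
  {φ : (ℕ → S) → Vec p → ℝ} {ζ : (ℕ → S) → ℝ → Vec p → Vec dz} {f : Vec dz → Vec dρ → ℝ}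
  {D : Set (ℝ × Vec dz)} {B C : ℝ}

/-- The loss of the structural variables as a function of the history and of `(u, θ, ρ)`. -/
def structLoss (r : ℝ × Vec p → ℝ) (φ : (ℕ → S) → Vec p → ℝ) (ζ : (ℕ → S) → ℝ → Vec p → Vec dz)
    (f : Vec dz → Vec dρ → ℝ) (x : ℕ → S) (q : ℝ × Vec p × Vec dρ) : ℝ :=
  sqLoss f (structY r φ x q.2.1) (ζ x q.1 q.2.1) q.2.2

/-- The expected loss of the structural variables. -/
noncomputable def limitLoss (law : Measure S) (r : ℝ × Vec p → ℝ) (φ : (ℕ → S) → Vec p → ℝ)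
    (ζ : (ℕ → S) → ℝ → Vec p → Vec dz) (f : Vec dz → Vec dρ → ℝ) (q : ℝ × Vec p × Vec dρ) : ℝ :=
  ∫ x, structLoss r φ ζ f x q ∂(Measure.infinitePi fun _ : ℕ => law)

theorem RegularLoss.ae_abs_structLoss_le (hl : RegularLoss D Γ f B C)
    (hD : ∀ᵐ x ∂(Measure.infinitePi fun _ : ℕ => law), ∀ u ∈ Icc (0 : ℝ) 1, ∀ θ ∈ Θ,
      (structY r φ x θ, ζ x u θ) ∈ D) :
    ∀ᵐ x ∂(Measure.infinitePi fun _ : ℕ => law), ∀ q ∈ Icc (0 : ℝ) 1 ×ˢ Θ ×ˢ Γ,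
      |structLoss r φ ζ f x q| ≤ B := by
  filter_upwards [hD] with x hx q hq
  rw [structLoss, abs_of_nonneg (sqLoss_nonneg _ _ _ _)]
  exact hl.le _ (hx _ hq.1 _ hq.2.1) _ hq.2.2

variable [IsProbabilityMeasure law]

theorem SmoothStructure.measurable_structY (hs : SmoothStructure law Θ r φ ζ) {θ : Vec p}
    (hθ : θ ∈ Θ) : Measurable fun x => structY r φ x θ := by
  obtain ⟨V, hV, hΘV, C, hr, -⟩ := hs.smooth
  have hc : Continuous fun y : ℝ => r (y, θ) :=
    hr.continuousOn.comp_continuous (by fun_prop) fun y => ⟨mem_univ _, hΘV hθ⟩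
  exact hc.measurable.comp (hs.measurable_φ θ hθ)

theorem SmoothStructure.measurable_structLoss (hs : SmoothStructure law Θ r φ ζ)
    (hf : IsRegressionFunction Γ f) {q : ℝ × Vec p × Vec dρ} (hq : q ∈ Icc (0 : ℝ) 1 ×ˢ Θ ×ˢ Γ) :
    Measurable fun x => structLoss r φ ζ f x q :=
  ((hs.measurable_structY hq.2.1).sub
    ((hf.measurable _ hq.2.2).comp (hs.measurable_ζ _ hq.1 _ hq.2.1))).pow_const 2

theorem SmoothStructure.ae_continuousOn_structLoss (hs : SmoothStructure law Θ r φ ζ)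
    (hl : RegularLoss D Γ f B C)
    (hD : ∀ᵐ x ∂(Measure.infinitePi fun _ : ℕ => law), ∀ u ∈ Icc (0 : ℝ) 1, ∀ θ ∈ Θ,
      (structY r φ x θ, ζ x u θ) ∈ D) :
    ∀ᵐ x ∂(Measure.infinitePi fun _ : ℕ => law),
      ContinuousOn (structLoss r φ ζ f x) (Icc (0 : ℝ) 1 ×ˢ Θ ×ˢ Γ) := by
  obtain ⟨V, hV, hΘV, C, hr, -, hφ⟩ := hs.smooth
  filter_upwards [hD, hφ, hs.continuous_ζ] with x hxD hxφ hxζ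
  have h1 : ContinuousOn (fun q : ℝ × Vec p × Vec dρ => structY r φ x q.2.1)
      (Icc (0 : ℝ) 1 ×ˢ Θ ×ˢ Γ) := by
    have hφc : ContinuousOn (fun q : ℝ × Vec p × Vec dρ => (φ x q.2.1, q.2.1))
        (Icc (0 : ℝ) 1 ×ˢ Θ ×ˢ Γ) :=
      (hxφ.1.continuousOn.comp (by fun_prop) fun q hq => hΘV hq.2.1).prodMk (by fun_prop)
    exact hr.continuousOn.comp hφc fun q hq => ⟨mem_univ _, hΘV hq.2.1⟩
  have h2 : ContinuousOn (fun q : ℝ × Vec p × Vec dρ => ζ x q.1 q.2.1)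
      (Icc (0 : ℝ) 1 ×ˢ Θ ×ˢ Γ) :=
    hxζ.comp (f := fun q : ℝ × Vec p × Vec dρ => (q.1, q.2.1)) (by fun_prop)
      fun q hq => ⟨hq.1, hq.2.1⟩
  have h3 : ContinuousOn (fun q : ℝ × Vec p × Vec dρ =>
      ((structY r φ x q.2.1, ζ x q.1 q.2.1), q.2.2)) (Icc (0 : ℝ) 1 ×ˢ Θ ×ˢ Γ) :=
    (h1.prodMk h2).prodMk (by fun_prop)
  exact hl.continuousOn.comp h3 fun q hq => ⟨hxD _ hq.1 _ hq.2.1, hq.2.2⟩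

theorem SmoothStructure.continuousOn_limitLoss (hs : SmoothStructure law Θ r φ ζ)
    (hf : IsRegressionFunction Γ f) (hl : RegularLoss D Γ f B C)
    (hD : ∀ᵐ x ∂(Measure.infinitePi fun _ : ℕ => law), ∀ u ∈ Icc (0 : ℝ) 1, ∀ θ ∈ Θ,
      (structY r φ x θ, ζ x u θ) ∈ D) :
    ContinuousOn (limitLoss law r φ ζ f) (Icc (0 : ℝ) 1 ×ˢ Θ ×ˢ Γ) :=
  continuousOn_of_dominated (bound := fun _ => B)
    (fun _ hq => (hs.measurable_structLoss hf hq).aestronglyMeasurable)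
    (fun q hq => (hl.ae_abs_structLoss_le hD).mono fun _ hx => hx q hq) (integrable_const _)
    (hs.ae_continuousOn_structLoss hl hD)

theorem IsIID.integral_structLoss {ν : ℤ → Ω → S} (hν : IsIID μ law ν)
    (hs : SmoothStructure law Θ r φ ζ) (hf : IsRegressionFunction Γ f)
    {q : ℝ × Vec p × Vec dρ} (hq : q ∈ Icc (0 : ℝ) 1 ×ˢ Θ ×ˢ Γ) (t : ℤ) :
    ∫ ω, structLoss r φ ζ f (history ν t ω) q ∂μ = limitLoss law r φ ζ f q := by
  rw [limitLoss, ← hν.map_history t, integral_map (hν.measurable_history t).aemeasurable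
    (hs.measurable_structLoss hf hq).aestronglyMeasurable]

/-- Uniform consistency of the estimators computed from simulated series. -/
theorem isLittleOP_simulated [IsProbabilityMeasure μ] {ν : ℤ → Ω → S} (hν : IsIID μ law ν)
    (hΘ : IsCompact Θ) (hΓ : IsCompact Γ) (hs : SmoothStructure law Θ r φ ζ)
    (hf : IsRegressionFunction Γ f) (hl : RegularLoss D Γ f B C) (hB : 0 ≤ B)
    (hD : ∀ᵐ x ∂(Measure.infinitePi fun _ : ℕ => law), ∀ u ∈ Icc (0 : ℝ) 1, ∀ θ ∈ Θ,
      (structY r φ x θ, ζ x u θ) ∈ D)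
    {M : ℝ → Vec p → Vec dρ → ℝ}
    (hM : ∀ u ∈ Icc (0 : ℝ) 1, ∀ θ ∈ Θ, ∀ ρ ∈ Γ,
      Tendsto (fun T : ℕ => 1 / (T : ℝ) * ∑ t ∈ Finset.Icc 1 T,
        ∫ ω, sqLoss f (structY r φ (history ν t ω) θ) (ζ (history ν t ω) u θ) ρ ∂μ)
        atTop (𝓝 (M u θ ρ)))
    {ρ₀ : ℝ → Vec p → Vec dρ}
    (hρ₀ : ∀ u ∈ Icc (0 : ℝ) 1, ∀ θ ∈ Θ, IsArgmin (M u θ) Γ (ρ₀ u θ) ∧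
      ∀ ρ, IsArgmin (M u θ) Γ ρ → ρ = ρ₀ u θ)
    {U : ℕ → Set ℝ} (hU : ∀ T, U T ⊆ Icc 0 1) {ρhat : ℕ → Ω → ℝ → Vec p → Vec dρ}
    (hρhat : ∀ T, 1 ≤ T → ∀ᵐ ω ∂μ, ∀ u ∈ U T, ∀ θ ∈ Θ,
      IsArgmin (simCriterion f (fun t ω => structY r φ (history ν t ω) θ)
        (fun t ω => ζ (history ν t ω) u θ) T ω) Γ (ρhat T ω u θ)) :
    IsLittleOP μ fun T ω => ⨆ u ∈ U T, ⨆ θ ∈ Θ, ‖ρhat T ω u θ - ρ₀ u θ‖ₑ := by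
  -- All histories have the same law, so the averaged expectations are already constant in `T ≥ 1`.
  have hMeq : ∀ u ∈ Icc (0 : ℝ) 1, ∀ θ ∈ Θ, ∀ ρ ∈ Γ, M u θ ρ = limitLoss law r φ ζ f (u, θ, ρ) := by
    intro u hu θ hθ ρ hρ
    refine tendsto_nhds_unique (hM u hu θ hθ ρ hρ) (tendsto_const_nhds.congr' ?_)
    filter_upwards [eventually_ge_atTop 1] with T hT
    have hT0 : (0 : ℝ) < T := by exact_mod_cast hT
    have h := fun t : ℤ => hν.integral_structLoss hs hf (q := (u, θ, ρ)) ⟨hu, hθ, hρ⟩ t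
    simp only [structLoss] at h
    simp only [h, Finset.sum_const, Nat.card_Icc, add_tsub_cancel_right, nsmul_eq_mul]
    field_simp
  have hgap : ∀ ε : ℝ, 0 < ε → ∃ η : ℝ, 0 < η ∧ ∀ q ∈ Icc (0 : ℝ) 1 ×ˢ Θ, ∀ ρ ∈ Γ,
      ε ≤ dist ρ (ρ₀ q.1 q.2) → η ≤ limitLoss law r φ ζ f (q.1, q.2, ρ) -
        limitLoss law r φ ζ f (q.1, q.2, ρ₀ q.1 q.2) := by
    intro ε hε
    refine exists_uniform_gap (Q := Icc (0 : ℝ) 1 ×ˢ Θ) (isCompact_Icc.prod hΘ) hΓ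
      (F := fun q ρ => limitLoss law r φ ζ f (q.1, q.2, ρ)) (s := fun q => ρ₀ q.1 q.2) ?_
      (fun q hq => (hρ₀ _ hq.1 _ hq.2).1.1) ?_ hε
    · exact (hs.continuousOn_limitLoss hf hl hD).comp
        (f := fun x : (ℝ × Vec p) × Vec dρ => (x.1.1, x.1.2, x.2)) (by fun_prop)
        fun x hx => ⟨hx.1.1, hx.1.2, hx.2⟩
    · intro q hq ρ hρ hne
      obtain ⟨⟨hmem, hmin⟩, huniq⟩ := hρ₀ _ hq.1 _ hq.2
      simp only [← hMeq _ hq.1 _ hq.2 _ hρ, ← hMeq _ hq.1 _ hq.2 _ hmem]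
      by_contra hle
      refine hne (huniq ρ ⟨hρ, fun τ hτ => ?_⟩)
      exact (not_lt.1 hle).trans (hmin hτ)
  refine isLittleOP_of_highProb fun ε hε => ?_
  obtain ⟨η, hη, hgap⟩ := hgap ε hε
  -- Two deviations of `η / 3`, at the estimator and at the target, cannot bridge a gap of `η`.
  have hunif := hν.highProb_uniform_avg (isCompact_Icc.prod (hΘ.prod hΓ))
    (fun q hq => hs.measurable_structLoss hf hq) (hs.ae_continuousOn_structLoss hl hD) hB
    (hl.ae_abs_structLoss_le hD) (by positivity : 0 < η / 3)
  refine hunif.mono ?_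
  filter_upwards [eventually_ge_atTop 1] with T hT
  filter_upwards [hρhat T hT] with ω hω hgood
  refine iSup₂_le fun u hu => iSup₂_le fun θ hθ => ?_
  obtain ⟨hmem, hmin⟩ := hω u hu θ hθ
  have hu' := hU T hu
  have hmem0 := (hρ₀ u hu' θ hθ).1.1
  have h1 := hgood (u, θ, ρhat T ω u θ) ⟨hu', hθ, hmem⟩
  have h2 := hgood (u, θ, ρ₀ u θ) ⟨hu', hθ, hmem0⟩
  have h3 : simCriterion f (fun t ω => structY r φ (history ν t ω) θ)
        (fun t ω => ζ (history ν t ω) u θ) T ω (ρhat T ω u θ) ≤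
      simCriterion f (fun t ω => structY r φ (history ν t ω) θ)
        (fun t ω => ζ (history ν t ω) u θ) T ω (ρ₀ u θ) := hmin hmem0
  have h4 := hgap (u, θ) ⟨hu', hθ⟩ (ρhat T ω u θ) hmem
  rw [← ofReal_norm]
  refine ENNReal.ofReal_le_ofReal ?_
  by_contra hcon
  rw [not_le, ← dist_eq_norm] at hcon
  have h5 := h4 hcon.le
  simp only [simCriterion] at h3
  simp only [structLoss] at h1 h2
  simp only [limitLoss, structLoss] at h5
  rw [abs_le] at h1 h2
  linarith

end StructuralLoss

/-! ### Decoupling past and future under `φ`-mixing. -/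

section Mixing

/-- Under a `φ`-mixing bound between two σ-fields, the integral of a product is at most the product
of the integrals, up to an error proportional to the first integral. -/
theorem lintegral_mul_le_of_mixing {Ω : Type*} {m₁ m₂ m₀ : MeasurableSpace Ω} {μ : Measure Ω}
    [IsProbabilityMeasure μ] (h₁ : m₁ ≤ m₀) (h₂ : m₂ ≤ m₀)
    {c : ℝ≥0∞}
    (hmix : ∀ A B : Set Ω, MeasurableSet[m₁] A → MeasurableSet[m₂] B → μ (B ∩ A) ≤ μ A * (μ B + c))
    {X : Ω → ℝ≥0∞} (hX : Measurable[m₁] X) {Y : Ω → ℝ} (hY : Measurable[m₂] Y) {M : ℝ}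
    (hY0 : ∀ ω, 0 ≤ Y ω) (hYM : ∀ ω, Y ω ≤ M) :
    ∫⁻ ω, X ω * ENNReal.ofReal (Y ω) ∂μ ≤
      (∫⁻ ω, X ω ∂μ) * (∫⁻ ω, ENNReal.ofReal (Y ω) ∂μ + ENNReal.ofReal M * c) := by
  set C := ∫⁻ ω, ENNReal.ofReal (Y ω) ∂μ + ENNReal.ofReal M * c with hC
  have hYm : Measurable Y := hY.mono h₂ le_rfl
  -- Layer-cake formula: the integral of `Y` over `A` is the integral over levels `t` of `μ ({t ≤ Y}
  -- ∩ A)`. The mixing error `c` is paid only at levels in `(0, M]`, as higher level sets are empty.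
  have hA : ∀ A, MeasurableSet[m₁] A → ∫⁻ ω in A, ENNReal.ofReal (Y ω) ∂μ ≤ C * μ A := by
    intro A hA
    rw [lintegral_eq_lintegral_meas_le (μ.restrict A) (Eventually.of_forall hY0) hYm.aemeasurable]
    have hle : ∀ t ∈ Ioi (0 : ℝ), (μ.restrict A) {ω | t ≤ Y ω} ≤
        μ A * (μ {ω | t ≤ Y ω} + (Ioc 0 M).indicator (fun _ => c) t) := by
      intro t ht
      have hB : MeasurableSet[m₂] {ω | t ≤ Y ω} := measurableSet_le measurable_const hY
      rw [Measure.restrict_apply (h₂ _ hB)]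
      by_cases htM : t ≤ M
      · rw [indicator_of_mem (show t ∈ Ioc 0 M from ⟨ht, htM⟩)]
        exact hmix A _ hA hB
      · have : {ω | t ≤ Y ω} = ∅ := by
          ext ω
          simpa using (hYM ω).trans_lt (not_le.1 htM)
        simp [this]
    calc _ ≤ ∫⁻ t in Ioi (0 : ℝ), μ A * (μ {ω | t ≤ Y ω} + (Ioc 0 M).indicator (fun _ => c) t) :=
          setLIntegral_mono' measurableSet_Ioi hle
      _ ≤ μ A * ((∫⁻ t in Ioi (0 : ℝ), μ {ω | t ≤ Y ω}) +
          ∫⁻ t in Ioi (0 : ℝ), (Ioc 0 M).indicator (fun _ => c) t) := by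
          rw [lintegral_const_mul' _ _ (measure_ne_top _ _),
            lintegral_add_right _ (measurable_const.indicator measurableSet_Ioc)]
      _ ≤ μ A * (∫⁻ ω, ENNReal.ofReal (Y ω) ∂μ + ENNReal.ofReal M * c) := by
          rw [lintegral_eq_lintegral_meas_le μ (Eventually.of_forall hY0) hYm.aemeasurable]
          gcongr
          refine (setLIntegral_le_lintegral _ _).trans ?_
          rw [lintegral_indicator_const measurableSet_Ioc, Real.volume_Ioc, sub_zero, mul_comm]
      _ = C * μ A := mul_comm _ _
  -- On `m₁`, `hA` says that the measure with density `Y` is dominated by `C • μ`. Domination of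
  -- measures passes to integrals of every `m₁`-measurable `X`, so no approximation by simple
  -- functions is needed.
  set κ := μ.withDensity fun ω => ENNReal.ofReal (Y ω) with hκ
  have hle : κ.trim h₁ ≤ C • μ.trim h₁ := by
    refine Measure.le_iff.2 fun A hAm => ?_
    rw [Measure.smul_apply, trim_measurableSet_eq h₁ hAm, trim_measurableSet_eq h₁ hAm, hκ,
      withDensity_apply _ (h₁ _ hAm), smul_eq_mul]
    exact hA A hAm
  calc ∫⁻ ω, X ω * ENNReal.ofReal (Y ω) ∂μ = ∫⁻ ω, X ω ∂κ := by
        rw [hκ, lintegral_withDensity_eq_lintegral_mul _ hYm.ennreal_ofReal (hX.mono h₁ le_rfl)]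
        simp only [Pi.mul_apply, mul_comm]
    _ = ∫⁻ ω, X ω ∂(κ.trim h₁) := (lintegral_trim h₁ hX).symm
    _ ≤ ∫⁻ ω, X ω ∂(C • μ.trim h₁) := lintegral_mono' hle le_rfl
    _ = (∫⁻ ω, X ω ∂μ) * C := by
        rw [lintegral_smul_measure, lintegral_trim h₁ hX, smul_eq_mul, mul_comm]

variable {Ω : Type*} [MeasurableSpace Ω] {μ : Measure Ω}

/-- Hoeffding's lemma on `[-b, b]`, whose variance proxy is the squared half-length `b²`. -/
theorem lintegral_exp_le_of_abs_le [IsProbabilityMeasure μ] {Z : Ω → ℝ} (hZ : Measurable Z) {b : ℝ}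
    (hb : ∀ ω, |Z ω| ≤ b) (h0 : ∫ ω, Z ω ∂μ = 0) (l : ℝ) :
    ∫⁻ ω, ENNReal.ofReal (Real.exp (l * Z ω)) ∂μ ≤
      ENNReal.ofReal (Real.exp (l ^ 2 * b ^ 2 / 2)) := by
  have hmem : ∀ᵐ ω ∂μ, Z ω ∈ Icc (-b) b := Eventually.of_forall fun ω => abs_le.1 (hb ω)
  have hs := hasSubgaussianMGF_of_mem_Icc_of_integral_eq_zero hZ.aemeasurable hmem h0
  rw [← ofReal_integral_eq_lintegral_ofReal (hs.integrable_exp_mul l)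
    (Eventually.of_forall fun _ => (Real.exp_pos _).le)]
  refine ENNReal.ofReal_le_ofReal ((hs.mgf_le l).trans (Real.exp_le_exp.2 (le_of_eq ?_)))
  have : |b - -b| / 2 = |b| := by
    rw [sub_neg_eq_add, ← two_mul, abs_mul]; simp
  push_cast
  rw [Real.norm_eq_abs, this, sq_abs]
  ring

variable {E F : Type*} [MeasurableSpace E] [MeasurableSpace F] {Y : ℕ → ℕ → Ω → E}
  {Z : ℕ → ℕ → Ω → F}

theorem phiCoeff_nonneg (k : ℕ) : 0 ≤ phiCoeff μ Y Z k := by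
  refine Real.sSup_nonneg ?_
  rintro x ⟨T, t, A, B, -, -, -, -, -, rfl⟩
  exact abs_nonneg _

/-- The multiplicative form also covers null `A`, for which conditional probabilities are excluded
from `phiCoeff`. -/
theorem measure_inter_le_phiCoeff [IsProbabilityMeasure μ] {T t k : ℕ} (ht1 : 1 ≤ t) (htT : t ≤ T) {A B : Set Ω}
    (hA : MeasurableSet[sigmaField Y Z T 1 t] A)
    (hB : MeasurableSet[sigmaField Y Z T (t + k) T] B) :
    μ (B ∩ A) ≤ μ A * (μ B + ENNReal.ofReal (phiCoeff μ Y Z k)) := by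
  rcases eq_or_ne (μ A) 0 with h0 | h0
  · rw [h0, zero_mul]
    exact (measure_mono inter_subset_right).trans h0.le
  have hA0 : 0 < μ.real A := ENNReal.toReal_pos h0 (measure_ne_top _ _)
  -- A real supremum dominates its elements only for a set bounded above; here differences of
  -- probabilities are at most `1`.
  have hbdd : BddAbove {x : ℝ | ∃ (T t : ℕ) (A B : Set Ω), 1 ≤ t ∧ t ≤ T ∧
    MeasurableSet[sigmaField Y Z T 1 t] A ∧ MeasurableSet[sigmaField Y Z T (t + k) T] B ∧
    0 < μ A ∧ x = |μ.real (B ∩ A) / μ.real A - μ.real B|} := by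
    refine ⟨1, ?_⟩
    rintro x ⟨T, t, A, B, -, -, -, -, -, rfl⟩
    have h1 : μ.real (B ∩ A) / μ.real A ≤ 1 :=
      div_le_one_of_le₀ (measureReal_mono inter_subset_right) measureReal_nonneg
    have h2 : 0 ≤ μ.real (B ∩ A) / μ.real A := by positivity
    have h3 : μ.real B ≤ 1 := measureReal_le_one
    have h4 : 0 ≤ μ.real B := measureReal_nonneg
    rw [abs_le]
    constructor <;> linarith
  have hle : |μ.real (B ∩ A) / μ.real A - μ.real B| ≤ phiCoeff μ Y Z k :=
    le_csSup hbdd ⟨T, t, A, B, ht1, htT, hA, hB, pos_iff_ne_zero.2 h0, rfl⟩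
  have h5 : μ.real (B ∩ A) ≤ μ.real A * (μ.real B + phiCoeff μ Y Z k) := by
    have := (abs_le.1 hle).2
    rw [sub_le_iff_le_add, div_le_iff₀ hA0] at this
    linarith
  rw [← ofReal_measureReal (μ := μ) (s := B ∩ A), ← ofReal_measureReal (μ := μ) (s := A),
    ← ofReal_measureReal (μ := μ) (s := B), ← ENNReal.ofReal_add measureReal_nonneg
    (phiCoeff_nonneg k), ← ENNReal.ofReal_mul measureReal_nonneg]
  exact ENNReal.ofReal_le_ofReal h5

theorem sigmaField_le (hY : ∀ T t, Measurable (Y T t)) (hZ : ∀ T t, Measurable (Z T t))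
    (T a b : ℕ) : sigmaField Y Z T a b ≤ (inferInstance : MeasurableSpace Ω) :=
  iSup₂_le fun i _ => ((hY T i).prodMk (hZ T i)).comap_le

end Mixing

/-! ### Blocks of alternating parity. -/

section Blocks

/-- The times `t ∈ {1, …, T}` in the block of length `m` with index `i`. -/
def timeBlock (m T i : ℕ) : Finset ℕ := (Finset.Icc 1 T).filter fun t => t / m = i

theorem mem_timeBlock {m T i t : ℕ} : t ∈ timeBlock m T i ↔ (1 ≤ t ∧ t ≤ T) ∧ t / m = i := by
  simp [timeBlock]

/-- Blocks of equal parity are separated by a full block, which leaves the gap needed for mixing.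
The range `T / m + 1` is generous; the surplus blocks are empty. -/
theorem sum_timeBlock (m T e : ℕ) (he : e < 2) (a : ℕ → ℝ) :
    ∑ j ∈ Finset.range (T / m + 1), ∑ t ∈ timeBlock m T (2 * j + e), a t =
      ∑ t ∈ (Finset.Icc 1 T).filter (fun t => t / m % 2 = e), a t := by
  have hmaps : ∀ t ∈ (Finset.Icc 1 T).filter (fun t => t / m % 2 = e),
      t / m / 2 ∈ Finset.range (T / m + 1) := by
    intro t ht
    rw [Finset.mem_filter, Finset.mem_Icc] at ht
    have : t / m ≤ T / m := Nat.div_le_div_right ht.1.2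
    rw [Finset.mem_range]
    exact Nat.lt_succ_of_le ((Nat.div_le_self _ 2).trans this)
  rw [← Finset.sum_fiberwise_of_maps_to hmaps]
  refine Finset.sum_congr rfl fun j _ => Finset.sum_congr ?_ fun _ _ => rfl
  ext t
  simp only [timeBlock, Finset.mem_filter, and_assoc]
  constructor
  · rintro ⟨h1, h2⟩; exact ⟨h1, by omega, by omega⟩
  · rintro ⟨h1, h2, h3⟩; exact ⟨h1, by omega⟩

theorem sum_split_parity (m T : ℕ) (a : ℕ → ℝ) :
    ∑ t ∈ Finset.Icc 1 T, a t = ∑ t ∈ (Finset.Icc 1 T).filter (fun t => t / m % 2 = 0), a t +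
      ∑ t ∈ (Finset.Icc 1 T).filter (fun t => t / m % 2 = 1), a t := by
  rw [← Finset.sum_filter_add_sum_filter_not (Finset.Icc 1 T) fun t => t / m % 2 = 0]
  congr 1
  refine Finset.sum_congr (Finset.filter_congr fun t _ => ?_) fun _ _ => rfl
  omega

theorem card_timeBlock_le {m : ℕ} (hm : 1 ≤ m) (T i : ℕ) : (timeBlock m T i).card ≤ m := by
  calc (timeBlock m T i).card ≤ (Finset.Ico (i * m) ((i + 1) * m)).card := by
        refine Finset.card_le_card fun t ht => ?_
        have h := (mem_timeBlock.1 ht).2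
        have h' := (Nat.div_eq_iff (by omega)).1 h
        rw [Finset.mem_Ico]
        constructor
        · omega
        · have := Nat.succ_mul i m
          simp only [Nat.succ_eq_add_one] at this
          omega
    _ = m := by rw [Nat.card_Ico, Nat.succ_mul]; omega

theorem sum_timeBlock_le {m T : ℕ} (hm : 1 ≤ m) {a : ℕ → ℝ} {κ : ℝ} (hκ : 0 ≤ κ)
    (ha : ∀ t ∈ Finset.Icc 1 T, a t ≤ κ) (i : ℕ) : ∑ t ∈ timeBlock m T i, a t ≤ m * κ := by
  calc ∑ t ∈ timeBlock m T i, a t ≤ (timeBlock m T i).card • κ :=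
        Finset.sum_le_card_nsmul _ _ _ fun t ht => ha t (Finset.mem_filter.1 ht).1
    _ ≤ m * κ := by
        rw [nsmul_eq_mul]
        gcongr
        exact card_timeBlock_le hm T i

/-- A sum of squares is at most the largest block weight, `m * κ`, times the total weight. This is
the variance proxy in the exponential bound. -/
theorem sum_sq_timeBlock_le {m T e : ℕ} (hm : 1 ≤ m) (he : e < 2) {a : ℕ → ℝ} {κ s : ℝ}
    (hκ : 0 ≤ κ) (ha0 : ∀ t ∈ Finset.Icc 1 T, 0 ≤ a t) (ha : ∀ t ∈ Finset.Icc 1 T, a t ≤ κ)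
    (hs : ∑ t ∈ Finset.Icc 1 T, a t ≤ s) :
    ∑ j ∈ Finset.range (T / m + 1), (∑ t ∈ timeBlock m T (2 * j + e), a t) ^ 2 ≤ m * κ * s := by
  have h0 : ∀ i, 0 ≤ ∑ t ∈ timeBlock m T i, a t := fun i =>
    Finset.sum_nonneg fun t ht => ha0 t (Finset.mem_filter.1 ht).1
  calc _ ≤ ∑ j ∈ Finset.range (T / m + 1), (m * κ) * ∑ t ∈ timeBlock m T (2 * j + e), a t := by
        refine Finset.sum_le_sum fun j _ => ?_
        rw [sq]
        exact mul_le_mul_of_nonneg_right (sum_timeBlock_le hm hκ ha _) (h0 _)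
    _ = (m * κ) * ∑ t ∈ (Finset.Icc 1 T).filter (fun t => t / m % 2 = e), a t := by
        rw [← Finset.mul_sum, sum_timeBlock m T e he]
    _ ≤ m * κ * s := by
        gcongr
        refine le_trans ?_ hs
        exact Finset.sum_le_sum_of_subset_of_nonneg (Finset.filter_subset _ _)
          fun t ht _ => ha0 t ht

end Blocks

/-! ### Exponential inequality for weighted sums of a mixing array. -/

section Exponential

variable {Ω : Type*} {E F : Type*} [MeasurableSpace E] [MeasurableSpace F] {Y : ℕ → ℕ → Ω → E}
  {Z : ℕ → ℕ → Ω → F}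

theorem measurable_sum_sigmaField {T a b : ℕ} {X : ℕ → Ω → ℝ}
    (hX : ∀ t, Measurable[MeasurableSpace.comap (fun ω => (Y T t ω, Z T t ω)) inferInstance] (X t))
    (c : ℕ → ℝ) {I : Finset ℕ} (hI : ∀ t ∈ I, a ≤ t ∧ t ≤ b) :
    Measurable[sigmaField Y Z T a b] fun ω => ∑ t ∈ I, c t * X t ω := by
  refine Finset.measurable_fun_sum _ fun t ht => Measurable.const_mul ?_ _
  refine (hX t).mono ?_ le_rfl
  exact le_iSup₂_of_le (f := fun i (_ : i ∈ Finset.Icc a b) =>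
    MeasurableSpace.comap (fun ω => (Y T i ω, Z T i ω)) inferInstance) t
    (Finset.mem_Icc.2 (hI t ht)) le_rfl

variable [MeasurableSpace Ω] {μ : Measure Ω} [IsProbabilityMeasure μ]
  {T m : ℕ} {X : ℕ → Ω → ℝ} {a : ℕ → ℝ} {κ s B : ℝ}

/-- Exponential moments of sums over alternating blocks of a `φ`-mixing array. -/
theorem lintegral_exp_sum_timeBlock_le (hY : ∀ T t, Measurable (Y T t))
    (hZ : ∀ T t, Measurable (Z T t)) (hT : 1 ≤ T) (hm : 1 ≤ m) (e : ℕ)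
    (hX : ∀ t, Measurable[MeasurableSpace.comap (fun ω => (Y T t ω, Z T t ω)) inferInstance] (X t))
    (hB : ∀ t ω, |X t ω| ≤ B) (h0 : ∀ t, ∫ ω, X t ω ∂μ = 0) (hκ : 0 ≤ κ)
    (ha0 : ∀ t ∈ Finset.Icc 1 T, 0 ≤ a t) (ha : ∀ t ∈ Finset.Icc 1 T, a t ≤ κ) {l : ℝ}
    (hl : |l| * (B * (m * κ)) ≤ 1) (J : ℕ) :
    ∫⁻ ω, ENNReal.ofReal (Real.exp (l * ∑ j ∈ Finset.range J,
        ∑ t ∈ timeBlock m T (2 * j + e), a t * X t ω)) ∂μ ≤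
      ENNReal.ofReal (Real.exp (∑ j ∈ Finset.range J,
        (l ^ 2 * B ^ 2 / 2 * (∑ t ∈ timeBlock m T (2 * j + e), a t) ^ 2 +
          3 * phiCoeff μ Y Z m))) := by
  have hB0 : 0 ≤ B := (abs_nonneg _).trans (hB 0 (Classical.choice (nonempty_of_isProbabilityMeasure μ)))
  have hφ0 := phiCoeff_nonneg (μ := μ) (Y := Y) (Z := Z) m
  have hXm : ∀ t, Measurable (X t) := fun t =>
    (hX t).mono ((hY T t).prodMk (hZ T t)).comap_le le_rfl
  set w : ℕ → ℝ := fun i => ∑ t ∈ timeBlock m T i, a t with hw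
  have hw0 : ∀ i, 0 ≤ w i := fun i =>
    Finset.sum_nonneg fun t ht => ha0 t (Finset.mem_filter.1 ht).1
  have hwm : ∀ i, w i ≤ m * κ := fun i => sum_timeBlock_le hm hκ ha i
  set R : ℕ → Ω → ℝ := fun i ω => ∑ t ∈ timeBlock m T i, a t * X t ω with hR
  have hRm : ∀ i, Measurable (R i) := fun i =>
    Finset.measurable_fun_sum _ fun t _ => (hXm t).const_mul _
  have hRb : ∀ i ω, |R i ω| ≤ B * w i := by
    intro i ω
    refine (Finset.abs_sum_le_sum_abs _ _).trans ?_
    rw [hw, Finset.mul_sum]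
    refine Finset.sum_le_sum fun t ht => ?_
    have := ha0 t (Finset.mem_filter.1 ht).1
    rw [abs_mul, abs_of_nonneg this, mul_comm]
    exact mul_le_mul_of_nonneg_right (hB t ω) this
  have hXint : ∀ t, Integrable (X t) μ := fun t =>
    Integrable.of_bound (hXm t).aestronglyMeasurable B (Eventually.of_forall fun ω => hB t ω)
  have hR0 : ∀ i, ∫ ω, R i ω ∂μ = 0 := by
    intro i
    rw [hR, integral_finsetSum _ fun t _ => (hXint t).const_mul _]
    refine Finset.sum_eq_zero fun t _ => ?_
    rw [integral_const_mul, h0, mul_zero]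
  have hRexp : ∀ i, ∫⁻ ω, ENNReal.ofReal (Real.exp (l * R i ω)) ∂μ ≤
      ENNReal.ofReal (Real.exp (l ^ 2 * B ^ 2 / 2 * w i ^ 2)) := by
    intro i
    refine (lintegral_exp_le_of_abs_le (hRm i) (hRb i) (hR0 i) l).trans (le_of_eq ?_)
    congr 2
    ring
  -- The constraint on `l` keeps each exponent at most `1`, so each factor is at most `e < 3`. This
  -- `3` is the bound `M` of the decoupling lemma and the source of `3 * phiCoeff`.
  have hRle : ∀ i ω, Real.exp (l * R i ω) ≤ 3 := by
    intro i ω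
    refine le_trans (Real.exp_le_exp.2 ?_) (Real.exp_one_lt_three.le)
    refine (le_abs_self _).trans ?_
    rw [abs_mul]
    refine le_trans ?_ hl
    gcongr
    exact (hRb i ω).trans (mul_le_mul_of_nonneg_left (hwm i) hB0)
  have hstep : ∀ i, ENNReal.ofReal (Real.exp (l ^ 2 * B ^ 2 / 2 * w i ^ 2)) +
      ENNReal.ofReal 3 * ENNReal.ofReal (phiCoeff μ Y Z m) ≤
      ENNReal.ofReal (Real.exp (l ^ 2 * B ^ 2 / 2 * w i ^ 2 + 3 * phiCoeff μ Y Z m)) := by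
    intro i
    rw [← ENNReal.ofReal_mul (by norm_num), ← ENNReal.ofReal_add (Real.exp_pos _).le (by positivity)]
    refine ENNReal.ofReal_le_ofReal ?_
    rw [Real.exp_add]
    have h1 : 1 ≤ Real.exp (l ^ 2 * B ^ 2 / 2 * w i ^ 2) := Real.one_le_exp (by positivity)
    have h2 : 3 * phiCoeff μ Y Z m + 1 ≤ Real.exp (3 * phiCoeff μ Y Z m) := Real.add_one_le_exp _
    nlinarith
  induction J with
  | zero => simp
  | succ J ih =>
    rw [Finset.sum_range_succ (fun j => l ^ 2 * B ^ 2 / 2 * w (2 * j + e) ^ 2 + 3 * phiCoeff μ Y Z m),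
      Real.exp_add, ENNReal.ofReal_mul (Real.exp_pos _).le]
    have hsplit : ∀ ω, ENNReal.ofReal (Real.exp (l * ∑ j ∈ Finset.range (J + 1),
        R (2 * j + e) ω)) = ENNReal.ofReal (Real.exp (l * ∑ j ∈ Finset.range J,
        R (2 * j + e) ω)) * ENNReal.ofReal (Real.exp (l * R (2 * J + e) ω)) := fun ω => by
      rw [Finset.sum_range_succ, mul_add, Real.exp_add, ENNReal.ofReal_mul (Real.exp_pos _).le]
    change ∫⁻ ω, ENNReal.ofReal (Real.exp (l * ∑ j ∈ Finset.range (J + 1), R (2 * j + e) ω)) ∂μ ≤ _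
    simp only [hsplit]
    -- The first block has no past to be decoupled from, and for `e = 0` the index `2 * J + e - 1`
    -- below would be truncated.
    rcases Nat.eq_zero_or_pos J with hJ | hJ
    · subst hJ
      simp only [Finset.range_zero, Finset.sum_empty, mul_zero, Real.exp_zero, ENNReal.ofReal_one,
        one_mul]
      exact (hRexp _).trans (le_self_add.trans (hstep _))
    -- The separating block has index `2J + e - 1`: earlier blocks of this parity end before it
    -- starts, and the new one begins `m` later. The minimum with `T` respects `t ≤ T` in
    -- `phiCoeff`.
    set t₁ := min ((2 * J + e - 1) * m) T with ht₁
    have hpos : 1 ≤ (2 * J + e - 1) * m := Nat.one_le_iff_ne_zero.2 (by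
      refine Nat.mul_ne_zero ?_ ?_ <;> omega)
    have hmeas1 : Measurable[sigmaField Y Z T 1 t₁] fun ω =>
        ENNReal.ofReal (Real.exp (l * ∑ j ∈ Finset.range J, R (2 * j + e) ω)) := by
      refine ENNReal.measurable_ofReal.comp (Real.measurable_exp.comp (Measurable.const_mul ?_ _))
      refine Finset.measurable_fun_sum _ fun j hj => measurable_sum_sigmaField hX a fun t ht => ?_
      obtain ⟨⟨h1, h2⟩, h3⟩ := mem_timeBlock.1 ht
      refine ⟨h1, le_min ?_ h2⟩
      have hj' := Finset.mem_range.1 hj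
      have h4 : t < (2 * j + e + 1) * m := by
        rw [← Nat.div_lt_iff_lt_mul (by omega)]; omega
      exact h4.le.trans (Nat.mul_le_mul_right m (by omega))
    have hmeas2 : Measurable[sigmaField Y Z T (t₁ + m) T] fun ω =>
        Real.exp (l * R (2 * J + e) ω) := by
      refine Real.measurable_exp.comp (Measurable.const_mul ?_ _)
      refine measurable_sum_sigmaField hX a fun t ht => ?_
      obtain ⟨⟨h1, h2⟩, h3⟩ := mem_timeBlock.1 ht
      refine ⟨?_, h2⟩
      have h4 : (2 * J + e) * m ≤ t := by
        rw [← Nat.le_div_iff_mul_le (by omega)]; omega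
      have h5 : (2 * J + e - 1) * m + m = (2 * J + e) * m := by
        rw [← Nat.succ_mul]; congr 1; omega
      have := min_le_left ((2 * J + e - 1) * m) T
      omega
    calc _ ≤ _ := lintegral_mul_le_of_mixing (sigmaField_le hY hZ _ _ _) (sigmaField_le hY hZ _ _ _)
          (fun A B hA hB => measure_inter_le_phiCoeff (le_min hpos hT) (min_le_right _ _) hA hB)
          hmeas1 hmeas2 (fun ω => (Real.exp_pos _).le) (hRle _)
      _ ≤ _ := by
          gcongr
          exact (add_le_add_left (hRexp _) _).trans (hstep _)

/-- Chernoff's bound for one parity class. The sign of `l` is free, so both tails are covered. -/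
theorem measure_parity_sum_ge_le (hY : ∀ T t, Measurable (Y T t))
    (hZ : ∀ T t, Measurable (Z T t)) (hT : 1 ≤ T) (hm : 1 ≤ m) {e : ℕ} (he : e < 2)
    (hX : ∀ t, Measurable[MeasurableSpace.comap (fun ω => (Y T t ω, Z T t ω)) inferInstance] (X t))
    (hB : ∀ t ω, |X t ω| ≤ B) (h0 : ∀ t, ∫ ω, X t ω ∂μ = 0) (hκ : 0 ≤ κ)
    (ha0 : ∀ t ∈ Finset.Icc 1 T, 0 ≤ a t) (ha : ∀ t ∈ Finset.Icc 1 T, a t ≤ κ)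
    (hs : ∑ t ∈ Finset.Icc 1 T, a t ≤ s) {l : ℝ}
    (hl : |l| * (B * (m * κ)) ≤ 1) (x : ℝ) :
    μ {ω | x ≤ l * ∑ t ∈ (Finset.Icc 1 T).filter (fun t => t / m % 2 = e), a t * X t ω} ≤
      ENNReal.ofReal (Real.exp (-x + l ^ 2 * B ^ 2 / 2 * (m * κ * s) +
        3 * phiCoeff μ Y Z m * (T / m + 1))) := by
  have hXm : ∀ t, Measurable (X t) := fun t =>
    (hX t).mono ((hY T t).prodMk (hZ T t)).comap_le le_rfl
  have hφ0 := phiCoeff_nonneg (μ := μ) (Y := Y) (Z := Z) m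
  have hmain := lintegral_exp_sum_timeBlock_le (μ := μ) hY hZ hT hm e hX hB h0 hκ ha0 ha hl (T / m + 1)
  have heq : ∀ ω, ∑ j ∈ Finset.range (T / m + 1), ∑ t ∈ timeBlock m T (2 * j + e), a t * X t ω =
      ∑ t ∈ (Finset.Icc 1 T).filter (fun t => t / m % 2 = e), a t * X t ω := fun ω =>
    sum_timeBlock m T e he fun t => a t * X t ω
  simp only [heq] at hmain
  set W : Ω → ℝ := fun ω => ∑ t ∈ (Finset.Icc 1 T).filter (fun t => t / m % 2 = e), a t * X t ω
  have hW : Measurable W := Finset.measurable_fun_sum _ fun t _ => (hXm t).const_mul _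
  have hexp : ∑ j ∈ Finset.range (T / m + 1),
        (l ^ 2 * B ^ 2 / 2 * (∑ t ∈ timeBlock m T (2 * j + e), a t) ^ 2 + 3 * phiCoeff μ Y Z m) ≤
      l ^ 2 * B ^ 2 / 2 * (m * κ * s) + 3 * phiCoeff μ Y Z m * (T / m + 1) := by
    rw [Finset.sum_add_distrib, ← Finset.mul_sum]
    refine add_le_add (mul_le_mul_of_nonneg_left
      (sum_sq_timeBlock_le hm he hκ ha0 ha hs) (by positivity)) ?_
    rw [Finset.sum_const, Finset.card_range, nsmul_eq_mul, mul_comm]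
    gcongr
    push_cast
    gcongr
    exact Nat.cast_div_le
  have hmark := mul_meas_ge_le_lintegral (μ := μ)
    (f := fun ω => ENNReal.ofReal (Real.exp (l * W ω)))
    (Real.measurable_exp.comp (hW.const_mul l)).ennreal_ofReal (ENNReal.ofReal (Real.exp x))
  have hset : {ω | x ≤ l * W ω} ⊆
      {ω | ENNReal.ofReal (Real.exp x) ≤ ENNReal.ofReal (Real.exp (l * W ω))} := fun ω hω =>
    ENNReal.ofReal_le_ofReal (Real.exp_le_exp.2 hω)
  have hpos : ENNReal.ofReal (Real.exp x) ≠ 0 := by simpa using Real.exp_pos x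
  rw [← ENNReal.mul_le_mul_iff_right hpos ENNReal.ofReal_ne_top]
  calc _ ≤ ENNReal.ofReal (Real.exp x) *
        μ {ω | ENNReal.ofReal (Real.exp x) ≤ ENNReal.ofReal (Real.exp (l * W ω))} := by gcongr
    _ ≤ _ := hmark.trans hmain
    _ ≤ _ := by
        rw [← ENNReal.ofReal_mul (Real.exp_pos _).le, ← Real.exp_add]
        refine ENNReal.ofReal_le_ofReal (Real.exp_le_exp.2 ?_)
        linarith

/-- A Hoeffding inequality for weighted sums of a `φ`-mixing array. -/
theorem measure_abs_sum_ge_le (hY : ∀ T t, Measurable (Y T t))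
    (hZ : ∀ T t, Measurable (Z T t)) (hT : 1 ≤ T) (hm : 1 ≤ m)
    (hX : ∀ t, Measurable[MeasurableSpace.comap (fun ω => (Y T t ω, Z T t ω)) inferInstance] (X t))
    (hB : ∀ t ω, |X t ω| ≤ B) (h0 : ∀ t, ∫ ω, X t ω ∂μ = 0) (hκ : 0 ≤ κ)
    (ha0 : ∀ t ∈ Finset.Icc 1 T, 0 ≤ a t) (ha : ∀ t ∈ Finset.Icc 1 T, a t ≤ κ)
    (hs : ∑ t ∈ Finset.Icc 1 T, a t ≤ s) {l : ℝ} (hl0 : 0 < l)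
    (hl : l * (B * (m * κ)) ≤ 1) (x : ℝ) :
    μ {ω | 2 * x ≤ |∑ t ∈ Finset.Icc 1 T, a t * X t ω|} ≤
      4 * ENNReal.ofReal (Real.exp (-(l * x) + l ^ 2 * B ^ 2 / 2 * (m * κ * s) +
        3 * phiCoeff μ Y Z m * (T / m + 1))) := by
  -- If the total is at least `2x` in absolute value, one parity class is at least `x` in absolute
  -- value: two classes and two signs give the factor `4`.
  set P : ℝ → ℕ → Set Ω := fun l' e =>
    {ω | l * x ≤ l' * ∑ t ∈ (Finset.Icc 1 T).filter (fun t => t / m % 2 = e), a t * X t ω} with hP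
  have hsub : {ω | 2 * x ≤ |∑ t ∈ Finset.Icc 1 T, a t * X t ω|} ⊆
      (P l 0 ∪ P l 1) ∪ (P (-l) 0 ∪ P (-l) 1) := by
    intro ω hω
    simp only [mem_ofPred_eq] at hω
    rw [sum_split_parity m T fun t => a t * X t ω] at hω
    simp only [hP, mem_union, mem_ofPred_eq]
    by_contra! hcon
    obtain ⟨⟨h1, h2⟩, h3, h4⟩ := hcon
    rw [neg_mul, ← mul_neg] at h3 h4
    have h1' := lt_of_mul_lt_mul_left h1 hl0.le
    have h2' := lt_of_mul_lt_mul_left h2 hl0.le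
    have h3' := lt_of_mul_lt_mul_left h3 hl0.le
    have h4' := lt_of_mul_lt_mul_left h4 hl0.le
    rcases le_abs.1 hω with h | h <;> linarith
  have hb : ∀ l', |l'| = l → ∀ e < 2, μ (P l' e) ≤
      ENNReal.ofReal (Real.exp (-(l * x) + l ^ 2 * B ^ 2 / 2 * (m * κ * s) +
        3 * phiCoeff μ Y Z m * (T / m + 1))) := by
    intro l' hl' e he
    have := measure_parity_sum_ge_le (μ := μ) hY hZ hT hm he hX hB h0 hκ ha0 ha hs (l := l')
      (by rw [hl']; exact hl) (l * x)
    rwa [← sq_abs l', hl'] at this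
  have hp := abs_of_pos hl0
  have hn : |(-l)| = l := by rw [abs_neg, hp]
  calc _ ≤ _ := measure_mono hsub
    _ ≤ _ := (measure_union_le _ _).trans (add_le_add (measure_union_le _ _) (measure_union_le _ _))
    _ ≤ _ := add_le_add (add_le_add (hb l hp 0 (by norm_num)) (hb l hp 1 (by norm_num)))
        (add_le_add (hb _ hn 0 (by norm_num)) (hb _ hn 1 (by norm_num)))
    _ = _ := by ring

end Exponential

/-! ### Riemann sums of the kernel. -/

section Kernel

variable {K : ℝ → ℝ}

theorem IsKernel.contDiff_one (hK : IsKernel K) : ContDiff ℝ 1 K := by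
  obtain ⟨k, hk, hcd, -⟩ := hK.order
  exact hcd.of_le (by exact_mod_cast (by omega : 1 ≤ k))

theorem IsKernel.continuous (hK : IsKernel K) : Continuous K := hK.contDiff_one.continuous

theorem IsKernel.continuous_deriv (hK : IsKernel K) : Continuous (deriv K) :=
  hK.contDiff_one.continuous_deriv le_rfl

/-- A continuous derivative leaves only the tails. In the second alternative `K'` is odd because `K`
is even, so the decay of order `|x| ^ (-v)` at `+∞` settles both sides. -/
theorem IsKernel.integrable_deriv (hK : IsKernel K) : Integrable (deriv K) := by
  have hc := hK.continuous_deriv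
  obtain ⟨L, hL | ⟨C, v, hv, -, hb⟩⟩ := hK.tail
  · refine hc.integrable_of_hasCompactSupport
      (HasCompactSupport.of_support_subset_isCompact (isCompact_Icc (a := -L) (b := L)) ?_)
    intro x hx
    by_contra hcon
    refine hx ?_
    have hLx : L < |x| := by
      by_contra h
      exact hcon (abs_le.1 (not_lt.1 h))
    have hev : K =ᶠ[𝓝 x] fun _ => 0 := by
      filter_upwards [continuous_abs.continuousAt.eventually_const_lt hLx] with y hy using hL y hy
    rw [hev.deriv_eq, deriv_const]
  · have hodd : ∀ x, deriv K (-x) = - deriv K x := by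
      intro x
      have h1 : (fun y => K (-y)) = K := funext hK.symm
      have h2 := deriv_comp_neg K x
      rw [h1] at h2
      linarith
    refine hc.locallyIntegrable.integrable_of_isBigO_atTop_of_norm_isNegInvariant
      (g := fun x : ℝ => x ^ (-v)) (Eventually.of_forall fun x => by simp [hodd]) ?_ ?_
    · refine Asymptotics.IsBigO.of_bound |C| ?_
      filter_upwards [eventually_gt_atTop L, eventually_gt_atTop 0] with x hx hx0
      have h1 := hb x (by rwa [abs_of_pos hx0])
      rw [abs_of_pos hx0] at h1
      rw [Real.norm_eq_abs, Real.norm_eq_abs, abs_of_nonneg (Real.rpow_nonneg hx0.le _)]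
      exact h1.trans (mul_le_mul_of_nonneg_right (le_abs_self C) (Real.rpow_nonneg hx0.le _))
    · exact ⟨Ioi 1, Ioi_mem_atTop 1, integrableOn_Ioi_rpow_of_lt (by linarith) one_pos⟩

/-- On a cell, `K` at the right end exceeds `K x` by at most the integral of `|K'|`; averaging over
`x` gives the bound. Summed over adjacent cells, it controls Riemann sums by `∫ K + d ∫ |K'|`, with
no monotonicity of `K`. -/
theorem IsKernel.mul_le_integral_cell (hK : IsKernel K) {a d : ℝ} (hd : 0 ≤ d) :
    d * K (a + d) ≤ ∫ x in a..(a + d), (K x + d * |deriv K x|) := by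
  have hc := hK.continuous_deriv
  have hab : a ≤ a + d := by linarith
  have hpt : ∀ x ∈ Icc a (a + d), K (a + d) ≤ K x + ∫ y in a..(a + d), |deriv K y| := by
    intro x hx
    have h1 : ∫ y in x..(a + d), deriv K y = K (a + d) - K x :=
      intervalIntegral.integral_eq_sub_of_hasDerivAt
        (fun y _ => (hK.contDiff_one.differentiable one_ne_zero y).hasDerivAt)
        (hc.intervalIntegrable _ _)
    have h2 : ∫ y in x..(a + d), deriv K y ≤ ∫ y in x..(a + d), |deriv K y| :=
      intervalIntegral.integral_mono_on hx.2 (hc.intervalIntegrable _ _)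
        (hc.abs.intervalIntegrable _ _) fun y _ => le_abs_self _
    have h3 : ∫ y in x..(a + d), |deriv K y| ≤ ∫ y in a..(a + d), |deriv K y| :=
      intervalIntegral.integral_mono_interval hx.1 hx.2 le_rfl
        (Eventually.of_forall fun y => abs_nonneg _) (hc.abs.intervalIntegrable _ _)
    linarith
  have hmono : ∫ _ in a..(a + d), K (a + d) ≤
      ∫ x in a..(a + d), (K x + ∫ y in a..(a + d), |deriv K y|) := intervalIntegral.integral_mono_on hab
    (continuous_const.intervalIntegrable (μ := volume) a (a + d))
    ((hK.continuous.add continuous_const).intervalIntegrable _ _) hpt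
  rw [intervalIntegral.integral_const, smul_eq_mul,
    intervalIntegral.integral_add (hK.continuous.intervalIntegrable _ _)
      (continuous_const.intervalIntegrable _ _), intervalIntegral.integral_const, smul_eq_mul] at hmono
  have hadd : ∫ x in a..(a + d), (K x + d * |deriv K x|) =
      (∫ x in a..(a + d), K x) + d * ∫ x in a..(a + d), |deriv K x| := by
    rw [← intervalIntegral.integral_const_mul]
    exact intervalIntegral.integral_add (hK.continuous.intervalIntegrable _ _)
      ((continuous_const.mul hc.abs).intervalIntegrable _ _)
  rw [hadd]
  simpa using hmono

theorem IsKernel.mul_sum_le (hK : IsKernel K) {d : ℝ} (hd : 0 ≤ d) (c : ℝ) (T : ℕ) :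
    d * ∑ k ∈ Finset.range T, K (c + (k + 1 : ℕ) * d) ≤ 1 + d * ∫ x, |deriv K x| := by
  have hint : Integrable fun x => K x + d * |deriv K x| :=
    hK.integrable.add (hK.integrable_deriv.abs.const_mul d)
  have hcell : ∀ k : ℕ, d * K (c + (k + 1 : ℕ) * d) ≤
      ∫ x in (c + k * d)..(c + (k + 1 : ℕ) * d), (K x + d * |deriv K x|) := by
    intro k
    have h := hK.mul_le_integral_cell (a := c + k * d) hd
    have he : c + k * d + d = c + (k + 1 : ℕ) * d := by push_cast; ring
    rwa [he] at h
  rw [Finset.mul_sum]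
  calc _ ≤ ∑ k ∈ Finset.range T,
        ∫ x in (c + k * d)..(c + (k + 1 : ℕ) * d), (K x + d * |deriv K x|) :=
        Finset.sum_le_sum fun k _ => hcell k
    _ = ∫ x in (c + (0 : ℕ) * d)..(c + T * d), (K x + d * |deriv K x|) :=
        intervalIntegral.sum_integral_adjacent_intervals (a := fun k : ℕ => c + k * d)
          fun k _ => hint.intervalIntegrable
    _ ≤ ∫ x, (K x + d * |deriv K x|) := by
        rw [intervalIntegral.integral_of_le (by simp; positivity)]
        exact setIntegral_le_integral hint
          (Eventually.of_forall fun x => add_nonneg (hK.nonneg x) (by positivity))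
    _ = _ := by
        rw [integral_add hK.integrable (hK.integrable_deriv.abs.const_mul d), hK.integral,
          integral_const_mul]

/-- Kernel weights sum to at most a multiple of `T h`. -/
theorem IsKernel.sum_le (hK : IsKernel K) {T : ℕ} (hT : 1 ≤ T) {h : ℝ} (hh : 0 < h) (u : ℝ) :
    ∑ t ∈ Finset.Icc 1 T, K ((u - (t : ℝ) / T) / h) ≤ T * h + ∫ x, |deriv K x| := by
  have hT0 : (0 : ℝ) < T := by exact_mod_cast hT
  have hTh : 0 < T * h := by positivity
  have hsum : ∑ t ∈ Finset.Icc 1 T, K ((u - (t : ℝ) / T) / h) =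
      ∑ k ∈ Finset.range T, K (-(u / h) + (k + 1 : ℕ) * (1 / (T * h))) := by
    rw [Finset.range_eq_Ico, Finset.sum_Ico_add' (fun k : ℕ => K (-(u / h) + (k : ℕ) * (1 / (T * h))))]
    refine Finset.sum_congr ?_ fun t _ => ?_
    · ext; simp
    · rw [← hK.symm]
      congr 1
      field_simp
      ring
  have hle := hK.mul_sum_le (d := 1 / (T * h)) (by positivity) (-(u / h)) T
  rw [← hsum] at hle
  have h2 := mul_le_mul_of_nonneg_left hle hTh.le
  have e1 : ∀ a : ℝ, T * h * (1 / (T * h) * a) = a := fun a => by field_simp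
  rw [e1, mul_add, e1, mul_one] at h2
  exact h2

/-- The total kernel weight at `u`. -/
noncomputable def kernelMass (K : ℝ → ℝ) (h : ℕ → ℝ) (T : ℕ) (u : ℝ) : ℝ :=
  1 / (T * h T) * ∑ t ∈ Finset.Icc 1 T, K ((u - (t : ℝ) / T) / h T)

theorem IsKernel.eventually_sum_le (hK : IsKernel K) {h : ℕ → ℝ} (hpos : ∀ T, 1 ≤ T → 0 < h T)
    (hTh : Tendsto (fun T : ℕ => T * h T) atTop atTop) :
    ∀ᶠ T : ℕ in atTop, ∀ u, ∑ t ∈ Finset.Icc 1 T, K ((u - (t : ℝ) / T) / h T) ≤ 2 * (T * h T) := by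
  filter_upwards [eventually_ge_atTop 1, hTh.eventually_ge_atTop (∫ x, |deriv K x|)] with T hT hT2 u
  have := hK.sum_le hT (hpos T hT) u
  linarith

theorem IsKernel.kernelMass_nonneg (hK : IsKernel K) {h : ℕ → ℝ} {T : ℕ} (hpos : 0 ≤ h T) (u : ℝ) :
    0 ≤ kernelMass K h T u :=
  mul_nonneg (by positivity) (Finset.sum_nonneg fun _ _ => hK.nonneg _)

theorem IsKernel.eventually_kernelMass_le (hK : IsKernel K) {h : ℕ → ℝ}
    (hpos : ∀ T, 1 ≤ T → 0 < h T) (hTh : Tendsto (fun T : ℕ => T * h T) atTop atTop) :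
    ∀ᶠ T : ℕ in atTop, ∀ u, kernelMass K h T u ≤ 2 := by
  filter_upwards [hK.eventually_sum_le hpos hTh, hTh.eventually_gt_atTop 0] with T hT hT0 u
  rw [kernelMass, one_div_mul_eq_div, div_le_iff₀ hT0]
  exact hT u

/-- An interval of length `ℓ ≥ 2` contains at least `ℓ - 1 ≥ ℓ / 2` integers. -/
theorem mul_le_sum_of_le_on_Icc {T : ℕ} {lo hi κ : ℝ} (hlo : 0 < lo) (hhi : hi ≤ T)
    (hlen : 2 ≤ hi - lo) {g : ℕ → ℝ} (hg0 : ∀ t, 0 ≤ g t) (hκ : 0 ≤ κ)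
    (hg : ∀ t : ℕ, lo ≤ t → t ≤ hi → κ ≤ g t) :
    κ * ((hi - lo) / 2) ≤ ∑ t ∈ Finset.Icc 1 T, g t := by
  have hhi0 : 0 ≤ hi := by linarith
  have hcard : (hi - lo) / 2 ≤ ((Finset.Icc ⌈lo⌉₊ ⌊hi⌋₊).card : ℝ) := by
    have h1 := Nat.ceil_lt_add_one hlo.le
    have h2 := Nat.lt_floor_add_one hi
    have h3 : ⌈lo⌉₊ ≤ ⌊hi⌋₊ + 1 := by
      have : (⌈lo⌉₊ : ℝ) ≤ ⌊hi⌋₊ + 1 := by linarith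
      exact_mod_cast this
    rw [Nat.card_Icc, Nat.cast_sub h3]
    push_cast
    linarith
  calc κ * ((hi - lo) / 2) ≤ κ * ((Finset.Icc ⌈lo⌉₊ ⌊hi⌋₊).card : ℝ) := by gcongr
    _ = ∑ t ∈ Finset.Icc ⌈lo⌉₊ ⌊hi⌋₊, κ := by rw [Finset.sum_const, nsmul_eq_mul, mul_comm]
    _ ≤ ∑ t ∈ Finset.Icc ⌈lo⌉₊ ⌊hi⌋₊, g t := Finset.sum_le_sum fun t ht => by
        rw [Finset.mem_Icc] at ht
        exact hg t (Nat.ceil_le.1 ht.1) ((Nat.le_floor_iff hhi0).1 ht.2)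
    _ ≤ ∑ t ∈ Finset.Icc 1 T, g t := by
        refine Finset.sum_le_sum_of_subset_of_nonneg (Finset.Icc_subset_Icc ?_ ?_)
          fun t _ _ => hg0 t
        · exact Nat.one_le_iff_ne_zero.2 (Nat.ceil_pos.2 hlo).ne'
        · exact Nat.floor_le_of_le hhi

/-- The total kernel weight is bounded below uniformly on the unit interval. -/
theorem IsKernel.eventually_le_kernelMass (hK : IsKernel K) {h : ℕ → ℝ}
    (hpos : ∀ T, 1 ≤ T → 0 < h T) (h0 : Tendsto h atTop (𝓝 0))
    (hTh : Tendsto (fun T : ℕ => T * h T) atTop atTop) :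
    ∃ c : ℝ, 0 < c ∧ ∀ᶠ T : ℕ in atTop, ∀ u ∈ Icc (0 : ℝ) 1, c ≤ kernelMass K h T u := by
  -- An even kernel vanishing on the positive half-line would have integral zero. Near such an `a`,
  -- the kernel stays above `K a / 2` on `[a, b]`.
  obtain ⟨a, ha, hKa⟩ : ∃ a : ℝ, 0 < a ∧ 0 < K a := by
    by_contra! hcon
    have hzero : ∀ᵐ x ∂(volume : Measure ℝ), K x = 0 := by
      filter_upwards [Measure.ae_ne volume (0 : ℝ)] with x hx
      rcases lt_or_gt_of_ne hx with hx | hx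
      · rw [← hK.symm]
        exact le_antisymm (hcon _ (by linarith)) (hK.nonneg _)
      · exact le_antisymm (hcon _ hx) (hK.nonneg _)
    have := hK.integral
    rw [integral_congr_ae (g := fun _ => (0 : ℝ)) hzero, integral_zero] at this
    exact zero_ne_one this
  obtain ⟨r, hr, hball⟩ := Metric.eventually_nhds_iff.1
    (hK.continuous.continuousAt.eventually_const_lt (half_lt_self hKa) : ∀ᶠ x in 𝓝 a, K a / 2 < K x)
  set b := a + r / 2 with hb
  have hKab : ∀ x, a ≤ x → x ≤ b → K a / 2 ≤ K x := fun x h1 h2 =>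
    (hball (by rw [Real.dist_eq, abs_of_nonneg (by linarith)]; linarith)).le
  refine ⟨K a / 2 * (r / 2 / 2), by positivity, ?_⟩
  have hb0 : 0 < b := by positivity
  filter_upwards [eventually_ge_atTop 1, h0.eventually_lt_const (by positivity : 0 < 1 / 2 / b),
    hTh.eventually_ge_atTop (2 / (r / 2))] with T hT hhb hlen u hu
  have hT0 : (0 : ℝ) < T := by exact_mod_cast hT
  have hh := hpos T hT
  have hThp : 0 < T * h T := by positivity
  rw [lt_div_iff₀ hb0] at hhb
  rw [div_le_iff₀ (by positivity)] at hlen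
  rw [kernelMass, one_div_mul_eq_div, le_div_iff₀ hThp]
  have hlen' : T * (h T * b) - T * (h T * a) = T * h T * (r / 2) := by rw [hb]; ring
  have hdiv : ∀ t : ℕ, (t : ℝ) = T * (t / T) := fun t => by field_simp
  -- One side of `u` always has room: the window `u + h [a, b]` fits in `[0, 1]` when `u ≤ 1/2`, and
  -- `u - h [a, b]` otherwise, because `h * b < 1/2`. The evenness of `K` makes both windows equally
  -- good.
  rcases le_total u (1 / 2) with hu2 | hu2
  · have := mul_le_sum_of_le_on_Icc (T := T) (lo := T * (u + h T * a)) (hi := T * (u + h T * b))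
      (κ := K a / 2) (g := fun t => K ((u - (t : ℝ) / T) / h T))
      (by have := hu.1; positivity) (by
        have : u + h T * b ≤ 1 := by linarith
        nlinarith) (by linarith) (fun _ => hK.nonneg _) (by positivity) (by
        intro t h1 h2
        rw [← hK.symm ((u - (t : ℝ) / T) / h T)]
        rw [hdiv t] at h1 h2
        have h1' := le_of_mul_le_mul_left h1 hT0
        have h2' := le_of_mul_le_mul_left h2 hT0
        refine hKab _ ?_ ?_
        · rw [← neg_div, le_div_iff₀ hh]; linarith
        · rw [← neg_div, div_le_iff₀ hh]; linarith)
    refine le_trans (le_of_eq ?_) this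
    linear_combination (- (K a / 2) / 2) * hlen'
  · have := mul_le_sum_of_le_on_Icc (T := T) (lo := T * (u - h T * b)) (hi := T * (u - h T * a))
      (κ := K a / 2) (g := fun t => K ((u - (t : ℝ) / T) / h T))
      (mul_pos hT0 (by linarith)) (by
        have : u - h T * a ≤ 1 := by have := hu.2; have : 0 < h T * a := by positivity
                                     linarith
        nlinarith) (by linarith) (fun _ => hK.nonneg _) (by positivity) (by
        intro t h1 h2
        rw [hdiv t] at h1 h2
        have h1' := le_of_mul_le_mul_left h1 hT0
        have h2' := le_of_mul_le_mul_left h2 hT0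
        refine hKab _ ?_ ?_
        · rw [le_div_iff₀ hh]; linarith
        · rw [div_le_iff₀ hh]; linarith)
    refine le_trans (le_of_eq ?_) this
    linear_combination (- (K a / 2) / 2) * hlen'

/-- Away from `u` the kernel weights are negligible compared with the bandwidth. -/
theorem IsKernel.eventually_le_mul (hK : IsKernel K) {h : ℕ → ℝ}
    (hpos : ∀ T, 1 ≤ T → 0 < h T) (h0 : Tendsto h atTop (𝓝 0)) {a ε : ℝ} (ha : 0 < a)
    (hε : 0 < ε) : ∀ᶠ T in atTop, ∀ x : ℝ, a ≤ |x| → K (x / h T) ≤ ε * h T := by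
  have hdec : ∀ᶠ x : ℝ in cocompact ℝ, |x| * K x < ε * a :=
    hK.decay.eventually_lt_const (by positivity)
  rw [cocompact_eq_atBot_atTop, eventually_sup, eventually_atBot, eventually_atTop] at hdec
  obtain ⟨⟨N₁, hN₁⟩, N₂, hN₂⟩ := hdec
  set N := max (max |N₁| |N₂|) 1
  have hN : 0 < N := lt_max_of_lt_right one_pos
  have hfar : ∀ x : ℝ, N ≤ |x| → |x| * K x < ε * a := by
    intro x hx
    rcases le_total 0 x with hx0 | hx0
    · rw [abs_of_nonneg hx0] at hx
      refine hN₂ x ((le_abs_self _).trans (le_trans ?_ hx))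
      exact (le_max_right _ _).trans (le_max_left _ _)
    · rw [abs_of_nonpos hx0] at hx
      refine hN₁ x ?_
      have h1 : |N₁| ≤ -x := le_trans ((le_max_left _ _).trans (le_max_left _ _)) hx
      have := neg_abs_le N₁
      linarith
  filter_upwards [eventually_ge_atTop 1, h0.eventually_lt_const (by positivity : 0 < a / N)]
    with T hT hha x hx
  have hh := hpos T hT
  rw [lt_div_iff₀ hN] at hha
  have habs : |x / h T| = |x| / h T := by rw [abs_div, abs_of_pos hh]
  have h1 := hfar (x / h T) (by rw [habs, le_div_iff₀ hh]; linarith)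
  rw [habs, div_mul_eq_mul_div, div_lt_iff₀ hh] at h1
  have h2 : a * K (x / h T) ≤ |x| * K (x / h T) :=
    mul_le_mul_of_nonneg_right hx (hK.nonneg _)
  have h3 : a * K (x / h T) ≤ a * (ε * h T) := by linarith
  exact le_of_mul_le_mul_left h3 ha

end Kernel

/-! ### Modulus of continuity of the local criterion. -/

section Criterion

variable {Ω : Type*} {dz dρ : ℕ} {Γ : Set (Vec dρ)} {f : Vec dz → Vec dρ → ℝ}
  {D : Set (ℝ × Vec dz)} {B C : ℝ} {Y : ℕ → ℕ → Ω → ℝ} {Z : ℕ → ℕ → Ω → Vec dz} {K : ℝ → ℝ}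
  {h : ℕ → ℝ}

/-- The local criterion depends continuously on the rescaled time and on the parameter. -/
theorem RegularLoss.abs_localCriterion_sub_le (hl : RegularLoss D Γ f B C) (hK : IsKernel K)
    {L : ℝ} (hL : ∀ x x', |K x - K x'| ≤ L * |x - x'|) {T : ℕ} (hT : 1 ≤ T) (hh : 0 < h T)
    {ω : Ω} (hω : ∀ t ∈ Finset.Icc 1 T, (Y T t ω, Z T t ω) ∈ D) {u u' : ℝ} {ρ ρ' : Vec dρ}
    (hρ' : ρ' ∈ Γ) {ε : ℝ}
    (hε : ∀ w ∈ D, |sqLoss f w.1 w.2 ρ - sqLoss f w.1 w.2 ρ'| ≤ ε) :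
    |localCriterion f K h Y Z T u ω ρ - localCriterion f K h Y Z T u' ω ρ'| ≤
      ε * kernelMass K h T u + B * L * |u - u'| / h T ^ 2 := by
  have hT0 : (0 : ℝ) < T := by exact_mod_cast hT
  have hp : (0 : ℝ) ≤ 1 / (T * h T) := by positivity
  rw [localCriterion, localCriterion, ← mul_sub, ← Finset.sum_sub_distrib, abs_mul,
    abs_of_nonneg hp, kernelMass]
  calc _ ≤ 1 / (T * h T) * ∑ t ∈ Finset.Icc 1 T,
        (ε * K ((u - (t : ℝ) / T) / h T) + B * (L * (|u - u'| / h T))) := by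
        refine mul_le_mul_of_nonneg_left ((Finset.abs_sum_le_sum_abs _ _).trans
          (Finset.sum_le_sum fun t ht => ?_)) hp
        have h1 := hε _ (hω t ht)
        have h2 := hl.le _ (hω t ht) ρ' hρ'
        have h3 := sqLoss_nonneg f (Y T t ω) (Z T t ω) ρ'
        have h4 := hL ((u - (t : ℝ) / T) / h T) ((u' - (t : ℝ) / T) / h T)
        rw [← sub_div, sub_sub_sub_cancel_right, abs_div, abs_of_pos hh] at h4
        have h5 := hK.nonneg ((u - (t : ℝ) / T) / h T)
        set k := K ((u - (t : ℝ) / T) / h T)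
        set k' := K ((u' - (t : ℝ) / T) / h T)
        simp only at h1 h2
        set a := sqLoss f (Y T t ω) (Z T t ω) ρ
        set b := sqLoss f (Y T t ω) (Z T t ω) ρ'
        calc |a * k - b * k'| = |(a - b) * k + b * (k - k')| := by congr 1; ring
          _ ≤ |a - b| * k + b * |k - k'| := by
              refine (abs_add_le _ _).trans (le_of_eq ?_)
              rw [abs_mul, abs_mul, abs_of_nonneg h5, abs_of_nonneg h3]
          _ ≤ _ := by
              refine add_le_add (mul_le_mul_of_nonneg_right h1 h5) ?_
              exact mul_le_mul h2 h4 (abs_nonneg _) (h3.trans h2)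
    _ = _ := by
        rw [Finset.sum_add_distrib, ← Finset.mul_sum, Finset.sum_const, Nat.card_Icc,
          add_tsub_cancel_right, nsmul_eq_mul]
        field_simp

end Criterion

/-! ### Uniform concentration of the local criterion. -/

section Observed

variable {Ω : Type*} [MeasurableSpace Ω] {μ : Measure Ω} [IsProbabilityMeasure μ] {dz dρ : ℕ}
  {Γ : Set (Vec dρ)} {f : Vec dz → Vec dρ → ℝ} {D : Set (ℝ × Vec dz)} {B C : ℝ}
  {Y : ℕ → ℕ → Ω → ℝ} {Z : ℕ → ℕ → Ω → Vec dz} {m : ℕ → ℕ} {K : ℝ → ℝ} {h : ℕ → ℝ}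

theorem IsRegressionFunction.measurable_sqLoss (hf : IsRegressionFunction Γ f) {ρ : Vec dρ}
    (hρ : ρ ∈ Γ) : Measurable fun w : ℝ × Vec dz => sqLoss f w.1 w.2 ρ :=
  (measurable_fst.sub ((hf.measurable ρ hρ).comp measurable_snd)).pow_const 2

theorem RegularLoss.integrable (hl : RegularLoss D Γ f B C) (hf : IsRegressionFunction Γ f)
    {y : Ω → ℝ} {z : Ω → Vec dz} (hy : Measurable y) (hz : Measurable z)
    (hD : ∀ᵐ ω ∂μ, (y ω, z ω) ∈ D) {ρ : Vec dρ} (hρ : ρ ∈ Γ) :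
    Integrable (fun ω => sqLoss f (y ω) (z ω) ρ) μ := by
  refine Integrable.of_bound
    ((hf.measurable_sqLoss hρ).comp (hy.prodMk hz)).aestronglyMeasurable B ?_
  filter_upwards [hD] with ω hω
  rw [Real.norm_eq_abs, abs_of_nonneg (sqLoss_nonneg _ _ _ _)]
  exact hl.le _ hω ρ hρ

theorem RegularLoss.integral_mem_Icc (hl : RegularLoss D Γ f B C) (hf : IsRegressionFunction Γ f)
    {y : Ω → ℝ} {z : Ω → Vec dz} (hy : Measurable y) (hz : Measurable z)
    (hD : ∀ᵐ ω ∂μ, (y ω, z ω) ∈ D) {ρ : Vec dρ} (hρ : ρ ∈ Γ) :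
    ∫ ω, sqLoss f (y ω) (z ω) ρ ∂μ ∈ Icc 0 B := by
  refine ⟨integral_nonneg fun ω => sqLoss_nonneg _ _ _ _, ?_⟩
  have := integral_mono_ae (hl.integrable hf hy hz hD hρ) (integrable_const B)
    (hD.mono fun ω hω => hl.le _ hω ρ hρ)
  simpa using this

theorem RegularLoss.integrable_localCriterion (hl : RegularLoss D Γ f B C)
    (hf : IsRegressionFunction Γ f) (hY : ∀ T t, Measurable (Y T t))
    (hZ : ∀ T t, Measurable (Z T t))
    (hD : ∀ T t : ℕ, 1 ≤ t → t ≤ T → ∀ᵐ ω ∂μ, (Y T t ω, Z T t ω) ∈ D) (T : ℕ) (u : ℝ)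
    {ρ : Vec dρ} (hρ : ρ ∈ Γ) : Integrable (fun ω => localCriterion f K h Y Z T u ω ρ) μ := by
  refine (integrable_finsetSum _ fun t ht => ?_).const_mul _
  rw [Finset.mem_Icc] at ht
  exact (hl.integrable hf (hY T t) (hZ T t) (hD T t ht.1 ht.2) hρ).mul_const _

theorem RegularLoss.integral_localCriterion (hl : RegularLoss D Γ f B C)
    (hf : IsRegressionFunction Γ f) (hY : ∀ T t, Measurable (Y T t))
    (hZ : ∀ T t, Measurable (Z T t))
    (hD : ∀ T t : ℕ, 1 ≤ t → t ≤ T → ∀ᵐ ω ∂μ, (Y T t ω, Z T t ω) ∈ D) (T : ℕ) (u : ℝ)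
    {ρ : Vec dρ} (hρ : ρ ∈ Γ) :
    ∫ ω, localCriterion f K h Y Z T u ω ρ ∂μ = 1 / (T * h T) * ∑ t ∈ Finset.Icc 1 T,
      (∫ ω, sqLoss f (Y T t ω) (Z T t ω) ρ ∂μ) * K ((u - (t : ℝ) / T) / h T) := by
  simp only [localCriterion]
  rw [integral_const_mul, integral_finsetSum]
  · simp only [integral_mul_const]
  · intro t ht
    rw [Finset.mem_Icc] at ht
    exact (hl.integrable hf (hY T t) (hZ T t) (hD T t ht.1 ht.2) hρ).mul_const _

/-- With `l = a / m_T` the Hoeffding exponent is at most `-c T h / m_T`, which beats `-3 log T` by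
the bandwidth condition, while bounded `T φ(m_T) / m_T` costs only a constant factor. The power `3`
is what a grid of about `T²` times requires. -/
theorem RegularLoss.eventually_measure_localCriterion_le (hl : RegularLoss D Γ f B C)
    (hB0 : 0 ≤ B) (hf : IsRegressionFunction Γ f) (hY : ∀ T t, Measurable (Y T t))
    (hZ : ∀ T t, Measurable (Z T t))
    (hD : ∀ T t : ℕ, 1 ≤ t → t ≤ T → ∀ᵐ ω ∂μ, (Y T t ω, Z T t ω) ∈ D)
    (hmix : IsPhiMixing μ Y Z m) (hK : IsKernel K) (hh : IsBandwidth h m) {ε : ℝ} (hε : 0 < ε) :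
    ∃ A : ℝ, 0 ≤ A ∧ ∀ᶠ T : ℕ in atTop, ∀ u : ℝ, ∀ ρ ∈ Γ,
      μ {ω | ε ≤ |localCriterion f K h Y Z T u ω ρ - ∫ ω, localCriterion f K h Y Z T u ω ρ ∂μ|} ≤
        ENNReal.ofReal (A / (T : ℝ) ^ 3) := by
  obtain ⟨κ, hκ0, hκ⟩ : ∃ κ : ℝ, 0 < κ ∧ ∀ x, K x ≤ κ := by
    obtain ⟨κ, hκ⟩ := hK.bounded
    exact ⟨max κ 1, by positivity, fun x => (hκ x).trans (le_max_left _ _)⟩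
  obtain ⟨Cφ, hCφ⟩ := hmix.bound
  -- The first entry gives the constraint `l * (B * (m * κ)) ≤ 1`; the second makes the quadratic
  -- term of the exponent at most half the linear one. Using `B + 1` avoids division by zero.
  set a := min (1 / ((B + 1) * κ)) (ε / (4 * ((B + 1) ^ 2 * κ))) with ha
  have ha0 : 0 < a := by positivity
  have ha1 : a * (B * κ) ≤ 1 := by
    have h1 : a * ((B + 1) * κ) ≤ 1 := by
      rw [← le_div_iff₀ (by positivity)]; exact min_le_left _ _
    nlinarith [mul_pos ha0 hκ0]
  have ha2 : a * (B ^ 2 * κ) ≤ ε / 4 := by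
    have h1 : a * ((B + 1) ^ 2 * κ) ≤ ε / 4 := by
      rw [← le_div_iff₀ (by positivity)]
      exact (min_le_right _ _).trans (le_of_eq (by field_simp))
    have h2 : B ^ 2 * κ ≤ (B + 1) ^ 2 * κ := by gcongr; linarith
    exact (mul_le_mul_of_nonneg_left h2 ha0.le).trans h1
  set c := a * (ε / 4) with hc
  have hc0 : 0 < c := by positivity
  refine ⟨4 * Real.exp (6 * Cφ), by positivity, ?_⟩
  filter_upwards [eventually_ge_atTop 2, hK.eventually_sum_le hh.pos hh.tendsto_mul,
    hh.tendsto_div.eventually_ge_atTop (3 / c)] with T hT2 hsum hlog u ρ hρ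
  have hT : 1 ≤ T := by omega
  have hT0 : (0 : ℝ) < T := by exact_mod_cast hT
  have hhT := hh.pos T hT
  have hTh : 0 < T * h T := by positivity
  have hm1 := hmix.one_le T hT
  have hm0 : (0 : ℝ) < m T := by exact_mod_cast hm1
  have hlogT : 0 < Real.log T := Real.log_pos (by exact_mod_cast hT2)
  -- Truncation at `B` changes the loss only on null sets for `1 ≤ t ≤ T`, yields a bound valid for
  -- every `ω` and `t`, and keeps measurability with respect to the observation at `t`.
  set W : ℕ → Ω → ℝ := fun t ω => min (sqLoss f (Y T t ω) (Z T t ω) ρ) B with hW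
  have hWm' : ∀ t, Measurable[MeasurableSpace.comap (fun ω => (Y T t ω, Z T t ω)) inferInstance]
      (W t) := fun t =>
    ((hf.measurable_sqLoss hρ).min measurable_const).comp (comap_measurable _)
  have hWm : ∀ t, Measurable (W t) := fun t =>
    (hWm' t).mono ((hY T t).prodMk (hZ T t)).comap_le le_rfl
  have hW0 : ∀ t ω, 0 ≤ W t ω := fun t ω => le_min (sqLoss_nonneg _ _ _ _) hB0
  have hWB : ∀ t ω, W t ω ≤ B := fun t ω => min_le_right _ _
  have hWint : ∀ t, Integrable (W t) μ := fun t =>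
    Integrable.of_bound (hWm t).aestronglyMeasurable B (Eventually.of_forall fun ω => by
      rw [Real.norm_eq_abs, abs_of_nonneg (hW0 t ω)]; exact hWB t ω)
  have hEW0 : ∀ t, 0 ≤ ∫ ω, W t ω ∂μ := fun t => integral_nonneg (hW0 t)
  have hEWB : ∀ t, ∫ ω, W t ω ∂μ ≤ B := fun t => by
    have := integral_mono (hWint t) (integrable_const B) (hWB t)
    simpa using this
  set X : ℕ → Ω → ℝ := fun t ω => W t ω - ∫ ω, W t ω ∂μ with hX
  have hmain := measure_abs_sum_ge_le (μ := μ) (X := X) (B := B)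
    (a := fun t => K ((u - (t : ℝ) / T) / h T)) hY hZ hT hm1
    (fun t => (hWm' t).sub_const _)
    (fun t ω => by
      have h1 := hW0 t ω
      have h2 := hWB t ω
      have h3 := hEW0 t
      have h4 := hEWB t
      change |W t ω - ∫ ω, W t ω ∂μ| ≤ B
      rw [abs_le]
      constructor <;> linarith)
    (fun t => by
      rw [hX, integral_sub (hWint t) (integrable_const _)]
      simp)
    hκ0.le (fun t _ => hK.nonneg _) (fun t _ => hκ _) (hsum u) (l := a / m T) (by positivity)
    (by
      calc a / m T * (B * (m T * κ)) = a * (B * κ) := by field_simp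
        _ ≤ 1 := ha1) (ε * (T * h T) / 2)
  have hWeq : ∀ t, 1 ≤ t → t ≤ T → (fun ω => sqLoss f (Y T t ω) (Z T t ω) ρ) =ᵐ[μ] W t := by
    intro t h1 h2
    filter_upwards [hD T t h1 h2] with ω hω
    exact (min_eq_left (hl.le _ hω ρ hρ)).symm
  have hset : μ {ω | ε ≤ |localCriterion f K h Y Z T u ω ρ -
        ∫ ω, localCriterion f K h Y Z T u ω ρ ∂μ|} ≤
      μ {ω | 2 * (ε * (T * h T) / 2) ≤
        |∑ t ∈ Finset.Icc 1 T, K ((u - (t : ℝ) / T) / h T) * X t ω|} := by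
    refine measure_mono_ae ?_
    have hall : ∀ᵐ ω ∂μ, ∀ t ∈ Finset.Icc 1 T, sqLoss f (Y T t ω) (Z T t ω) ρ = W t ω := by
      refine (Finset.eventually_all _).2 fun t ht => ?_
      rw [Finset.mem_Icc] at ht
      exact hWeq t ht.1 ht.2
    filter_upwards [hall] with ω hω hle
    have hle' : ε ≤ |localCriterion f K h Y Z T u ω ρ -
        ∫ ω, localCriterion f K h Y Z T u ω ρ ∂μ| := hle
    change 2 * (ε * (T * h T) / 2) ≤ |∑ t ∈ Finset.Icc 1 T, K ((u - (t : ℝ) / T) / h T) * X t ω|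
    rw [hl.integral_localCriterion hf hY hZ hD T u hρ, localCriterion, ← mul_sub,
      ← Finset.sum_sub_distrib, abs_mul, abs_of_nonneg (by positivity), one_div_mul_eq_div,
      le_div_iff₀ hTh] at hle'
    have hsumeq : ∑ t ∈ Finset.Icc 1 T, (sqLoss f (Y T t ω) (Z T t ω) ρ *
        K ((u - (t : ℝ) / T) / h T) - (∫ ω, sqLoss f (Y T t ω) (Z T t ω) ρ ∂μ) *
        K ((u - (t : ℝ) / T) / h T)) =
        ∑ t ∈ Finset.Icc 1 T, K ((u - (t : ℝ) / T) / h T) * X t ω := by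
      refine Finset.sum_congr rfl fun t ht => ?_
      rw [hω t ht]
      rw [Finset.mem_Icc] at ht
      rw [integral_congr_ae (hWeq t ht.1 ht.2), hX]
      ring
    rw [hsumeq] at hle'
    linarith
  refine hset.trans (hmain.trans ?_)
  have h4 : (4 : ℝ≥0∞) = ENNReal.ofReal 4 := by simp
  rw [h4, ← ENNReal.ofReal_mul (by norm_num)]
  refine ENNReal.ofReal_le_ofReal ?_
  have hφ0 := phiCoeff_nonneg (μ := μ) (Y := Y) (Z := Z) (m T)
  have hmT : (m T : ℝ) ≤ T := by exact_mod_cast hmix.le T hT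
  have hφ1 : phiCoeff μ Y Z (m T) * (T / m T) ≤ Cφ := by
    have := hCφ T hT
    calc _ = T * phiCoeff μ Y Z (m T) / m T := by ring
      _ ≤ Cφ := this
  have hφ2 : phiCoeff μ Y Z (m T) ≤ Cφ := by
    refine le_trans ?_ hφ1
    exact le_mul_of_one_le_right hφ0 ((one_le_div hm0).2 hmT)
  have hexp : -(a / m T * (ε * (T * h T) / 2)) +
      (a / m T) ^ 2 * B ^ 2 / 2 * (m T * κ * (2 * (T * h T))) +
      3 * phiCoeff μ Y Z (m T) * (T / m T + 1) ≤ -(3 * Real.log T) + 6 * Cφ := by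
    have e1 : -(a / m T * (ε * (T * h T) / 2)) +
        (a / m T) ^ 2 * B ^ 2 / 2 * (m T * κ * (2 * (T * h T))) =
        (T * h T / m T) * (a * (a * (B ^ 2 * κ) - ε / 2)) := by
      field_simp
      ring
    have e2 : a * (a * (B ^ 2 * κ) - ε / 2) ≤ -c := by
      rw [hc]
      have := mul_le_mul_of_nonneg_left ha2 ha0.le
      linarith
    have e3 : 3 * Real.log T ≤ c * (T * h T / m T) := by
      rw [div_le_div_iff₀ hc0 (by positivity)] at hlog
      rw [mul_div_assoc', le_div_iff₀ hm0]
      linarith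
    have e4 : (T * h T / m T) * (a * (a * (B ^ 2 * κ) - ε / 2)) ≤ (T * h T / m T) * (-c) :=
      mul_le_mul_of_nonneg_left e2 (by positivity)
    have e5 : 3 * phiCoeff μ Y Z (m T) * (T / m T + 1) ≤ 6 * Cφ := by
      calc _ = 3 * (phiCoeff μ Y Z (m T) * (T / m T)) + 3 * phiCoeff μ Y Z (m T) := by ring
        _ ≤ 6 * Cφ := by linarith
    rw [e1]
    linarith
  have hpow : Real.exp (-(3 * Real.log T)) = 1 / (T : ℝ) ^ 3 := by
    rw [Real.exp_neg, show (3 : ℝ) * Real.log T = (3 : ℕ) * Real.log T by norm_num,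
      Real.exp_nat_mul, Real.exp_log hT0, one_div]
  calc _ ≤ 4 * Real.exp (-(3 * Real.log T) + 6 * Cφ) := by gcongr
    _ = 4 * Real.exp (6 * Cφ) / (T : ℝ) ^ 3 := by rw [Real.exp_add, hpow]; ring

/-- The local criterion is uniformly close to its expectation. -/
theorem RegularLoss.highProb_localCriterion (hl : RegularLoss D Γ f B C)
    (hB0 : 0 ≤ B) (hf : IsRegressionFunction Γ f) (hY : ∀ T t, Measurable (Y T t))
    (hZ : ∀ T t, Measurable (Z T t))
    (hD : ∀ T t : ℕ, 1 ≤ t → t ≤ T → ∀ᵐ ω ∂μ, (Y T t ω, Z T t ω) ∈ D)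
    (hmix : IsPhiMixing μ Y Z m) (hK : IsKernel K) (hh : IsBandwidth h m) {ε : ℝ} (hε : 0 < ε) :
    HighProb μ fun T ω => ∀ u ∈ Icc (0 : ℝ) 1, ∀ ρ ∈ Γ,
      |localCriterion f K h Y Z T u ω ρ - ∫ ω, localCriterion f K h Y Z T u ω ρ ∂μ| ≤ 7 * ε := by
  obtain ⟨A, hA, htail⟩ := hl.eventually_measure_localCriterion_le hB0 hf hY hZ hD hmix hK hh hε
  obtain ⟨F, hF, hnet⟩ := hl.net ε hε
  obtain ⟨L, hL⟩ := hK.lipschitz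
  -- Mesh `T⁻²` suffices because the Lipschitz kernel changes the criterion by at most a multiple of
  -- `T⁻² / h² = (T h)⁻²`. The union bound over `(T² + 1) |F|` points against tails `A / T³` is `O(1
  -- / T)`.
  have hgrid : HighProb μ fun T ω => ∀ x ∈ Finset.range (T ^ 2 + 1) ×ˢ F,
      |localCriterion f K h Y Z T ((x.1 : ℝ) / T ^ 2) ω x.2 -
        ∫ ω, localCriterion f K h Y Z T ((x.1 : ℝ) / T ^ 2) ω x.2 ∂μ| < ε := by
    have hlim : Tendsto (fun T : ℕ => ENNReal.ofReal (2 * F.card * A * (1 / (T : ℝ)))) atTop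
        (𝓝 0) := by
      have := tendsto_one_div_atTop_nhds_zero_nat (𝕜 := ℝ) |>.const_mul (2 * F.card * A)
      simpa using ENNReal.tendsto_ofReal this
    refine tendsto_of_tendsto_of_tendsto_of_le_of_le' tendsto_const_nhds hlim
      (Eventually.of_forall fun _ => zero_le) ?_
    filter_upwards [htail, eventually_ge_atTop 1] with T hT hT1
    have hT0 : (0 : ℝ) < T := by exact_mod_cast hT1
    calc _ ≤ μ (⋃ x ∈ Finset.range (T ^ 2 + 1) ×ˢ F,
          {ω | ε ≤ |localCriterion f K h Y Z T ((x.1 : ℝ) / T ^ 2) ω x.2 -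
            ∫ ω, localCriterion f K h Y Z T ((x.1 : ℝ) / T ^ 2) ω x.2 ∂μ|}) := by
          refine measure_mono fun ω hω => ?_
          simp only [mem_ofPred_eq, not_forall, not_lt] at hω
          obtain ⟨x, hx, hω⟩ := hω
          exact mem_iUnion₂.2 ⟨x, hx, hω⟩
      _ ≤ ∑ x ∈ Finset.range (T ^ 2 + 1) ×ˢ F, ENNReal.ofReal (A / (T : ℝ) ^ 3) :=
          (measure_biUnion_finset_le _ _).trans (Finset.sum_le_sum fun x hx =>
            hT _ _ (hF _ (Finset.mem_product.1 hx).2))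
      _ = ENNReal.ofReal (((T ^ 2 + 1) * F.card : ℕ) * (A / (T : ℝ) ^ 3)) := by
          rw [Finset.sum_const, Finset.card_product, Finset.card_range, nsmul_eq_mul,
            ENNReal.ofReal_mul (by positivity), ENNReal.ofReal_natCast]
      _ ≤ ENNReal.ofReal (2 * F.card * A * (1 / (T : ℝ))) := by
          refine ENNReal.ofReal_le_ofReal ?_
          have h1 : (1 : ℝ) ≤ T ^ 2 := one_le_pow₀ (by exact_mod_cast hT1)
          push_cast
          calc ((T : ℝ) ^ 2 + 1) * F.card * (A / (T : ℝ) ^ 3) ≤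
                ((T : ℝ) ^ 2 + T ^ 2) * F.card * (A / (T : ℝ) ^ 3) := by gcongr
            _ = _ := by field_simp; ring
  have hsmall : ∀ᶠ T : ℕ in atTop, B * L / (T * h T) ^ 2 ≤ ε := by
    have h1 : Tendsto (fun T : ℕ => B * L / (T * h T) ^ 2) atTop (𝓝 0) :=
      ((tendsto_pow_atTop two_ne_zero).comp hh.tendsto_mul).const_div_atTop _
    exact h1.eventually_le_const hε
  refine hgrid.mono ?_
  filter_upwards [hsmall, hK.eventually_kernelMass_le hh.pos hh.tendsto_mul, eventually_ge_atTop 1]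
    with T hTs hTm hT
  have hT0 : (0 : ℝ) < T := by exact_mod_cast hT
  have hhT := hh.pos T hT
  have hL0 : 0 ≤ L := by
    have := (abs_nonneg _).trans (hL 1 0)
    simpa using this
  have hDall : ∀ᵐ ω ∂μ, ∀ t ∈ Finset.Icc 1 T, (Y T t ω, Z T t ω) ∈ D := by
    refine (Finset.eventually_all _).2 fun t ht => ?_
    rw [Finset.mem_Icc] at ht
    exact hD T t ht.1 ht.2
  filter_upwards [hDall] with ω hω hgood u hu ρ hρ
  obtain ⟨ρ', hρ', hρρ'⟩ := hnet ρ hρ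
  set i := ⌊u * (T : ℝ) ^ 2⌋₊ with hi
  have hi0 : 0 ≤ u * (T : ℝ) ^ 2 := by have := hu.1; positivity
  have hi1 : (i : ℝ) ≤ u * (T : ℝ) ^ 2 := Nat.floor_le hi0
  have hi2 : u * (T : ℝ) ^ 2 < i + 1 := Nat.lt_floor_add_one _
  have hirange : i ∈ Finset.range (T ^ 2 + 1) := by
    rw [Finset.mem_range, Nat.lt_succ_iff]
    have : (i : ℝ) ≤ (T ^ 2 : ℕ) := by
      push_cast
      refine hi1.trans ?_
      have := hu.2
      nlinarith [sq_nonneg (T : ℝ)]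
    exact_mod_cast this
  have hdist : |u - (i : ℝ) / T ^ 2| ≤ 1 / (T : ℝ) ^ 2 := by
    have e : u - (i : ℝ) / T ^ 2 = (u * (T : ℝ) ^ 2 - i) / T ^ 2 := by field_simp
    rw [e, abs_of_nonneg (div_nonneg (by linarith) (by positivity))]
    gcongr
    linarith
  -- The net costs `2 * ε`, as the kernel mass is at most `2`, and the mesh costs `ε`. Paid for the
  -- criterion and again for its expectation, plus `ε` on the grid, this makes `7 * ε`.
  have hcmp : ∀ ω, (∀ t ∈ Finset.Icc 1 T, (Y T t ω, Z T t ω) ∈ D) →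
      |localCriterion f K h Y Z T u ω ρ - localCriterion f K h Y Z T ((i : ℝ) / T ^ 2) ω ρ'| ≤
        3 * ε := by
    intro ω hω
    refine (hl.abs_localCriterion_sub_le hK hL hT hhT hω (hF _ hρ') hρρ').trans ?_
    have h1 : ε * kernelMass K h T u ≤ ε * 2 := mul_le_mul_of_nonneg_left (hTm u) hε.le
    have h2 : B * L * |u - (i : ℝ) / T ^ 2| / h T ^ 2 ≤ B * L / (T * h T) ^ 2 := by
      calc _ ≤ B * L * (1 / (T : ℝ) ^ 2) / h T ^ 2 := by gcongr
        _ = _ := by field_simp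
    linarith
  have hint1 := hl.integrable_localCriterion (K := K) (h := h) hf hY hZ hD T u hρ
  have hint2 := hl.integrable_localCriterion (K := K) (h := h) hf hY hZ hD T ((i : ℝ) / T ^ 2)
    (hF _ hρ')
  have hcmpE : |∫ ω, localCriterion f K h Y Z T u ω ρ ∂μ -
      ∫ ω, localCriterion f K h Y Z T ((i : ℝ) / T ^ 2) ω ρ' ∂μ| ≤ 3 * ε := by
    rw [← integral_sub hint1 hint2, ← Real.norm_eq_abs]
    have := norm_integral_le_of_norm_le_const (μ := μ) (f := fun ω =>
      localCriterion f K h Y Z T u ω ρ - localCriterion f K h Y Z T ((i : ℝ) / T ^ 2) ω ρ')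
      (C := 3 * ε) (hDall.mono fun ω hω => hcmp ω hω)
    simpa using this
  have h1 := hgood (i, ρ') (Finset.mem_product.2 ⟨hirange, hρ'⟩)
  have h2 := hcmp ω hω
  simp only at h1
  rw [abs_lt] at h1
  rw [abs_le] at h2 hcmpE ⊢
  constructor <;> linarith

end Observed

/-! ### From almost sure approximation rates to expectations. -/

section LocalStationarity

variable {Ω : Type*} [MeasurableSpace Ω] {μ : Measure Ω}

/-- Markov's inequality for `|C_T|^η`: the event `|C_T| ≥ κ T` has probability at most `B / (κ
T)^η`, however small `η` is. -/
theorem IsLocallyStationary.highProb {E : Type*} [NormedAddCommGroup E] [MeasurableSpace E]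
    {X : ℕ → ℕ → Ω → E} {x : ℝ → ℤ → Ω → E} (hX : IsLocallyStationary μ X x) {κ : ℝ} (hκ : 0 < κ) :
    HighProb μ fun T ω => ∀ t ∈ Finset.Icc 1 T, ‖X T t ω - x ((t : ℝ) / T) (t : ℤ) ω‖ ≤ κ := by
  obtain ⟨-, C, hCm, ⟨η, hη, B, hB, hCB⟩, hC⟩ := hX
  have hHP : HighProb μ fun T ω => ‖C T ω‖ₑ < ENNReal.ofReal (κ * T) := by
    have hlim : Tendsto (fun T : ℕ => B / ENNReal.ofReal (κ * T) ^ η) atTop (𝓝 0) := by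
      rw [← ENNReal.div_top (a := B)]
      refine ENNReal.Tendsto.const_div ?_ (Or.inr hB.ne)
      exact (ENNReal.tendsto_rpow_at_top hη).comp (ENNReal.tendsto_ofReal_atTop.comp
        (tendsto_natCast_atTop_atTop.const_mul_atTop hκ))
    refine tendsto_of_tendsto_of_tendsto_of_le_of_le' tendsto_const_nhds hlim
      (Eventually.of_forall fun _ => zero_le) ?_
    filter_upwards [eventually_ge_atTop 1] with T hT
    have hT0 : (0 : ℝ) < T := by exact_mod_cast hT
    have hpos : ENNReal.ofReal (κ * T) ^ η ≠ 0 := by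
      have : ENNReal.ofReal (κ * T) ≠ 0 := by simpa using mul_pos hκ hT0
      simp [ENNReal.rpow_eq_zero_iff, this, not_lt.2 hη.le]
    have hfin : ENNReal.ofReal (κ * T) ^ η ≠ ∞ :=
      ENNReal.rpow_ne_top_of_nonneg hη.le ENNReal.ofReal_ne_top
    calc _ ≤ μ {ω | ENNReal.ofReal (κ * T) ^ η ≤ ‖C T ω‖ₑ ^ η} := by
          refine measure_mono fun ω hω => ?_
          simp only [mem_ofPred_eq, not_lt] at hω ⊢
          exact ENNReal.rpow_le_rpow hω hη.le
      _ ≤ (∫⁻ ω, ‖C T ω‖ₑ ^ η ∂μ) / ENNReal.ofReal (κ * T) ^ η :=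
          meas_ge_le_lintegral_div ((hCm T).enorm.pow_const η).aemeasurable hpos hfin
      _ ≤ _ := ENNReal.div_le_div_right (hCB T hT) _
  refine hHP.mono ?_
  filter_upwards [eventually_ge_atTop 1] with T hT
  have hT0 : (0 : ℝ) < T := by exact_mod_cast hT
  filter_upwards [hC T hT] with ω hω hlt t ht
  refine (hω t ht).trans ?_
  rw [← ofReal_norm, ENNReal.ofReal_lt_ofReal_iff (by positivity)] at hlt
  rw [div_le_iff₀ hT0]
  exact (le_abs_self _).trans hlt.le

/-- The exceptional set may be non-measurable; its measurable hull has the same measure. -/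
theorem abs_integral_le_add_mul_measure [IsProbabilityMeasure μ] {g : Ω → ℝ} {E : Set Ω} {e B : ℝ}
    (he : 0 ≤ e) (hgE : ∀ᵐ ω ∂μ, ω ∉ E → |g ω| ≤ e) (hgB : ∀ᵐ ω ∂μ, |g ω| ≤ B) :
    |∫ ω, g ω ∂μ| ≤ e + B * μ.real E := by
  set E' := toMeasurable μ E
  have hE' : MeasurableSet E' := measurableSet_toMeasurable μ E
  have hint : Integrable (E'.indicator fun _ => B) μ := (integrable_const B).indicator hE'
  have hle := norm_integral_le_of_norm_le (μ := μ) (f := g)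
    (g := fun ω => e + E'.indicator (fun _ => B) ω) ((integrable_const e).add hint) (by
      filter_upwards [hgE, hgB] with ω h1 h2
      rw [Real.norm_eq_abs]
      by_cases hω : ω ∈ E'
      · rw [indicator_of_mem hω]; linarith
      · rw [indicator_of_notMem hω, add_zero]
        exact h1 fun h => hω (subset_toMeasurable μ E h))
  rw [integral_add (integrable_const e) hint, integral_indicator_const _ hE'] at hle
  have hreal : μ.real E' = μ.real E := by
    simp only [Measure.real, E', measure_toMeasurable]
  rw [hreal] at hle
  simpa [mul_comm] using hle

end LocalStationarity

/-! ### Continuous extension of the parameter curve. -/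

section Extension

/-- A curve with bounded second derivative on `(0,1)` extends continuously to `[0,1]`. -/
theorem SmoothCurve.exists_continuous_extension {p : ℕ} {Θ : Set (Vec p)} (hΘ : IsCompact Θ)
    {θ₀ : ℝ → Vec p} (hθ₀ : ∀ u ∈ Icc (0 : ℝ) 1, θ₀ u ∈ Θ) (hs : SmoothCurve θ₀) :
    ∃ g : ℝ → Vec p, Continuous g ∧ (∀ u ∈ Icc (0 : ℝ) 1, g u ∈ Θ) ∧
      ∀ u ∈ Ioo (0 : ℝ) 1, g u = θ₀ u := by
  obtain ⟨C, hC⟩ := hs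
  have hhalf : (1 / 2 : ℝ) ∈ Ioo (0 : ℝ) 1 := by norm_num
  set A := ‖deriv θ₀ (1 / 2)‖ + |C| with hA
  have hA0 : 0 ≤ A := by positivity
  -- The mean value inequality is used twice: bounded second derivative gives bounded first
  -- derivative, which gives a Lipschitz curve. Its extension stays in `Θ` because `Θ` is closed.
  have hbd : ∀ u ∈ Ioo (0 : ℝ) 1, ‖deriv θ₀ u‖ ≤ A := by
    intro u hu
    have h1 := (convex_Ioo (0 : ℝ) 1).norm_image_sub_le_of_norm_deriv_le (f := deriv θ₀) (C := C)
      (fun x hx => (hC x hx).2.1) (fun x hx => (hC x hx).2.2) hhalf hu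
    have h2 : ‖u - 1 / 2‖ ≤ 1 := by
      rw [Real.norm_eq_abs, abs_le]
      constructor <;> linarith [hu.1, hu.2]
    have h3 : C * ‖u - 1 / 2‖ ≤ |C| * 1 :=
      mul_le_mul (le_abs_self C) h2 (norm_nonneg _) (abs_nonneg _)
    have h4 := norm_sub_norm_le (deriv θ₀ u) (deriv θ₀ (1 / 2))
    linarith
  have hlip : LipschitzOnWith A.toNNReal θ₀ (Ioo 0 1) := by
    refine LipschitzOnWith.of_dist_le_mul fun x hx y hy => ?_
    rw [dist_eq_norm, dist_eq_norm, Real.coe_toNNReal _ hA0]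
    exact (convex_Ioo (0 : ℝ) 1).norm_image_sub_le_of_norm_deriv_le (fun x hx => (hC x hx).1)
      hbd hy hx
  obtain ⟨g, hg, heq⟩ := hlip.extend_finite_dimension
  refine ⟨g, hg.continuous, fun u hu => ?_, fun u hu => (heq hu).symm⟩
  have hcl : u ∈ closure (Ioo (0 : ℝ) 1) := by rwa [closure_Ioo zero_ne_one]
  have hmaps : MapsTo g (Ioo 0 1) Θ := fun x hx => by
    rw [← heq hx]; exact hθ₀ x (Ioo_subset_Icc_self hx)
  have := map_mem_closure hg.continuous hcl hmaps
  rwa [hΘ.isClosed.closure_eq] at this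

end Extension

/-! ### Bias of the local criterion and consistency for observed data. -/

section Consistency

variable {Ω : Type*} [MeasurableSpace Ω] {μ : Measure Ω} [IsProbabilityMeasure μ]
  {S : Type*} [MeasurableSpace S] {law : Measure S} [IsProbabilityMeasure law]
  {p dz dρ : ℕ} {Θ : Set (Vec p)} {Γ : Set (Vec dρ)} {r : ℝ × Vec p → ℝ}
  {φ : (ℕ → S) → Vec p → ℝ} {ζ : (ℕ → S) → ℝ → Vec p → Vec dz} {f : Vec dz → Vec dρ → ℝ}
  {D : Set (ℝ × Vec dz)} {B C : ℝ} {ν : ℤ → Ω → S} {θ₀ : ℝ → Vec p}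
  {Y : ℕ → ℕ → Ω → ℝ} {Z : ℕ → ℕ → Ω → Vec dz} {m : ℕ → ℕ} {K : ℝ → ℝ} {h : ℕ → ℝ}

theorem RegularLoss.limitLoss_mem_Icc (hl : RegularLoss D Γ f B C)
    (hs : SmoothStructure law Θ r φ ζ) (hf : IsRegressionFunction Γ f)
    (hDx : ∀ᵐ x ∂(Measure.infinitePi fun _ : ℕ => law), ∀ u ∈ Icc (0 : ℝ) 1, ∀ θ ∈ Θ,
      (structY r φ x θ, ζ x u θ) ∈ D) {q : ℝ × Vec p × Vec dρ}
    (hq : q ∈ Icc (0 : ℝ) 1 ×ˢ Θ ×ˢ Γ) : limitLoss law r φ ζ f q ∈ Icc 0 B :=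
  hl.integral_mem_Icc hf (hs.measurable_structY hq.2.1) (hs.measurable_ζ _ hq.1 _ hq.2.1)
    (hDx.mono fun _ hx => hx _ hq.1 _ hq.2.1) hq.2.2

/-- The expected loss of a locally stationary array is uniformly close to that of its stationary
approximations. -/
theorem RegularLoss.eventually_abs_expectedLoss_sub_le (hl : RegularLoss D Γ f B C)
    (hν : IsIID μ law ν) (hs : SmoothStructure law Θ r φ ζ) (hf : IsRegressionFunction Γ f)
    (hDx : ∀ᵐ x ∂(Measure.infinitePi fun _ : ℕ => law), ∀ u ∈ Icc (0 : ℝ) 1, ∀ θ ∈ Θ,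
      (structY r φ x θ, ζ x u θ) ∈ D)
    (hθ₀ : ∀ u ∈ Icc (0 : ℝ) 1, θ₀ u ∈ Θ)
    (hY : ∀ T t, Measurable (Y T t)) (hZ : ∀ T t, Measurable (Z T t))
    (hD : ∀ T t : ℕ, 1 ≤ t → t ≤ T → ∀ᵐ ω ∂μ, (Y T t ω, Z T t ω) ∈ D)
    (hYls : IsLocallyStationary μ Y (fun u t ω => structY r φ (history ν t ω) (θ₀ u)))
    (hZls : IsLocallyStationary μ Z (fun u t ω => ζ (history ν t ω) u (θ₀ u)))
    {ε : ℝ} (hε : 0 < ε) :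
    ∀ᶠ T : ℕ in atTop, ∀ t ∈ Finset.Icc 1 T, ∀ ρ ∈ Γ,
      |∫ ω, sqLoss f (Y T t ω) (Z T t ω) ρ ∂μ -
        limitLoss law r φ ζ f ((t : ℝ) / T, θ₀ ((t : ℝ) / T), ρ)| ≤ ε := by
  -- Approximation within `κ` moves the loss by at most `ε / 2`. The bad event depends on neither
  -- `t` nor `ρ`, which makes the estimate uniform.
  set κ := ε / 2 / (|C| + 1) with hκ
  have hκ0 : 0 < κ := by positivity
  have hHP := (hYls.highProb hκ0).and (hZls.highProb hκ0)
  have hreal := (ENNReal.tendsto_toReal ENNReal.zero_ne_top).comp hHP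
  have hreal' := hreal.const_mul B
  rw [ENNReal.toReal_zero, mul_zero] at hreal'
  filter_upwards [hreal'.eventually_le_const (half_pos hε)] with T hT t ht ρ hρ
  have ht' := Finset.mem_Icc.1 ht
  have hT0 : (0 : ℝ) < T := by exact_mod_cast (by omega : 0 < T)
  have hu : (t : ℝ) / T ∈ Icc (0 : ℝ) 1 := by
    refine ⟨by positivity, (div_le_one hT0).2 ?_⟩
    exact_mod_cast ht'.2
  have hθ := hθ₀ _ hu
  have hq : (((t : ℝ) / T, θ₀ ((t : ℝ) / T), ρ) : ℝ × Vec p × Vec dρ) ∈ Icc (0 : ℝ) 1 ×ˢ Θ ×ˢ Γ :=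
    ⟨hu, hθ, hρ⟩
  have hDh : ∀ᵐ ω ∂μ, (structY r φ (history ν t ω) (θ₀ ((t : ℝ) / T)),
      ζ (history ν t ω) ((t : ℝ) / T) (θ₀ ((t : ℝ) / T))) ∈ D :=
    (hν.measurePreserving_history t).quasiMeasurePreserving.ae
      (hDx.mono fun x hx => hx _ hu _ hθ)
  have hDt := hD T t ht'.1 ht'.2
  rw [← hν.integral_structLoss hs hf hq (t : ℤ)]
  simp only [structLoss]
  have hym : Measurable fun ω => structY r φ (history ν t ω) (θ₀ ((t : ℝ) / T)) :=
    (hs.measurable_structY hθ).comp (hν.measurable_history t)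
  have hzm : Measurable fun ω => ζ (history ν t ω) ((t : ℝ) / T) (θ₀ ((t : ℝ) / T)) :=
    (hs.measurable_ζ _ hu _ hθ).comp (hν.measurable_history t)
  rw [← integral_sub (hl.integrable hf (hY T t) (hZ T t) hDt hρ) (hl.integrable hf hym hzm hDh hρ)]
  refine ((abs_integral_le_add_mul_measure (B := B) (half_pos hε).le (E := {ω |
    ¬((∀ t ∈ Finset.Icc 1 T, ‖Y T t ω - structY r φ (history ν t ω) (θ₀ ((t : ℝ) / T))‖ ≤ κ) ∧
      ∀ t ∈ Finset.Icc 1 T, ‖Z T t ω - ζ (history ν t ω) ((t : ℝ) / T) (θ₀ ((t : ℝ) / T))‖ ≤ κ)})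
    ?_ ?_).trans (add_le_add le_rfl hT)).trans (add_halves ε).le
  · filter_upwards [hDt, hDh] with ω h1 h2 hω
    rw [not_not] at hω
    have h3 := hl.lipschitz _ h1 _ h2 ρ hρ
    refine h3.trans ?_
    have h4 : ‖(Y T t ω, Z T t ω) - (structY r φ (history ν t ω) (θ₀ ((t : ℝ) / T)),
        ζ (history ν t ω) ((t : ℝ) / T) (θ₀ ((t : ℝ) / T)))‖ ≤ κ :=
      max_le (hω.1 t ht) (hω.2 t ht)
    calc _ ≤ |C| * κ := mul_le_mul (le_abs_self C) h4 (norm_nonneg _) (abs_nonneg _)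
      _ ≤ (|C| + 1) * κ := by gcongr; linarith
      _ = ε / 2 := by rw [hκ]; field_simp
  · filter_upwards [hDt, hDh] with ω h1 h2
    have h3 := hl.le _ h1 ρ hρ
    have h4 := hl.le _ h2 ρ hρ
    have h5 := sqLoss_nonneg f (Y T t ω) (Z T t ω) ρ
    have h6 := sqLoss_nonneg f (structY r φ (history ν t ω) (θ₀ ((t : ℝ) / T)))
      (ζ (history ν t ω) ((t : ℝ) / T) (θ₀ ((t : ℝ) / T))) ρ
    rw [abs_le]
    constructor <;> linarith

/-- The expected local criterion is uniformly close to a multiple of the expected loss. -/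
theorem RegularLoss.eventually_abs_expectedCriterion_sub_le (hl : RegularLoss D Γ f B C)
    (hB : 0 ≤ B) (hΓ : IsCompact Γ)
    (hν : IsIID μ law ν) (hs : SmoothStructure law Θ r φ ζ) (hf : IsRegressionFunction Γ f)
    (hDx : ∀ᵐ x ∂(Measure.infinitePi fun _ : ℕ => law), ∀ u ∈ Icc (0 : ℝ) 1, ∀ θ ∈ Θ,
      (structY r φ x θ, ζ x u θ) ∈ D)
    (hθ₀ : ∀ u ∈ Icc (0 : ℝ) 1, θ₀ u ∈ Θ) {g : ℝ → Vec p} (hg : Continuous g)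
    (hgΘ : ∀ u ∈ Icc (0 : ℝ) 1, g u ∈ Θ) (hgθ : ∀ u ∈ Ioo (0 : ℝ) 1, g u = θ₀ u)
    (hY : ∀ T t, Measurable (Y T t)) (hZ : ∀ T t, Measurable (Z T t))
    (hD : ∀ T t : ℕ, 1 ≤ t → t ≤ T → ∀ᵐ ω ∂μ, (Y T t ω, Z T t ω) ∈ D)
    (hYls : IsLocallyStationary μ Y (fun u t ω => structY r φ (history ν t ω) (θ₀ u)))
    (hZls : IsLocallyStationary μ Z (fun u t ω => ζ (history ν t ω) u (θ₀ u)))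
    (hK : IsKernel K) (hh : IsBandwidth h m) {ε : ℝ} (hε : 0 < ε) :
    ∀ᶠ T : ℕ in atTop, ∀ u ∈ Icc (0 : ℝ) 1, ∀ ρ ∈ Γ,
      |∫ ω, localCriterion f K h Y Z T u ω ρ ∂μ -
        kernelMass K h T u * limitLoss law r φ ζ f (u, g u, ρ)| ≤ (5 + B) * ε := by
  obtain ⟨κ, hκ⟩ := hK.bounded
  have hκ0 : 0 ≤ κ := (hK.nonneg 0).trans (hκ 0)
  have hcont : ContinuousOn (fun x : ℝ × Vec dρ => limitLoss law r φ ζ f (x.1, g x.1, x.2))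
      (Icc (0 : ℝ) 1 ×ˢ Γ) :=
    (hs.continuousOn_limitLoss hf hl hDx).comp
      (f := fun x : ℝ × Vec dρ => (x.1, g x.1, x.2)) (by fun_prop)
      fun x hx => ⟨hx.1, hgΘ _ hx.1, hx.2⟩
  obtain ⟨a, ha, hmod⟩ := Metric.uniformContinuousOn_iff.1
    ((isCompact_Icc.prod hΓ).uniformContinuousOn_of_continuous hcont) ε hε
  have hlast : ∀ᶠ T : ℕ in atTop, B * κ / (T * h T) ≤ ε :=
    (hh.tendsto_mul.const_div_atTop (B * κ)).eventually_le_const hε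
  filter_upwards [eventually_ge_atTop 1, hK.eventually_sum_le hh.pos hh.tendsto_mul,
    hK.eventually_le_mul hh.pos hh.tendsto_zero ha hε, hlast,
    hl.eventually_abs_expectedLoss_sub_le hν hs hf hDx hθ₀ hY hZ hD hYls hZls hε]
    with T hT hsum hfar hlast hexp u hu ρ hρ
  have hT0 : (0 : ℝ) < T := by exact_mod_cast hT
  have hhT := hh.pos T hT
  have hTh : 0 < T * h T := by positivity
  rw [hl.integral_localCriterion hf hY hZ hD T u hρ, kernelMass, mul_assoc, ← mul_sub,
    Finset.sum_mul, ← Finset.sum_sub_distrib, abs_mul, abs_of_nonneg (by positivity),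
    one_div_mul_eq_div, div_le_iff₀ hTh]
  have hLu := hl.limitLoss_mem_Icc hs hf hDx (q := (u, g u, ρ)) ⟨hu, hgΘ u hu, hρ⟩
  -- Times near `u` use uniform continuity of the limit; distant times carry weight at most `ε * h
  -- T`. The time `t = T` is set apart because `θ₀ 1` may differ from `g 1`; a single term is
  -- negligible after division by `T h`. With total weight at most `2 T h`, the three costs are `4 *
  -- ε`, `B * ε` and `ε`.
  have hterm : ∀ t ∈ Finset.Icc 1 T,
      |(∫ ω, sqLoss f (Y T t ω) (Z T t ω) ρ ∂μ) * K ((u - (t : ℝ) / T) / h T) -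
        K ((u - (t : ℝ) / T) / h T) * limitLoss law r φ ζ f (u, g u, ρ)| ≤
      (2 * ε * K ((u - (t : ℝ) / T) / h T) + B * (ε * h T)) + if t = T then B * κ else 0 := by
    intro t ht
    have ht' := Finset.mem_Icc.1 ht
    have hk0 := hK.nonneg ((u - (t : ℝ) / T) / h T)
    have hkκ := hκ ((u - (t : ℝ) / T) / h T)
    have hEt := hl.integral_mem_Icc (μ := μ) hf (hY T t) (hZ T t) (hD T t ht'.1 ht'.2) hρ
    have hfar' := hfar (u - (t : ℝ) / T)
    have hexp' := hexp t ht ρ hρ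
    set k := K ((u - (t : ℝ) / T) / h T)
    set e := ∫ ω, sqLoss f (Y T t ω) (Z T t ω) ρ ∂μ
    have heB : |e - limitLoss law r φ ζ f (u, g u, ρ)| ≤ B := by
      rw [abs_le]
      constructor <;> linarith [hEt.1, hEt.2, hLu.1, hLu.2]
    have habs : |e * k - k * limitLoss law r φ ζ f (u, g u, ρ)| =
        k * |e - limitLoss law r φ ζ f (u, g u, ρ)| := by
      rw [mul_comm e k, ← mul_sub, abs_mul, abs_of_nonneg hk0]
    rw [habs]
    have hp1 : 0 ≤ B * (ε * h T) := by positivity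
    have hp2 : 0 ≤ 2 * ε * k := by positivity
    split_ifs with htT
    · have : k * |e - limitLoss law r φ ζ f (u, g u, ρ)| ≤ κ * B :=
        mul_le_mul hkκ heB (abs_nonneg _) hκ0
      linarith
    · rw [add_zero]
      rcases le_or_gt a |u - (t : ℝ) / T| with hau | hau
      · have : k * |e - limitLoss law r φ ζ f (u, g u, ρ)| ≤ ε * h T * B :=
          mul_le_mul (hfar' hau) heB (abs_nonneg _) (by positivity)
        linarith
      · have hu' : (t : ℝ) / T ∈ Ioo (0 : ℝ) 1 := by
          refine ⟨div_pos (by exact_mod_cast ht'.1) hT0, (div_lt_one hT0).2 ?_⟩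
          exact_mod_cast lt_of_le_of_ne ht'.2 htT
        have h1 := hmod (u, ρ) ⟨hu, hρ⟩ ((t : ℝ) / T, ρ) ⟨Ioo_subset_Icc_self hu', hρ⟩ (by
          rw [Prod.dist_eq, dist_self, Real.dist_eq]
          exact max_lt hau ha)
        simp only [hgθ _ hu', Real.dist_eq] at h1
        have h2 : |e - limitLoss law r φ ζ f (u, g u, ρ)| ≤ 2 * ε := by
          rw [abs_lt] at h1
          rw [abs_le] at hexp' ⊢
          constructor <;> linarith
        have := mul_le_mul_of_nonneg_left h2 hk0
        linarith
  have hone : ∑ t ∈ Finset.Icc 1 T, (if t = T then B * κ else 0) = B * κ := by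
    rw [Finset.sum_ite_eq' , if_pos (Finset.mem_Icc.2 ⟨hT, le_rfl⟩)]
  have hs2 := mul_le_mul_of_nonneg_left (hsum u) (by positivity : 0 ≤ 2 * ε)
  rw [div_le_iff₀ hTh] at hlast
  calc _ ≤ ∑ t ∈ Finset.Icc 1 T, ((2 * ε * K ((u - (t : ℝ) / T) / h T) + B * (ε * h T)) +
        if t = T then B * κ else 0) :=
        (Finset.abs_sum_le_sum_abs _ _).trans (Finset.sum_le_sum hterm)
    _ = 2 * ε * ∑ t ∈ Finset.Icc 1 T, K ((u - (t : ℝ) / T) / h T) + T * (B * (ε * h T)) +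
        B * κ := by
        rw [Finset.sum_add_distrib, Finset.sum_add_distrib, hone, ← Finset.mul_sum,
          Finset.sum_const, Nat.card_Icc, add_tsub_cancel_right, nsmul_eq_mul]
    _ ≤ (5 + B) * ε * (T * h T) := by linarith

/-- Uniform consistency of the local least squares estimators of the observed data. -/
theorem isLittleOP_observed (hl : RegularLoss D Γ f B C) (hB : 0 ≤ B)
    (hΘ : IsCompact Θ) (hΓ : IsCompact Γ)
    (hν : IsIID μ law ν) (hs : SmoothStructure law Θ r φ ζ) (hf : IsRegressionFunction Γ f)
    (hDx : ∀ᵐ x ∂(Measure.infinitePi fun _ : ℕ => law), ∀ u ∈ Icc (0 : ℝ) 1, ∀ θ ∈ Θ,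
      (structY r φ x θ, ζ x u θ) ∈ D)
    (hθ₀ : ∀ u ∈ Icc (0 : ℝ) 1, θ₀ u ∈ Θ) (hsmooth : SmoothCurve θ₀)
    (hY : ∀ T t, Measurable (Y T t)) (hZ : ∀ T t, Measurable (Z T t))
    (hD : ∀ T t : ℕ, 1 ≤ t → t ≤ T → ∀ᵐ ω ∂μ, (Y T t ω, Z T t ω) ∈ D)
    (hYls : IsLocallyStationary μ Y (fun u t ω => structY r φ (history ν t ω) (θ₀ u)))
    (hZls : IsLocallyStationary μ Z (fun u t ω => ζ (history ν t ω) u (θ₀ u)))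
    (hmix : IsPhiMixing μ Y Z m) (hK : IsKernel K) (hh : IsBandwidth h m)
    {M : ℝ → Vec dρ → ℝ}
    (hM : ∀ u ∈ Icc (0 : ℝ) 1, ∀ ρ ∈ Γ,
      Tendsto (fun T => ∫ ω, localCriterion f K h Y Z T u ω ρ ∂μ) atTop (𝓝 (M u ρ)))
    {ρ₀ : ℝ → Vec dρ} (hρ₀ : ∀ u ∈ Icc (0 : ℝ) 1, IsWellSeparatedMin (M u) Γ (ρ₀ u))
    {U : ℕ → Set ℝ} (hU : ∀ T, U T ⊆ Icc 0 1) {ρhat : ℕ → Ω → ℝ → Vec dρ}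
    (hρhat : ∀ T, 1 ≤ T → ∀ᵐ ω ∂μ, ∀ u ∈ U T,
      IsArgmin (localCriterion f K h Y Z T u ω) Γ (ρhat T ω u)) :
    IsLittleOP μ fun T ω => ⨆ u ∈ U T, ‖ρhat T ω u - ρ₀ u‖ₑ := by
  obtain ⟨g, hg, hgΘ, hgθ⟩ := hsmooth.exists_continuous_extension hΘ hθ₀
  have hbias : ∀ ε : ℝ, 0 < ε → ∀ᶠ T : ℕ in atTop, ∀ u ∈ Icc (0 : ℝ) 1, ∀ ρ ∈ Γ,
      |∫ ω, localCriterion f K h Y Z T u ω ρ ∂μ -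
        kernelMass K h T u * limitLoss law r φ ζ f (u, g u, ρ)| ≤ ε := by
    intro ε hε
    have := hl.eventually_abs_expectedCriterion_sub_le hB hΓ hν hs hf hDx hθ₀ hg hgΘ hgθ hY hZ hD
      hYls hZls hK hh (ε := ε / (5 + B)) (by positivity)
    rwa [mul_div_cancel₀ _ (by positivity)] at this
  -- If the limit loss at `ρ` did not exceed that at `ρ₀ u`, neither would its product with the
  -- nonnegative kernel mass. Expected criteria would then differ by at most two bias errors `η /
  -- 3`, against the separation `η` of `M₀`.
  have huniq : ∀ u ∈ Icc (0 : ℝ) 1, ∀ ρ ∈ Γ, ρ ≠ ρ₀ u →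
      limitLoss law r φ ζ f (u, g u, ρ₀ u) < limitLoss law r φ ζ f (u, g u, ρ) := by
    intro u hu ρ hρ hne
    obtain ⟨⟨hmem, -⟩, hsep⟩ := hρ₀ u hu
    obtain ⟨η, hη, hgap⟩ := hsep (‖ρ - ρ₀ u‖ / 2) (half_pos (norm_pos_iff.2 (sub_ne_zero.2 hne)))
    have hη' := hgap ρ hρ (half_lt_self (norm_pos_iff.2 (sub_ne_zero.2 hne)))
    by_contra hcon
    rw [not_lt] at hcon
    have hle : M u ρ - M u (ρ₀ u) ≤ 2 * (η / 3) := by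
      refine le_of_tendsto ((hM u hu ρ hρ).sub (hM u hu _ hmem)) ?_
      filter_upwards [hbias (η / 3) (by positivity), eventually_ge_atTop 1] with T hT hT1
      have h1 := abs_le.1 (hT u hu ρ hρ)
      have h2 := abs_le.1 (hT u hu _ hmem)
      have h3 := mul_le_mul_of_nonneg_left hcon (hK.kernelMass_nonneg (hh.pos T hT1).le u)
      linarith [h1.2, h2.1]
    linarith
  obtain ⟨c, hc, hmass⟩ := hK.eventually_le_kernelMass hh.pos hh.tendsto_zero hh.tendsto_mul
  refine isLittleOP_of_highProb fun ε hε => ?_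
  obtain ⟨η, hη, hgap⟩ := exists_uniform_gap (Q := Icc (0 : ℝ) 1) isCompact_Icc hΓ
    (F := fun u ρ => limitLoss law r φ ζ f (u, g u, ρ)) (s := ρ₀)
    ((hs.continuousOn_limitLoss hf hl hDx).comp
      (f := fun x : ℝ × Vec dρ => (x.1, g x.1, x.2)) (by fun_prop)
      fun x hx => ⟨hx.1, hgΘ _ hx.1, hx.2⟩)
    (fun u hu => (hρ₀ u hu).1.1) huniq hε
  -- The factor `7` of the concentration bound turns this into `c * η / 5`. Two stochastic and two
  -- bias errors of that size total `4/5` of `c * η`, the least gap once the kernel mass is at least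
  -- `c`.
  have hcη : 0 < c * η / 35 := by positivity
  refine (hl.highProb_localCriterion hB hf hY hZ hD hmix hK hh hcη).mono ?_
  filter_upwards [eventually_ge_atTop 1, hmass, hbias (c * η / 5) (by positivity)]
    with T hT hmassT hbiasT
  filter_upwards [hρhat T hT] with ω hω hgood
  refine iSup₂_le fun u hu => ?_
  obtain ⟨hmem, hmin⟩ := hω u hu
  have hu' := hU T hu
  have hmem0 := (hρ₀ u hu').1.1
  have h1 := abs_le.1 (hgood u hu' _ hmem)
  have h2 := abs_le.1 (hgood u hu' _ hmem0)
  have h3 := abs_le.1 (hbiasT u hu' _ hmem)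
  have h4 := abs_le.1 (hbiasT u hu' _ hmem0)
  have h5 : localCriterion f K h Y Z T u ω (ρhat T ω u) ≤
    localCriterion f K h Y Z T u ω (ρ₀ u) := hmin hmem0
  rw [← ofReal_norm]
  refine ENNReal.ofReal_le_ofReal ?_
  by_contra hcon
  rw [not_le, ← dist_eq_norm] at hcon
  have h6 := hgap u hu' _ hmem hcon.le
  have h7 := mul_le_mul (hmassT u hu') h6 hη.le (hc.le.trans (hmassT u hu'))
  have h8 : 0 < c * η := by positivity
  linarith [h1.1, h1.2, h2.1, h2.2, h3.1, h3.2, h4.1, h4.2]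

end Consistency

end LocalII

open LocalII in
theorem corollary1
    {Ω : Type*} [MeasurableSpace Ω] (μ : Measure Ω) [IsProbabilityMeasure μ]
    {S : Type*} [MeasurableSpace S] (law : Measure S) [IsProbabilityMeasure law]
    {p dz dρ : ℕ} (hdim : p ≤ dρ)
    -- compact parameter spaces, trimming `δ_T = o(1)`
    (Θ : Set (Vec p)) (hΘ : IsCompact Θ) (Γ : Set (Vec dρ)) (hΓ : IsCompact Γ)
    (δ : ℕ → ℝ) (hδ : ∀ T, 0 < δ T ∧ δ T < 1 / 2) (hδ_lim : Tendsto δ atTop (𝓝 0))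
    -- structural model: innovations, simulated innovations, structural functions, true curve
    (ν ν' : ℤ → Ω → S) (hν : IsIID μ law ν) (hν' : IsIID μ law ν')
    (r : ℝ × Vec p → ℝ) (φ : (ℕ → S) → Vec p → ℝ) (ζ : (ℕ → S) → ℝ → Vec p → Vec dz)
    (hstruct : SmoothStructure law Θ r φ ζ)
    (θ₀ : ℝ → Vec p) (hθ₀ : ∀ u ∈ Icc (0 : ℝ) 1, θ₀ u ∈ Θ) (hθ₀_smooth : SmoothCurve θ₀)
    (hweak : ∀ θ ∈ Θ, IsWeaklyStationary μ (fun t ω => structY r φ (history ν t ω) θ))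
    -- observed arrays: locally stationary around the structural processes, and mixing
    (Y : ℕ → ℕ → Ω → ℝ) (Z : ℕ → ℕ → Ω → Vec dz)
    (hY : ∀ T t, Measurable (Y T t)) (hZ : ∀ T t, Measurable (Z T t))
    (hY_ls : IsLocallyStationary μ Y (fun u t ω => structY r φ (history ν t ω) (θ₀ u)))
    (hZ_ls : IsLocallyStationary μ Z (fun u t ω => ζ (history ν t ω) u (θ₀ u)))
    (m : ℕ → ℕ) (hmix : IsPhiMixing μ Y Z m)
    -- kernel and bandwidth
    (K : ℝ → ℝ) (hK : IsKernel K) (h : ℕ → ℝ) (hh : IsBandwidth h m)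
    -- regression function and squared loss
    (f : Vec dz → Vec dρ → ℝ) (hf : IsRegressionFunction Γ f)
    (hloss : SmoothBoundedLoss μ law Θ Γ r φ ζ Y Z f)
    -- limit criterion and pseudo-true curve of the observed data
    (M₀ : ℝ → Vec dρ → ℝ)
    (hM₀ : ∀ u ∈ Icc (0 : ℝ) 1, ∀ ρ ∈ Γ,
      Tendsto (fun T => ∫ ω, localCriterion f K h Y Z T u ω ρ ∂μ) atTop (𝓝 (M₀ u ρ)))
    (ρ₀ : ℝ → Vec dρ) (hρ₀ : ∀ u ∈ Icc (0 : ℝ) 1, IsWellSeparatedMin (M₀ u) Γ (ρ₀ u))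
    (hequi : EquicontinuousLoss μ Γ f (fun u t ω => structY r φ (history ν t ω) (θ₀ u))
      (fun u t ω => ζ (history ν t ω) u (θ₀ u)) ρ₀)
    -- limit criterion and pseudo-true map of the simulated data
    (M₀' : ℝ → Vec p → Vec dρ → ℝ)
    (hM₀' : ∀ u ∈ Icc (0 : ℝ) 1, ∀ θ ∈ Θ, ∀ ρ ∈ Γ,
      Tendsto (fun T : ℕ => 1 / (T : ℝ) * ∑ t ∈ Finset.Icc 1 T,
        ∫ ω, sqLoss f (structY r φ (history ν' t ω) θ) (ζ (history ν' t ω) u θ) ρ ∂μ)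
        atTop (𝓝 (M₀' u θ ρ)))
    (ρ₀' : ℝ → Vec p → Vec dρ)
    (hρ₀' : ∀ u ∈ Icc (0 : ℝ) 1, ∀ θ ∈ Θ, IsArgmin (M₀' u θ) Γ (ρ₀' u θ) ∧
      ∀ ρ, IsArgmin (M₀' u θ) Γ ρ → ρ = ρ₀' u θ)
    (hρ₀'_cont : ∀ u ∈ Icc (0 : ℝ) 1, ContinuousOn (ρ₀' u) Θ)
    (hρ₀'_inj : ∀ u ∈ Icc (0 : ℝ) 1, InjOn (ρ₀' u) Θ)
    -- the two auxiliary estimators: any choice of minimizers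
    (ρhat : ℕ → Ω → ℝ → Vec dρ)
    (hρhat : ∀ T, 1 ≤ T → ∀ᵐ ω ∂μ, ∀ u ∈ Icc (δ T) (1 - δ T),
      IsArgmin (localCriterion f K h Y Z T u ω) Γ (ρhat T ω u))
    (ρhat' : ℕ → Ω → ℝ → Vec p → Vec dρ)
    (hρhat' : ∀ T, 1 ≤ T → ∀ᵐ ω ∂μ, ∀ u ∈ Icc (δ T) (1 - δ T), ∀ θ ∈ Θ,
      IsArgmin (simCriterion f (fun t ω => structY r φ (history ν' t ω) θ)
        (fun t ω => ζ (history ν' t ω) u θ) T ω) Γ (ρhat' T ω u θ)) :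
    IsLittleOP μ (fun T ω => ⨆ u ∈ Icc (δ T) (1 - δ T), ‖ρhat T ω u - ρ₀ u‖ₑ) ∧
    IsLittleOP μ (fun T ω => ⨆ u ∈ Icc (δ T) (1 - δ T), ⨆ θ ∈ Θ,
      ‖ρhat' T ω u θ - ρ₀' u θ‖ₑ) := by
  obtain ⟨D, V, C, hDo, hDc, hVo, hΓV, hD, hDx, hcd, hC⟩ := hloss
  have hl : RegularLoss D Γ f (C ^ 2) C :=
    regularLoss_of_contDiffOn hDo hDc hVo hΓ hΓV hcd fun q hq => hC q hq 1 (by simp)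
  have hU : ∀ T, Icc (δ T) (1 - δ T) ⊆ Icc (0 : ℝ) 1 := fun T =>
    Icc_subset_Icc (hδ T).1.le (by linarith [(hδ T).1])
  exact ⟨isLittleOP_observed hl (sq_nonneg C) hΘ hΓ hν hstruct hf hDx hθ₀ hθ₀_smooth hY hZ hD
      hY_ls hZ_ls hmix hK hh hM₀ hρ₀ hU hρhat,
    isLittleOP_simulated hν' hΘ hΓ hstruct hf hl (sq_nonneg C) hDx hM₀' hρ₀' hU hρhat'⟩
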